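/- **Setting.** Let $m\ge 2$ agents be the vertices of a connected undirected graph $G$ with Laplacian $\bar W$. Let $C\in\mathbb R^{n\times n}$ be a cost matrix with $\|C\|_\infty=\max_{i,j}|C_{ij}|$, let $q_1,\dots,q_m$ lie in the standard probability simplex $S_n(1)$, and let $\mu>0$. For $p,q\in S_n(1)$ put $$\mathcal W_{\mu,q}(p)=\min\{\langle C,\pi\rangle+\mu\langle\pi,\ln\pi\rangle:\ \pi\ge 0,\ \pi\mathbf 1=p,\ \pi^T\mathbf 1=q\},$$ with conjugate $\mathcal W^*_{q,\mu}(u)=\mu\sum_j q_j\ln\big(\tfrac1{q_j}\sum_i e^{(-C_{ij}+u_i)/\mu}\big)$. The (regularized) Wasserstein barycenter problem is $\min_{p\in S_n(1)}\sum_{i=1}^m\mathcal W_{\mu,q_i}(p)$. Put $W=\bar W\otimes I_n$; let $\lambda_{\max}(W)$ be its largest and $\lambda^+_{\min}(W)$ its smallest non-zero eigenvalue, and $$\chi=\frac{\lambda_{\max}(W)}{\lambda^+_{\min}(W)},\quad M_F^2=2nm\|C\|_\infty^2,\quad L_\psi=\frac{\lambda_{\max}(W)}{\mu},\quad \sigma_\psi^2=m\lambda_{\max}(W),\quad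 S=\sqrt{\frac{M_F^2}{\mu\varepsilon}\chi}.$$ The dual problem is $\min_{\mathbf y\in\mathbb R^{nm}}\psi(\mathbf y)$, where $\psi(\mathbf y)=\sum_i\mathcal W^*_{q_i,\mu}([\sqrt W\mathbf y]_i)$. **Algorithm.** For one sample $\xi$, node $i$ selects an index $j=\xi_i$ with probability $(q_i)_j$; set $[\mathbf x(\mathbf u,\xi)]_{i,l}=e^{(-C_{lj}+u_{i,l})/\mu}\big/\sum_{l'}e^{(-C_{l'j}+u_{i,l'})/\mu}$, so that $\sqrt W\mathbf x(\sqrt W\mathbf y,\xi)$ is a stochastic gradient of $\psi$ at $\mathbf y$. Let $\mathbf x(\mathbf u,\{\xi_s\}_{s=1}^r)$ be the average over $r$ independent samples. Start from $\zeta^0=\mathbf y^0=0$, $A_0=\alpha_0=0$. For $k=0,\dots,N-1$ let $\alpha_{k+1}>0$ solve $A_{k+1}=A_k+\alpha_{k+1}=2L_\psi\alpha_{k+1}^2$ and set $$\lambda^{k+1}=\tfrac{\alpha_{k+1}\zeta^k+A_k\mathbf y^k}{A_{k+1}},\quad \zeta^{k+1}=\zeta^k-\alpha_{k+1}\sqrt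 W\,\mathbf x\big(\sqrt W\lambda^{k+1},\{\xi^{k+1}_s\}_{s=1}^{r_{k+1}}\big),\quad \mathbf y^{k+1}=\tfrac{\alpha_{k+1}\zeta^{k+1}+A_k\mathbf y^k}{A_{k+1}},$$ with fresh samples in every iteration. The output is $\mathtt p^N=\frac1{A_N}\sum_{k=1}^N\alpha_k\,\mathbf x(\sqrt W\lambda^k,\{\xi^k_s\}_{s=1}^{r_k})$. **Corollary (Wasserstein barycenters).** There are absolute constants $c_N,c_r>0$ such that the following holds for all data as above, all $\varepsilon>0$, $\delta\in(0,\frac14)$, all $N\ge1$ with $N\ge c_N S$, and all batch sizes $$r_k\ \ge\ c_r\max\Big\{1,\ \frac{\sigma_\psi^2\,\alpha_k\ln(N/\delta)}{\varepsilon}\Big\},\qquad k=1,\dots,N.$$ 1. The dual problem has an optimal solution $\mathbf y^*$ with $\|\mathbf y^*\|_2\le M_F/\sqrt{\lambda^+_{\min}(W)}$, and the barycenter problem has a solution $p^*$. For every $R_{\mathbf y}$ with $R_{\mathbf y}\le M_F/\sqrt{\lambda^+_{\min}(W)}$ that bounds the norm of some dual optimal solution, with probability at least $1-4\delta$, $$\sum_{i=1}^m\mathcal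 W_{\mu,q_i}(\mathtt p^N_i)-\sum_{i=1}^m\mathcal W_{\mu,q_i}(p^*)\le\varepsilon\qquad\text{and}\qquad\|\sqrt W\,\mathtt p^N\|_2\le\frac{\varepsilon}{R_{\mathbf y}}$$ (the second inequality being void if $R_{\mathbf y}=0$). 2. If $S\ge 1$ and $N$ and $r_k$ are of these orders, that is, $N\le\kappa S$ and $r_k\le\kappa\max\{1,\sigma_\psi^2\alpha_k\ln(N/\delta)/\varepsilon\}$ for a constant $\kappa$, then the total complexity of every node (arithmetic operations for its stochastic oracle calls and its local updates, where drawing an index costs $n$ operations, in the implementation with one communication round per iteration; the work of the $N$ communication rounds themselves is not included) is at most $$c_T\; n\,\max\Big\{\frac{mM_F^2}{\varepsilon^2}\,\chi\,\ln\Big(\frac1\delta\sqrt{\frac{M_F^2}{\mu\varepsilon}\chi}\Big),\ \sqrt{\frac{M_F^2}{\mu\varepsilon}\chi}\Big\},$$ where $c_T$ depends only on $\kappa$. -/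

import Mathlib

open MeasureTheory ProbabilityTheory

namespace WBary

noncomputable section

open scoped MatrixOrder Kronecker

/-! ## Entropically regularized optimal transport -/

/-- Nonnegative matrices with row sums `p` and column sums `q`. -/
def transportPlans {n : ℕ} (p q : Fin n → ℝ) : Set (Matrix (Fin n) (Fin n) ℝ) :=
  {π | (∀ i j, 0 ≤ π i j) ∧ (∀ i, ∑ j, π i j = p i) ∧ ∀ j, ∑ i, π i j = q j}

/-- `⟨C, π⟩ + μ ⟨π, ln π⟩`, with `0 ln 0 = 0`. -/
def transportCost {n : ℕ} (μ : ℝ) (C π : Matrix (Fin n) (Fin n) ℝ) : ℝ :=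
  ∑ i, ∑ j, C i j * π i j + μ * ∑ i, ∑ j, π i j * Real.log (π i j)

/-- The regularized Wasserstein distance `𝒲_{μ,q}(p)`.  For `p, q` in the simplex the infimum is
a minimum, see `regW_isLeast`. -/
def regW {n : ℕ} (μ : ℝ) (C : Matrix (Fin n) (Fin n) ℝ) (q p : Fin n → ℝ) : ℝ :=
  sInf (transportCost μ C '' transportPlans p q)

lemma regW_isLeast {n : ℕ} (μ : ℝ) (C : Matrix (Fin n) (Fin n) ℝ) {q p : Fin n → ℝ}
    (hq : q ∈ stdSimplex ℝ (Fin n)) (hp : p ∈ stdSimplex ℝ (Fin n)) :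
    IsLeast (transportCost μ C '' transportPlans p q) (regW μ C q p) := by
  have hne : (transportPlans p q).Nonempty := by
    refine ⟨fun i j => p i * q j, fun i j => mul_nonneg (hp.1 i) (hq.1 j), fun i => ?_, fun j => ?_⟩
    · rw [← Finset.mul_sum, hq.2, mul_one]
    · rw [← Finset.sum_mul, hp.2, one_mul]
  have hcl : IsClosed (transportPlans p q) := by
    have h1 : IsClosed {π : Matrix (Fin n) (Fin n) ℝ | ∀ i j, 0 ≤ π i j} := by
      simp only [Set.ofPred_forall]
      exact isClosed_iInter fun i => isClosed_iInter fun j =>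
        isClosed_le continuous_const (by fun_prop)
    have h2 : IsClosed {π : Matrix (Fin n) (Fin n) ℝ | ∀ i, ∑ j, π i j = p i} := by
      simp only [Set.ofPred_forall]
      exact isClosed_iInter fun i => isClosed_eq (by fun_prop) continuous_const
    have h3 : IsClosed {π : Matrix (Fin n) (Fin n) ℝ | ∀ j, ∑ i, π i j = q j} := by
      simp only [Set.ofPred_forall]
      exact isClosed_iInter fun i => isClosed_eq (by fun_prop) continuous_const
    exact h1.inter (h2.inter h3)
  have hsub : transportPlans p q ⊆
      Set.pi Set.univ fun i => Set.pi Set.univ fun _ : Fin n => Set.Icc (0 : ℝ) (p i) := by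
    rintro π ⟨h0, hr, -⟩ i - j -
    exact ⟨h0 i j, (hr i) ▸ Finset.single_le_sum (fun l _ => h0 i l) (Finset.mem_univ j)⟩
  have hcomp : IsCompact (transportPlans p q) :=
    (isCompact_univ_pi fun i => isCompact_univ_pi fun _ => isCompact_Icc).of_isClosed_subset
      hcl hsub
  have hcont : Continuous (transportCost μ C) := by
    unfold transportCost
    have h (i j : Fin n) : Continuous fun π : Matrix (Fin n) (Fin n) ℝ =>
        π i j * Real.log (π i j) :=
      Real.continuous_mul_log.comp (by fun_prop : Continuous fun π : Matrix (Fin n) (Fin n) ℝ =>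
        π i j)
    refine Continuous.add (by fun_prop) (continuous_const.mul ?_)
    exact continuous_finsetSum _ fun i _ => continuous_finsetSum _ fun j _ => h i j
  exact (hcomp.image hcont).isLeast_sInf (hne.image _)

/-- The `j`-th component `u ↦ μ ln ((1/q_j) ∑_i exp((-C_{ij} + u_i)/μ))` of the conjugate. -/
def conjComp {n : ℕ} (μ : ℝ) (C : Matrix (Fin n) (Fin n) ℝ) (q : Fin n → ℝ) (j : Fin n)
    (u : Fin n → ℝ) : ℝ :=
  μ * Real.log (1 / q j * ∑ i, Real.exp ((-C i j + u i) / μ))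

/-- The conjugate `𝒲*_{q,μ}(u) = μ ∑_j q_j ln ((1/q_j) ∑_i exp((-C_{ij} + u_i)/μ))`. -/
def conjW {n : ℕ} (μ : ℝ) (C : Matrix (Fin n) (Fin n) ℝ) (q u : Fin n → ℝ) : ℝ :=
  ∑ j, q j * conjComp μ C q j u

/-- The gradient of `conjComp μ C q j` at `u`, see `conjComp_hasGradientAt`. -/
def compGrad {n : ℕ} (μ : ℝ) (C : Matrix (Fin n) (Fin n) ℝ) (u : Fin n → ℝ) (j : Fin n) :
    Fin n → ℝ :=
  fun i => Real.exp ((-C i j + u i) / μ) / ∑ l, Real.exp ((-C l j + u l) / μ)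

lemma conjComp_hasGradientAt {n : ℕ} {μ : ℝ} (hμ : μ ≠ 0) (C : Matrix (Fin n) (Fin n) ℝ)
    (q : Fin n → ℝ) (j : Fin n) (hq : q j ≠ 0) (u : EuclideanSpace ℝ (Fin n)) :
    HasGradientAt (fun v : EuclideanSpace ℝ (Fin n) => conjComp μ C q j v.ofLp)
      (WithLp.toLp 2 (compGrad μ C u.ofLp j)) u := by
  have hpos : 0 < ∑ i, Real.exp ((-C i j + u i) / μ) :=
    Finset.sum_pos (fun i _ => Real.exp_pos _) ⟨j, Finset.mem_univ j⟩
  have h1 (i : Fin n) : HasFDerivAt (fun v : EuclideanSpace ℝ (Fin n) => (-C i j + v i) / μ)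
      (μ⁻¹ • (EuclideanSpace.proj i : EuclideanSpace ℝ (Fin n) →L[ℝ] ℝ)) u := by
    have := ((EuclideanSpace.proj i : EuclideanSpace ℝ (Fin n) →L[ℝ] ℝ).hasFDerivAt
      (x := u)).const_add (-C i j)
    simpa [div_eq_inv_mul] using this.const_mul μ⁻¹
  have h2 := (((HasFDerivAt.fun_sum (u := Finset.univ) fun i _ => (h1 i).exp).const_mul
    (1 / q j)).log (by positivity)).const_mul μ
  rw [hasGradientAt_iff_hasFDerivAt]
  refine h2.congr_fderiv ?_
  ext v
  simp only [InnerProductSpace.toDual_apply_apply, PiLp.inner_apply, compGrad,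
    smul_apply, sum_apply, smul_eq_mul, PiLp.proj_apply, RCLike.inner_apply, conj_trivial, Finset.mul_sum]
  refine Finset.sum_congr rfl fun i _ => ?_
  rw [← Finset.mul_sum]
  field_simp

/-! ## Networks and the stacked space `ℝ^{nm}` -/

/-- The data: regularization `μ`, cost matrix `C`, measures `q_1, …, q_m` on `n` points,
and the communication graph. -/
structure BaryProblem (m n : ℕ) where
  mu : ℝ
  C : Matrix (Fin n) (Fin n) ℝ
  q : Fin m → Fin n → ℝ
  G : SimpleGraph (Fin m)

/-- The stacked space, with its Euclidean norm. -/
abbrev Stacked (m n : ℕ) : Type := EuclideanSpace ℝ (Fin m × Fin n)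

/-- The `i`-th `n`-dimensional block. -/
def block {m n : ℕ} (x : Stacked m n) (i : Fin m) : Fin n → ℝ := fun j => x (i, j)

namespace BaryProblem

variable {m n : ℕ} (P : BaryProblem m n)

/-- The graph Laplacian `W̄`. -/
def lap : Matrix (Fin m) (Fin m) ℝ := by
  classical exact P.G.lapMatrix ℝ

/-- `W = W̄ ⊗ I_n`. -/
def W : Matrix (Fin m × Fin n) (Fin m × Fin n) ℝ := P.lap ⊗ₖ (1 : Matrix (Fin n) (Fin n) ℝ)

/-- `√W`, the positive semidefinite square root, as an operator on the stacked space. -/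
def sqrtW : Stacked m n →ₗ[ℝ] Stacked m n := Matrix.toEuclideanLin (CFC.sqrt P.W)

/-- `λ_max(W)`. -/
def lamMax : ℝ := sSup (spectrum ℝ P.W)

/-- `λ⁺_min(W)`, the smallest non-zero eigenvalue (`W` is positive semidefinite). -/
def lamMinPos : ℝ := sInf (spectrum ℝ P.W ∩ Set.Ioi 0)

/-- The condition number `χ(W)`. -/
def chi : ℝ := P.lamMax / P.lamMinPos

/-- `‖C‖_∞ = max_{i,j} |C_{ij}|`. -/
def normC : ℝ := ⨆ ij : Fin n × Fin n, |P.C ij.1 ij.2|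

/-- `M_F`, where `M_F² = 2 n m ‖C‖_∞²`. -/
def MF : ℝ := Real.sqrt (2 * n * m * P.normC ^ 2)

/-- `L_ψ = λ_max(W)/μ`. -/
def Lpsi : ℝ := P.lamMax / P.mu

/-- `σ_ψ² = m λ_max(W)`. -/
def sigmaPsiSq : ℝ := m * P.lamMax

/-- The barycenter objective `p ↦ ∑_i 𝒲_{μ,q_i}(p)`. -/
def objective (p : Fin n → ℝ) : ℝ := ∑ i, regW P.mu P.C (P.q i) p

/-- `p*` is a regularized Wasserstein barycenter. -/
def IsBarycenter (p : Fin n → ℝ) : Prop :=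
  p ∈ stdSimplex ℝ (Fin n) ∧ IsMinOn P.objective (stdSimplex ℝ (Fin n)) p

/-- The dual objective `ψ(y) = ∑_i 𝒲*_{q_i,μ}([√W y]_i)`. -/
def psi (y : Stacked m n) : ℝ := ∑ i, conjW P.mu P.C (P.q i) (block (P.sqrtW y) i)

/-- `y*` is an optimal solution of the dual problem. -/
def IsDualSolution (y : Stacked m n) : Prop := IsMinOn P.psi Set.univ y

end BaryProblem

/-! ## The dual stochastic accelerated method -/

/-- The positive root `α` of `A + α = 2 L α²`. -/
def stepRoot (L A : ℝ) : ℝ := (1 + Real.sqrt (1 + 8 * L * A)) / (4 * L)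

/-- `A_k`. -/
def bigA (L : ℝ) : ℕ → ℝ
  | 0 => 0
  | k + 1 => bigA L k + stepRoot L (bigA L k)

/-- `α_k`, with `α_0 = 0`. -/
def alpha (L : ℝ) : ℕ → ℝ
  | 0 => 0
  | k + 1 => stepRoot L (bigA L k)

lemma bigA_nonneg {L : ℝ} (hL : 0 < L) (k : ℕ) : 0 ≤ bigA L k := by
  induction k with
  | zero => exact le_rfl
  | succ k ih => simp only [bigA, stepRoot]; positivity

/-- `A_{k+1} = A_k + α_{k+1} = 2 L α_{k+1}²` with `α_{k+1} > 0`. -/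
lemma alpha_spec {L : ℝ} (hL : 0 < L) (k : ℕ) : 0 < alpha L (k + 1) ∧
    bigA L (k + 1) = bigA L k + alpha L (k + 1) ∧
    bigA L k + alpha L (k + 1) = 2 * L * alpha L (k + 1) ^ 2 := by
  have hA := bigA_nonneg hL k
  refine ⟨by simp only [alpha, stepRoot]; positivity, rfl, ?_⟩
  have hs := Real.sq_sqrt (show 0 ≤ 1 + 8 * L * bigA L k by positivity)
  simp only [alpha, stepRoot]
  set s := Real.sqrt (1 + 8 * L * bigA L k)
  have hA' : bigA L k = (s ^ 2 - 1) / (8 * L) := by rw [hs]; field_simp; ring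
  rw [hA']
  field_simp
  ring

/-- `λ^k, ζ^k, y^k`. -/
structure DualState (m n : ℕ) where
  lam : Stacked m n
  zeta : Stacked m n
  y : Stacked m n

namespace BaryProblem

variable {m n : ℕ} (P : BaryProblem m n)

/-- The batched primal estimate `x(u, {ξ_s}_{s<r}) = (1/r) ∑_s x(u, ξ_s)`, where a realization `ξ`
selects one component for each node: `[x(u, ξ)]_i = ∇(conjComp of q_i, component ξ i)(u_i)`.
Thus `√W x(√W y, ξ) = ∇ψ(y, ξ)`. -/
def batchX (r : ℕ) (ξ : ℕ → Fin m → Fin n) (u : Stacked m n) : Stacked m n :=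
  WithLp.toLp 2 fun ij =>
    (∑ s ∈ Finset.range r, compGrad P.mu P.C (block u ij.1) (ξ s ij.1) ij.2) / r

/-- The iterates; `r k` is the batch size and `ξ k` the samples of iteration `k`. -/
def iterate (r : ℕ → ℕ) (ξ : ℕ → ℕ → Fin m → Fin n) : ℕ → DualState m n
  | 0 => ⟨0, 0, 0⟩
  | k + 1 =>
    let s := iterate r ξ k
    let a := alpha P.Lpsi (k + 1)
    let A := bigA P.Lpsi k
    let A' := bigA P.Lpsi (k + 1)
    let lam := A'⁻¹ • (a • s.zeta + A • s.y)
    let zeta := s.zeta - a • P.sqrtW (P.batchX (r (k + 1)) (ξ (k + 1)) (P.sqrtW lam))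
    ⟨lam, zeta, A'⁻¹ • (a • zeta + A • s.y)⟩

/-- The output `p^N = (1/A_N) ∑_{k=0}^N α_k x(√W λ^k, {ξ^k_s}_{s<r_k})`. -/
def output (r : ℕ → ℕ) (ξ : ℕ → ℕ → Fin m → Fin n) (N : ℕ) : Stacked m n :=
  (bigA P.Lpsi N)⁻¹ • ∑ k ∈ Finset.range (N + 1), alpha P.Lpsi k •
    P.batchX (r k) (ξ k) (P.sqrtW (P.iterate r ξ k).lam)

end BaryProblem

/-- The samples `ξ^k_s` are independent, and node `i` selects component `j` with probability
`q_i(j)`.  (The choices of different nodes within one sample may depend on each other.) -/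
structure IsSampling {m n : ℕ} (q : Fin m → Fin n → ℝ) {Ω : Type*} [MeasurableSpace Ω]
    (Pr : Measure Ω) (ξ : ℕ → ℕ → Ω → Fin m → Fin n) : Prop where
  measurable : ∀ k s, Measurable (ξ k s)
  law : ∀ k s i j, Pr.real {ω | ξ k s ω i = j} = q i j
  indep : iIndepFun (fun ks : ℕ × ℕ => ξ ks.1 ks.2) Pr

/-! ## Operation counts: the method as executed by the nodes of the network -/

/-- A value together with the number of operations spent on computing it. -/
structure Counted (α : Type) where
  val : α
  ops : ℕ

namespace Counted

instance : Monad Counted where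
  pure a := ⟨a, 0⟩
  bind x f := ⟨(f x.val).val, x.ops + (f x.val).ops⟩

/-- Real arithmetic, one operation each. -/
def add (a b : ℝ) : Counted ℝ := ⟨a + b, 1⟩
def sub (a b : ℝ) : Counted ℝ := ⟨a - b, 1⟩
def mul (a b : ℝ) : Counted ℝ := ⟨a * b, 1⟩
def div (a b : ℝ) : Counted ℝ := ⟨a / b, 1⟩
def exp (a : ℝ) : Counted ℝ := ⟨Real.exp a, 1⟩
def sqrt (a : ℝ) : Counted ℝ := ⟨Real.sqrt a, 1⟩

/-- Drawing an index in `{1, …, n}` from a given distribution (the drawn index is supplied):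
`n` operations. -/
def draw {n : ℕ} (j : Fin n) : Counted (Fin n) := ⟨j, n⟩

/-- Computing a vector entry by entry. -/
def vec {n : ℕ} (f : Fin n → Counted ℝ) : Counted (Fin n → ℝ) :=
  ⟨fun i => (f i).val, ∑ i, (f i).ops⟩

/-- Summing the entries of a vector: `n` additions to an accumulator. -/
def sum {n : ℕ} (f : Fin n → ℝ) : Counted ℝ := ⟨∑ i, f i, n⟩

/-- `for s in {0, …, r-1}`. -/
def loop {α : Type} : ℕ → (ℕ → α → Counted α) → α → Counted α
  | 0, _, a => pure a
  | r + 1, f, a => do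
    let b ← loop r f a
    f r b

@[simp] lemma pure_val {α : Type} (a : α) : (pure a : Counted α).val = a := rfl
@[simp] lemma bind_val {α β : Type} (x : Counted α) (f : α → Counted β) :
    (x >>= f).val = (f x.val).val := rfl

end Counted

open Counted

/-- One call of the stochastic oracle of a node: draw a component and evaluate its gradient. -/
def oracleProg {n : ℕ} (μ : ℝ) (C : Matrix (Fin n) (Fin n) ℝ) (u : Fin n → ℝ) (j : Fin n) :
    Counted (Fin n → ℝ) := do
  let l ← draw j
  let e ← vec fun i => do
    let a ← sub (u i) (C i l)
    let b ← div a μ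
    exp b
  let s ← sum e
  vec fun i => div (e i) s

/-- The average of `r` oracle calls. -/
def batchProg {n : ℕ} (μ : ℝ) (C : Matrix (Fin n) (Fin n) ℝ) (r : ℕ) (ξ : ℕ → Fin n)
    (u : Fin n → ℝ) : Counted (Fin n → ℝ) := do
  let s ← loop r (fun t acc => do
    let x ← oracleProg μ C u (ξ t)
    vec fun i => add (acc i) (x i)) 0
  vec fun i => div (s i) r

/-- `(a z + A y)/A'`. -/
def combineProg {n : ℕ} (a A A' : ℝ) (z y : Fin n → ℝ) : Counted (Fin n → ℝ) :=
  vec fun i => do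
    let s ← mul a (z i)
    let t ← mul A (y i)
    let w ← add s t
    div w A'

/-- `α_{k+1}` from `A_k`. -/
def stepProg (L A : ℝ) : Counted ℝ := do
  let b ← mul 8 L
  let c ← mul b A
  let d ← add 1 c
  let e ← sqrt d
  let f ← add 1 e
  let g ← mul 4 L
  div f g

/-- What a node stores: its blocks of `√W ζ^k`, `√W y^k` and `∑_{l ≤ k} α_l x^l`, and `A_k`. -/
structure NodeState (n : ℕ) where
  zetaBar : Fin n → ℝ
  yBar : Fin n → ℝ
  acc : Fin n → ℝ
  A : ℝ

/-- What a node computes before a communication round: `α_{k+1}`, `A_{k+1}` and its block of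
`x^{k+1}`, which it then sends to its neighbours. -/
structure NodeMessage (n : ℕ) where
  a : ℝ
  A' : ℝ
  x : Fin n → ℝ

namespace BaryProblem

variable {m n : ℕ} (P : BaryProblem m n)

/-- Local work of a node before the communication round. -/
def beforeProg (r : ℕ) (ξ : ℕ → Fin n) (s : NodeState n) : Counted (NodeMessage n) := do
  let a ← stepProg P.Lpsi s.A
  let A' ← add s.A a
  let lamBar ← combineProg a s.A A' s.zetaBar s.yBar
  let x ← batchProg P.mu P.C r ξ lamBar
  pure ⟨a, A', x⟩

/-- Local work of a node after the communication round, which delivers `g = ∑_j W̄_{ij} x_j`. -/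
def afterProg (s : NodeState n) (w : NodeMessage n) (g : Fin n → ℝ) : Counted (NodeState n) := do
  let zetaBar ← vec fun j => do
    let b ← mul w.a (g j)
    sub (s.zetaBar j) b
  let yBar ← combineProg w.a s.A w.A' zetaBar s.yBar
  let acc ← vec fun j => do
    let b ← mul w.a (w.x j)
    add (s.acc j) b
  pure ⟨zetaBar, yBar, acc, w.A'⟩

/-- The state of node `i` after `k` iterations (one communication round each), with the number of
operations that node `i` has executed. -/
def nodeRun (r : ℕ → ℕ) (ξ : ℕ → ℕ → Fin m → Fin n) : ℕ → Fin m → Counted (NodeState n)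
  | 0, _ => pure ⟨0, 0, 0, 0⟩
  | k + 1, i => do
    let s ← nodeRun r ξ k i
    let w ← P.beforeProg (r (k + 1)) (fun t => ξ (k + 1) t i) s
    afterProg s w (∑ j, P.lap i j •
      (P.beforeProg (r (k + 1)) (fun t => ξ (k + 1) t j) (nodeRun r ξ k j).val).val.x)

/-- Node `i`'s computation of its block of the output. -/
def nodeOutput (r : ℕ → ℕ) (ξ : ℕ → ℕ → Fin m → Fin n) (N : ℕ) (i : Fin m) :
    Counted (Fin n → ℝ) := do
  let s ← P.nodeRun r ξ N i
  vec fun j => div (s.acc j) s.A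

lemma sqrtW_sqrtW_block (x : Stacked m n) (i : Fin m) :
    block (P.sqrtW (P.sqrtW x)) i = ∑ j, P.lap i j • block x j := by
  have hpsd : P.W.PosSemidef := by
    classical
    have h : P.lap.PosSemidef := by
      unfold lap
      convert SimpleGraph.posSemidef_lapMatrix ℝ P.G
    exact h.kronecker Matrix.PosSemidef.one
  have hs : CFC.sqrt P.W * CFC.sqrt P.W = P.W := CFC.sqrt_mul_sqrt_self _ hpsd.nonneg
  funext k
  simp only [block, sqrtW, Matrix.toLpLin_apply, Matrix.mulVec_mulVec, hs]
  simp [Matrix.mulVec, dotProduct, W, Matrix.kroneckerMap_apply, Fintype.sum_prod_type,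
    Matrix.one_apply, Finset.sum_apply, block]

lemma loop_batch_val (μ : ℝ) (C : Matrix (Fin n) (Fin n) ℝ) (r : ℕ) (ξ : ℕ → Fin n)
    (u : Fin n → ℝ) : (batchProg μ C r ξ u).val =
      fun j => (∑ s ∈ Finset.range r, compGrad μ C u (ξ s) j) / r := by
  have key : ∀ r : ℕ, (loop r (fun t acc => do
      let x ← oracleProg μ C u (ξ t)
      vec fun i => add (acc i) (x i)) (0 : Fin n → ℝ)).val =
      fun j => ∑ s ∈ Finset.range r, compGrad μ C u (ξ s) j := by
    intro r
    induction r with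
    | zero => funext j; simp [loop]
    | succ r ih =>
      funext j
      simp only [loop, bind_val, ih, Finset.sum_range_succ]
      simp [vec, add, oracleProg, draw, sub, div, exp, sum, compGrad, sub_eq_neg_add]
  funext j
  simp only [batchProg, bind_val, key]
  simp [vec, div]

/-- The nodes' programs compute the iterates of the method. -/
lemma nodeRun_val (r : ℕ → ℕ) (ξ : ℕ → ℕ → Fin m → Fin n) (k : ℕ) (i : Fin m) :
    (P.nodeRun r ξ k i).val =
      ⟨block (P.sqrtW (P.iterate r ξ k).zeta) i, block (P.sqrtW (P.iterate r ξ k).y) i,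
        block (∑ l ∈ Finset.range (k + 1), alpha P.Lpsi l •
          P.batchX (r l) (ξ l) (P.sqrtW (P.iterate r ξ l).lam)) i, bigA P.Lpsi k⟩ := by
  induction k generalizing i with
  | zero =>
    simp only [nodeRun, pure_val, iterate, map_zero, bigA, alpha, zero_smul, zero_add,
      Finset.range_one, Finset.sum_singleton]
    rfl
  | succ k ih =>
    have hbefore : ∀ j, (P.beforeProg (r (k + 1)) (fun t => ξ (k + 1) t j)
        (P.nodeRun r ξ k j).val).val = ⟨alpha P.Lpsi (k + 1), bigA P.Lpsi (k + 1),
          block (P.batchX (r (k + 1)) (ξ (k + 1)) (P.sqrtW (P.iterate r ξ (k + 1)).lam)) j⟩ := by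
      intro j
      have hlam : (combineProg (alpha P.Lpsi (k + 1)) (bigA P.Lpsi k) (bigA P.Lpsi (k + 1))
          (block (P.sqrtW (P.iterate r ξ k).zeta) j) (block (P.sqrtW (P.iterate r ξ k).y) j)).val
          = block (P.sqrtW (P.iterate r ξ (k + 1)).lam) j := by
        funext l
        simp [combineProg, vec, add, mul, div, iterate, block, div_eq_inv_mul, mul_add]
      rw [ih j]
      simp only [beforeProg, bind_val, pure_val, loop_batch_val]
      have hstep : (stepProg P.Lpsi (bigA P.Lpsi k)).val = alpha P.Lpsi (k + 1) := rfl
      have hA : (add (bigA P.Lpsi k) (alpha P.Lpsi (k + 1))).val = bigA P.Lpsi (k + 1) := rfl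
      rw [hstep, hA, hlam]
      rfl
    have hb := hbefore i
    simp only [nodeRun, bind_val]
    simp only [hbefore]
    rw [ih i]
    simp only [← P.sqrtW_sqrtW_block]
    have hz : (vec fun j => do
        let b ← mul (alpha P.Lpsi (k + 1)) (block (P.sqrtW (P.sqrtW
          (P.batchX (r (k + 1)) (ξ (k + 1)) (P.sqrtW (P.iterate r ξ (k + 1)).lam)))) i j)
        sub (block (P.sqrtW (P.iterate r ξ k).zeta) i j) b).val =
        block (P.sqrtW (P.iterate r ξ (k + 1)).zeta) i := by
      funext l
      simp [vec, mul, sub, iterate, block]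
    simp only [afterProg, bind_val, pure_val]
    rw [hz]
    congr 1
    · funext l
      simp [combineProg, vec, add, mul, div, iterate, block, div_eq_inv_mul, mul_add]
    · funext l
      rw [Finset.sum_range_succ _ (k + 1)]
      simp [vec, add, mul, block]

lemma nodeOutput_val (r : ℕ → ℕ) (ξ : ℕ → ℕ → Fin m → Fin n) (N : ℕ) (i : Fin m) :
    (P.nodeOutput r ξ N i).val = block (P.output r ξ N) i := by
  simp only [nodeOutput, bind_val, nodeRun_val]
  funext j
  simp [vec, div, output, block, div_eq_inv_mul]

/-- The total complexity of node `i`: the number of operations it executes. -/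
def nodeComplexity (r : ℕ → ℕ) (ξ : ℕ → ℕ → Fin m → Fin n) (N : ℕ) (i : Fin m) : ℕ :=
  (P.nodeOutput r ξ N i).ops

end BaryProblem

end

end WBary

namespace WBary

/-! ## Sums of exponentials -/

/-! Errors are measured against the budget `E = A_N ε`. The dual function is convex and `L_ψ`-smooth
because each `μ ln Z_j` is a log-sum-exp: convexity is Jensen's inequality (`logZ_ge`), smoothness
is Hoeffding's lemma (`logZ_le`). A minimizer exists since every feasible point can be improved to
one of squared norm at most `n m ‖C‖²` (`exists_le_of_sum_eq_zero`); a pseudo-inverse pulls it back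
through `√W`. At a minimizer all gradient blocks agree, and the common block is a barycenter without
duality gap (`exists_dual_solution_and_barycenter`).

For the primal guarantee, each sampled gradient block is an "atom" of the simplex at which Fenchel's
inequality for the drawn component is an equality (`atomCost_compGrad`). Summing the one-step
inequality `accelerated_step` therefore yields `primal_dual_sum`: for every `z`, the dual value at
`y^N` plus the weighted atom costs is bounded by a term linear in the output, `‖z‖²/2` and sampling
errors. The output is a mixture of these atoms. Glued together they form a transport plan whose
second marginal is the empirical frequency of the drawn indices, and changing it to `q_i` costs
`‖C‖` times the ℓ¹ discrepancy (`regW_le_sum_atomCost_add`). Taking `z` of length `2R` against `√W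
p` leaves a term `-2R‖√W p‖`, while weak duality bounds the duality gap below by `-R‖√W p‖`; both
accuracy claims follow (`Regime.accuracy`).

The sampling errors are martingale sums controlled by exponential supermartingales
(`measure_scalar_walk_ge_le`, `measure_norm_walk_ge_le`). The scalar bounds involve a random
quadratic variation containing `‖ζ^k - y*‖²`, for which there is no a priori bound; the induction in
`Regime.norm_zeta_sub_sq_le` shows that it stays below `3E`, as the batch sizes make the quadratic
variation a small part of the budget. A union over `2N + 2` events of probability at most `δ/N`
gives `4δ`.

The complexity bound is an exact operation count combined with `∑ α_k = A_N ≤ N²/(2L_ψ)`. -/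

/-- Hoeffding's lemma for the finitely supported law with weights `w`; it becomes the smoothness of
log-sum-exp. -/
lemma sum_mul_exp_le_exp {ι : Type*} [Fintype ι] (w x : ι → ℝ)
    (hw : ∀ i, 0 ≤ w i) (hw1 : ∑ i, w i = 1) :
    ∑ i, w i * Real.exp (x i) ≤ Real.exp (∑ i, w i * x i + (∑ i, x i ^ 2) / 2) := by
  classical
  let _ : MeasurableSpace ι := ⊤
  set ν : Measure ι := ∑ i, ENNReal.ofReal (w i) • Measure.dirac i with hν
  have hprob : IsProbabilityMeasure ν := by
    constructor
    simp only [hν, Measure.coe_finsetSum, Finset.sum_apply, Measure.smul_apply, measure_univ,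
      smul_eq_mul, mul_one]
    rw [← ENNReal.ofReal_sum_of_nonneg fun i _ => hw i, hw1, ENNReal.ofReal_one]
  have hint (f : ι → ℝ) : ∫ i, f i ∂ν = ∑ i, w i * f i := by
    rw [hν, integral_finsetSum_measure fun i _ => (integrable_dirac (by finiteness)).smul_measure ENNReal.ofReal_ne_top]
    refine Finset.sum_congr rfl fun i _ => ?_
    rw [integral_smul_measure, integral_dirac, ENNReal.toReal_ofReal (hw i), smul_eq_mul]
  -- The crude interval `[-s, s]` suffices: the variance proxy is then `s²`, the squared Euclidean
  -- norm, which is the form smoothness needs.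
  set s := Real.sqrt (∑ i, x i ^ 2) with hs
  have hs2 : s ^ 2 = ∑ i, x i ^ 2 := Real.sq_sqrt (Finset.sum_nonneg fun i _ => sq_nonneg _)
  have hmem (i : ι) : x i ∈ Set.Icc (-s) s := by
    refine Set.mem_Icc.2 (abs_le.1 ?_)
    refine Real.abs_le_sqrt ?_
    exact Finset.single_le_sum (f := fun i => x i ^ 2) (fun i _ => sq_nonneg _) (Finset.mem_univ i)
  have h := (hasSubgaussianMGF_of_mem_Icc (μ := ν) (X := x) (a := -s) (b := s)
    (Measurable.of_discrete.aemeasurable) (ae_of_all _ hmem)).mgf_le 1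
  simp only [mgf, hint, one_mul] at h
  have hc : (((‖s - -s‖₊ / 2) ^ 2 : NNReal) : ℝ) = s ^ 2 := by
    have : 0 ≤ s := Real.sqrt_nonneg _
    simp only [NNReal.coe_pow, NNReal.coe_div, coe_nnnorm, Real.norm_eq_abs, NNReal.coe_ofNat]
    rw [abs_of_nonneg (by linarith)]
    ring
  rw [hc, hs2] at h
  calc ∑ i, w i * Real.exp (x i)
      = Real.exp (∑ i, w i * x i) * ∑ i, w i * Real.exp (x i - ∑ i, w i * x i) := by
        rw [Finset.mul_sum]
        refine Finset.sum_congr rfl fun i _ => ?_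
        rw [Real.exp_sub]
        field_simp
    _ ≤ Real.exp (∑ i, w i * x i) * Real.exp ((∑ i, x i ^ 2) * 1 ^ 2 / 2) :=
        mul_le_mul_of_nonneg_left h (Real.exp_pos _).le
    _ = _ := by rw [← Real.exp_add]; ring_nf

lemma exp_sum_mul_le {ι : Type*} [Fintype ι] (w x : ι → ℝ)
    (hw : ∀ i, 0 ≤ w i) (hw1 : ∑ i, w i = 1) :
    Real.exp (∑ i, w i * x i) ≤ ∑ i, w i * Real.exp (x i) := by
  simpa using convexOn_exp.map_sum_le (t := Finset.univ) (w := w) (p := x)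
    (fun i _ => hw i) hw1 (fun i _ => Set.mem_univ _)

/-! ## The log-partition functions -/

section Partition

variable {n : ℕ}

/-- `Z_j(u) = ∑_i exp((-C_{ij} + u_i)/μ)`. -/
noncomputable def partZ (μ : ℝ) (C : Matrix (Fin n) (Fin n) ℝ) (j : Fin n) (u : Fin n → ℝ) : ℝ :=
  ∑ i, Real.exp ((-C i j + u i) / μ)

/-- `μ ln Z_j(u)`. -/
noncomputable def logZ (μ : ℝ) (C : Matrix (Fin n) (Fin n) ℝ) (j : Fin n) (u : Fin n → ℝ) : ℝ :=
  μ * Real.log (partZ μ C j u)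

/-- `⟨C_j, θ⟩ + μ ⟨θ, ln θ⟩`, whose conjugate is `logZ μ C j`. -/
noncomputable def atomCost (μ : ℝ) (C : Matrix (Fin n) (Fin n) ℝ) (j : Fin n) (θ : Fin n → ℝ) : ℝ :=
  ∑ i, θ i * C i j + μ * ∑ i, θ i * Real.log (θ i)

variable {μ : ℝ} {C : Matrix (Fin n) (Fin n) ℝ}

lemma partZ_pos (j : Fin n) (u : Fin n → ℝ) : 0 < partZ μ C j u :=
  Finset.sum_pos (fun _ _ => Real.exp_pos _) ⟨j, Finset.mem_univ j⟩

lemma compGrad_eq (u : Fin n → ℝ) (j i : Fin n) :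
    compGrad μ C u j i = Real.exp ((-C i j + u i) / μ) / partZ μ C j u := rfl

lemma compGrad_pos (u : Fin n → ℝ) (j i : Fin n) : 0 < compGrad μ C u j i :=
  div_pos (Real.exp_pos _) (partZ_pos j u)

lemma compGrad_sum (u : Fin n → ℝ) (j : Fin n) : ∑ i, compGrad μ C u j i = 1 := by
  simp only [compGrad_eq, ← Finset.sum_div]
  exact div_self (partZ_pos j u).ne'

lemma compGrad_mem_stdSimplex (u : Fin n → ℝ) (j : Fin n) :
    compGrad μ C u j ∈ stdSimplex ℝ (Fin n) :=
  ⟨fun i => (compGrad_pos u j i).le, compGrad_sum u j⟩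

lemma partZ_eq_mul_sum (u v : Fin n → ℝ) (j : Fin n) :
    partZ μ C j v = partZ μ C j u * ∑ i, compGrad μ C u j i * Real.exp ((v i - u i) / μ) := by
  rw [Finset.mul_sum, partZ]
  refine Finset.sum_congr rfl fun i _ => ?_
  rw [compGrad_eq, ← mul_assoc, mul_div_cancel₀ _ (partZ_pos j u).ne', ← Real.exp_add]
  congr 1
  ring

lemma logZ_ge (hμ : 0 < μ) (u v : Fin n → ℝ) (j : Fin n) :
    logZ μ C j u + ∑ i, compGrad μ C u j i * (v i - u i) ≤ logZ μ C j v := by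
  have hZ := partZ_pos (μ := μ) (C := C) j u
  have h := exp_sum_mul_le (compGrad μ C u j) (fun i => (v i - u i) / μ)
    (fun i => (compGrad_pos u j i).le) (compGrad_sum u j)
  have h2 : Real.log (partZ μ C j u) + ∑ i, compGrad μ C u j i * ((v i - u i) / μ) ≤
      Real.log (partZ μ C j v) := by
    rw [← Real.log_exp (∑ i, _), ← Real.log_mul hZ.ne' (Real.exp_pos _).ne',
      partZ_eq_mul_sum u v]
    exact Real.log_le_log (mul_pos hZ (Real.exp_pos _)) (mul_le_mul_of_nonneg_left h hZ.le)
  have h3 := mul_le_mul_of_nonneg_left h2 hμ.le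
  rw [mul_add, Finset.mul_sum] at h3
  refine le_trans (le_of_eq ?_) h3
  rw [logZ]
  congr 1
  refine Finset.sum_congr rfl fun i _ => ?_
  field_simp

lemma logZ_le (hμ : 0 < μ) (u v : Fin n → ℝ) (j : Fin n) :
    logZ μ C j v ≤ logZ μ C j u + ∑ i, compGrad μ C u j i * (v i - u i) +
      (∑ i, (v i - u i) ^ 2) / (2 * μ) := by
  have hZ := partZ_pos (μ := μ) (C := C) j u
  have h := sum_mul_exp_le_exp (compGrad μ C u j) (fun i => (v i - u i) / μ)
    (fun i => (compGrad_pos u j i).le) (compGrad_sum u j)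
  have h2 : Real.log (partZ μ C j v) ≤ Real.log (partZ μ C j u) +
      (∑ i, compGrad μ C u j i * ((v i - u i) / μ) + (∑ i, ((v i - u i) / μ) ^ 2) / 2) := by
    rw [← Real.log_exp (∑ i, _ + _), ← Real.log_mul hZ.ne' (Real.exp_pos _).ne',
      partZ_eq_mul_sum u v]
    refine Real.log_le_log ?_ (mul_le_mul_of_nonneg_left h hZ.le)
    rw [← partZ_eq_mul_sum]
    exact partZ_pos j v
  have h3 := mul_le_mul_of_nonneg_left h2 hμ.le
  refine le_trans h3 (le_of_eq ?_)
  rw [logZ, mul_add, mul_add, Finset.mul_sum, ← mul_div_assoc, Finset.mul_sum, ← add_assoc,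
    Finset.sum_div, Finset.sum_div]
  congr 1
  · congr 1
    refine Finset.sum_congr rfl fun i _ => ?_
    field_simp
  · refine Finset.sum_congr rfl fun i _ => ?_
    field_simp

/-- Fenchel equality at the gradient: `μ ln` of a Gibbs weight is `u_i - C_{ij} - μ ln Z_j`, and the
weights sum to one. -/
lemma atomCost_compGrad (hμ : 0 < μ) (u : Fin n → ℝ) (j : Fin n) :
    atomCost μ C j (compGrad μ C u j) = ∑ i, compGrad μ C u j i * u i - logZ μ C j u := by
  have h (i : Fin n) : μ * Real.log (compGrad μ C u j i) = u i - C i j - logZ μ C j u := by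
    rw [compGrad_eq, Real.log_div (Real.exp_pos _).ne' (partZ_pos j u).ne', Real.log_exp, logZ]
    field_simp
    ring
  have h2 : logZ μ C j u = ∑ i, compGrad μ C u j i * logZ μ C j u := by
    rw [← Finset.sum_mul, compGrad_sum, one_mul]
  rw [atomCost, h2, Finset.mul_sum, ← Finset.sum_add_distrib, ← Finset.sum_sub_distrib]
  refine Finset.sum_congr rfl fun i _ => ?_
  rw [mul_left_comm, h]
  ring

/-- Exchanging columns of `C` changes every exponent by at most `2c/μ`. The bound does not depend on
`u`, so the sampling error in the dual value is bounded wherever the iterates are. -/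
lemma logZ_sub_logZ_le (hμ : 0 < μ) {c : ℝ} (hc : ∀ i j, |C i j| ≤ c) (u : Fin n → ℝ)
    (j j' : Fin n) : logZ μ C j u - logZ μ C j' u ≤ 2 * c := by
  have h1 : partZ μ C j u ≤ Real.exp (2 * c / μ) * partZ μ C j' u := by
    rw [partZ, partZ, Finset.mul_sum]
    refine Finset.sum_le_sum fun i _ => ?_
    rw [← Real.exp_add, Real.exp_le_exp, ← add_div]
    refine div_le_div_of_nonneg_right ?_ hμ.le
    linarith [neg_le_abs (C i j), le_abs_self (C i j'), hc i j, hc i j']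
  have h2 := Real.log_le_log (partZ_pos j u) h1
  rw [Real.log_mul (Real.exp_pos _).ne' (partZ_pos j' u).ne', Real.log_exp] at h2
  have h3 := mul_le_mul_of_nonneg_left h2 hμ.le
  rw [mul_add, mul_div_cancel₀ _ hμ.ne'] at h3
  simp only [logZ]
  linarith

lemma conjW_eq (q u : Fin n → ℝ) : conjW μ C q u =
    ∑ j, q j * logZ μ C j u - μ * ∑ j, q j * Real.log (q j) := by
  rw [conjW, Finset.mul_sum, ← Finset.sum_sub_distrib]
  refine Finset.sum_congr rfl fun j _ => ?_
  -- For `q_j = 0` the term `ln(1/q_j)` is meaningless, but its coefficient vanishes on both sides.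
  rcases eq_or_ne (q j) 0 with h | h
  · simp [h]
  · have hZ := partZ_pos (μ := μ) (C := C) j u
    change q j * (μ * Real.log (1 / q j * partZ μ C j u)) = _
    rw [Real.log_mul (by simpa using h) hZ.ne', one_div, Real.log_inv, logZ]
    ring

/-! ## Duality for transport plans -/

/-- The tangent bound `ln t ≤ t - 1` at `t = c w / x`. With `c w` a Gibbs entry this is
Fenchel–Young for the entropy. -/
lemma mul_log_ge {x c w : ℝ} (hx : 0 ≤ x) (hc : 0 < c) (hw : 0 < w) :
    x * Real.log (c * w) + x - c * w ≤ x * Real.log x := by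
  rcases hx.eq_or_lt with rfl | hx
  · simp only [zero_mul, zero_add, zero_sub, Left.neg_nonpos_iff]; positivity
  · have h := Real.log_le_sub_one_of_pos (div_pos (mul_pos hc hw) hx)
    rw [Real.log_div (by positivity) hx.ne'] at h
    have h2 := mul_le_mul_of_nonneg_left h hx.le
    have h3 : x * (c * w / x - 1) = c * w - x := by field_simp
    rw [h3] at h2
    linarith

/-- Compare each column of `π` with the Gibbs column of the same mass `q_j`; the linear terms of
`mul_log_ge` then cancel. -/
lemma sub_conjW_le_transportCost (hμ : 0 < μ) {p q : Fin n → ℝ} {π : Matrix (Fin n) (Fin n) ℝ}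
    (hπ : π ∈ transportPlans p q) (u : Fin n → ℝ) :
    ∑ i, u i * p i - conjW μ C q u ≤ transportCost μ C π := by
  obtain ⟨h0, hr, hcol⟩ := hπ
  have key (j : Fin n) : ∑ i, u i * π i j - q j * conjComp μ C q j u ≤
      ∑ i, C i j * π i j + μ * ∑ i, π i j * Real.log (π i j) := by
    have hqj : 0 ≤ q j := hcol j ▸ Finset.sum_nonneg fun i _ => h0 i j
    rcases hqj.eq_or_lt with hq | hq
    · have hz (i : Fin n) : π i j = 0 :=
        (Finset.sum_eq_zero_iff_of_nonneg fun i _ => h0 i j).1 ((hcol j).trans hq.symm) i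
          (Finset.mem_univ i)
      simp [hz, ← hq]
    · have hZ := partZ_pos (μ := μ) (C := C) j u
      have h1 (i : Fin n) := mul_log_ge (h0 i j) (div_pos hq hZ)
        (Real.exp_pos ((-C i j + u i) / μ))
      have h2 := Finset.sum_le_sum fun i (_ : i ∈ Finset.univ) => h1 i
      rw [Finset.sum_sub_distrib, Finset.sum_add_distrib, hcol, ← Finset.mul_sum] at h2
      change _ + q j - q j / partZ μ C j u * partZ μ C j u ≤ _ at h2
      rw [div_mul_cancel₀ _ hZ.ne', add_sub_cancel_right] at h2
      have h3 := mul_le_mul_of_nonneg_left h2 hμ.le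
      have h4 : μ * ∑ i, π i j * Real.log (q j / partZ μ C j u *
          Real.exp ((-C i j + u i) / μ)) = ∑ i, u i * π i j - ∑ i, C i j * π i j -
            q j * conjComp μ C q j u := by
        have h5 : q j * conjComp μ C q j u = ∑ i, π i j * conjComp μ C q j u := by
          rw [← Finset.sum_mul, hcol]
        rw [h5, Finset.mul_sum, ← Finset.sum_sub_distrib, ← Finset.sum_sub_distrib]
        refine Finset.sum_congr rfl fun i _ => ?_
        rw [Real.log_mul (div_pos hq hZ).ne' (Real.exp_pos _).ne', Real.log_exp,
          Real.log_div hq.ne' hZ.ne']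
        change _ = _ - π i j * (μ * Real.log (1 / q j * partZ μ C j u))
        rw [Real.log_mul (by simpa using hq.ne') hZ.ne', one_div, Real.log_inv]
        field_simp
        ring
      rw [h4] at h3
      linarith
  have h := Finset.sum_le_sum fun j (_ : j ∈ Finset.univ) => key j
  rw [Finset.sum_sub_distrib, Finset.sum_add_distrib, ← Finset.mul_sum, Finset.sum_comm] at h
  rw [transportCost, Finset.sum_comm, Finset.sum_comm (f := fun i j => π i j * Real.log (π i j))]
  refine le_trans (le_of_eq ?_) h
  congr 1
  refine Finset.sum_congr rfl fun i _ => ?_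
  rw [← Finset.mul_sum, hr]

lemma sub_conjW_le_regW (hμ : 0 < μ) {p q : Fin n → ℝ} (hp : p ∈ stdSimplex ℝ (Fin n))
    (hq : q ∈ stdSimplex ℝ (Fin n)) (u : Fin n → ℝ) :
    ∑ i, u i * p i - conjW μ C q u ≤ regW μ C q p := by
  obtain ⟨π, hπ, h⟩ := (regW_isLeast μ C hq hp).1
  rw [← h]
  exact sub_conjW_le_transportCost hμ hπ u

lemma regW_le_transportCost {p q : Fin n → ℝ} (hp : p ∈ stdSimplex ℝ (Fin n))
    (hq : q ∈ stdSimplex ℝ (Fin n)) {π : Matrix (Fin n) (Fin n) ℝ}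
    (hπ : π ∈ transportPlans p q) : regW μ C q p ≤ transportCost μ C π :=
  (regW_isLeast μ C hq hp).2 ⟨π, hπ, rfl⟩

/-! ## Plans built from atoms -/

/-- Jensen for `x ln x` with the normalized weights `β/q`; undoing the normalization produces the
term with `ln q`. -/
lemma mul_log_sum_le {T : Type*} [Fintype T] {q : ℝ} (β x : T → ℝ) (hβ : ∀ t, 0 ≤ β t)
    (hq : ∑ t, β t = q) (hx : ∀ t, 0 ≤ x t) :
    (∑ t, β t * x t) * Real.log (∑ t, β t * x t) ≤
      ∑ t, β t * (x t * Real.log (x t)) + (∑ t, β t * x t) * Real.log q := by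
  have hq0 : 0 ≤ q := hq ▸ Finset.sum_nonneg fun t _ => hβ t
  rcases hq0.eq_or_lt with h | h
  · have hz (t : T) : β t = 0 :=
      (Finset.sum_eq_zero_iff_of_nonneg fun t _ => hβ t).1 (hq.trans h.symm) t (Finset.mem_univ t)
    simp [hz]
  · have hJ := Real.convexOn_mul_log.map_sum_le (t := Finset.univ) (w := fun t => β t / q) (p := x)
      (fun t _ => div_nonneg (hβ t) hq0) (by rw [← Finset.sum_div, hq, div_self h.ne'])
      (fun t _ => hx t)
    simp only [smul_eq_mul, div_mul_eq_mul_div, ← Finset.sum_div] at hJ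
    set s := ∑ t, β t * x t with hs
    have hs0 : 0 ≤ s := Finset.sum_nonneg fun t _ => mul_nonneg (hβ t) (hx t)
    rw [div_le_div_iff_of_pos_right h] at hJ
    rcases hs0.eq_or_lt with h0 | h0
    · rw [← h0] at hJ ⊢
      simpa using hJ
    · rw [Real.log_div h0.ne' h.ne'] at hJ
      linarith

/-- The plan with `j`-th column `∑ t, β t j • θ t` is feasible, and by convexity of `x ln x` in each
column its entropy is at most that of the atoms plus that of `q`. -/
lemma regW_le_sum_atomCost {T : Type*} [Fintype T] (hμ : 0 < μ) {q : Fin n → ℝ}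
    (hq : q ∈ stdSimplex ℝ (Fin n)) (β : T → Fin n → ℝ) (θ : T → Fin n → ℝ)
    (hβ : ∀ t j, 0 ≤ β t j) (hβq : ∀ j, ∑ t, β t j = q j)
    (hθ : ∀ t, θ t ∈ stdSimplex ℝ (Fin n)) :
    regW μ C q (fun l => ∑ t, (∑ j, β t j) * θ t l) ≤
      ∑ t, ∑ j, β t j * atomCost μ C j (θ t) + μ * ∑ j, q j * Real.log (q j) := by
  set π : Matrix (Fin n) (Fin n) ℝ := fun l j => ∑ t, β t j * θ t l with hπ
  have hmem : π ∈ transportPlans (fun l => ∑ t, (∑ j, β t j) * θ t l) q := by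
    refine ⟨fun l j => Finset.sum_nonneg fun t _ => mul_nonneg (hβ t j) ((hθ t).1 l),
      fun l => ?_, fun j => ?_⟩
    · simp only [hπ, Finset.sum_mul]
      exact Finset.sum_comm
    · simp only [hπ]
      rw [Finset.sum_comm]
      simp only [← Finset.mul_sum, (hθ _).2, mul_one, hβq]
  have hp : (fun l => ∑ t, (∑ j, β t j) * θ t l) ∈ stdSimplex ℝ (Fin n) := by
    refine ⟨fun l => ?_, ?_⟩
    · exact Finset.sum_nonneg fun t _ => mul_nonneg (Finset.sum_nonneg fun j _ => hβ t j)
        ((hθ t).1 l)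
    · rw [Finset.sum_comm]
      simp only [← Finset.mul_sum, (hθ _).2, mul_one]
      rw [Finset.sum_comm]
      simp only [hβq, hq.2]
  refine (regW_le_transportCost hp hq hmem).trans ?_
  have h1 : ∑ l, ∑ j, π l j * Real.log (π l j) ≤
      ∑ t, ∑ j, β t j * ∑ l, θ t l * Real.log (θ t l) + ∑ j, q j * Real.log (q j) := by
    calc ∑ l, ∑ j, π l j * Real.log (π l j)
        ≤ ∑ l, ∑ j, (∑ t, β t j * (θ t l * Real.log (θ t l)) + π l j * Real.log (q j)) := by
          refine Finset.sum_le_sum fun l _ => Finset.sum_le_sum fun j _ => ?_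
          exact mul_log_sum_le (fun t => β t j) (fun t => θ t l) (fun t => hβ t j) (hβq j)
            fun t => (hθ t).1 l
      _ = _ := by
          simp only [Finset.sum_add_distrib]
          congr 1
          · rw [Finset.sum_comm]
            simp only [Finset.mul_sum]
            rw [Finset.sum_comm (s := (Finset.univ : Finset T))]
            exact Finset.sum_congr rfl fun j _ => Finset.sum_comm
          · rw [Finset.sum_comm]
            refine Finset.sum_congr rfl fun j _ => ?_
            rw [← Finset.sum_mul, hmem.2.2 j]
  have h2 : ∑ l, ∑ j, C l j * π l j = ∑ t, ∑ j, β t j * ∑ l, θ t l * C l j := by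
    simp only [hπ, Finset.mul_sum]
    rw [Finset.sum_comm, Finset.sum_comm (s := (Finset.univ : Finset T))]
    refine Finset.sum_congr rfl fun j _ => ?_
    rw [Finset.sum_comm]
    refine Finset.sum_congr rfl fun t _ => Finset.sum_congr rfl fun l _ => by ring
  rw [transportCost, h2]
  refine (add_le_add_right (mul_le_mul_of_nonneg_left h1 hμ.le) _).trans (le_of_eq ?_)
  simp only [atomCost, mul_add, Finset.sum_add_distrib, Finset.mul_sum]
  rw [← add_assoc]
  congr 2
  refine Finset.sum_congr rfl fun t _ => Finset.sum_congr rfl fun j _ =>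
    Finset.sum_congr rfl fun l _ => by ring

/-- `K` is the kernel of a maximal coupling of `q'` and `q`: the mass it moves is at most half of
the ℓ¹ distance. -/
lemma exists_redistribution {q q' : Fin n → ℝ} (hq : q ∈ stdSimplex ℝ (Fin n))
    (hq' : q' ∈ stdSimplex ℝ (Fin n)) :
    ∃ K : Fin n → Fin n → ℝ, (∀ a j, 0 ≤ K a j) ∧ (∀ a, q' a ≠ 0 → ∑ j, K a j = 1) ∧
      (∀ j, ∑ a, q' a * K a j = q j) ∧
      2 * ∑ a, q' a * (1 - K a a) ≤ ∑ j, |q' j - q j| := by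
  set τ := ∑ j, max (q' j - q j) 0 with hτ
  have hτ0 : 0 ≤ τ := Finset.sum_nonneg fun j _ => le_max_right _ _
  have hτ' : τ = ∑ j, max (q j - q' j) 0 := by
    have : ∑ j, (max (q' j - q j) 0 - max (q j - q' j) 0) = 0 := by
      have h (j : Fin n) : max (q' j - q j) 0 - max (q j - q' j) 0 = q' j - q j := by
        rcases le_total (q j) (q' j) with h | h
        · rw [max_eq_left (by linarith), max_eq_right (by linarith)]; ring
        · rw [max_eq_right (by linarith), max_eq_left (by linarith)]; ring
      simp only [h, Finset.sum_sub_distrib, hq.2, hq'.2, sub_self]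
    rw [Finset.sum_sub_distrib] at this
    linarith
  have hex (j : Fin n) (h : τ = 0) : max (q' j - q j) 0 = 0 :=
    (Finset.sum_eq_zero_iff_of_nonneg fun j _ => le_max_right _ _).1 h j (Finset.mem_univ j)
  have hex' (j : Fin n) (h : τ = 0) : max (q j - q' j) 0 = 0 :=
    (Finset.sum_eq_zero_iff_of_nonneg fun j _ => le_max_right _ _).1 (hτ'.symm.trans h) j
      (Finset.mem_univ j)
  have hmm (a : Fin n) : min (q a) (q' a) + max (q' a - q a) 0 = q' a := by
    rcases le_total (q a) (q' a) with h | h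
    · rw [min_eq_left h, max_eq_left (by linarith)]; ring
    · rw [min_eq_right h, max_eq_right (by linarith)]; ring
  have hmm' (a : Fin n) : min (q a) (q' a) + max (q a - q' a) 0 = q a := by
    rcases le_total (q a) (q' a) with h | h
    · rw [min_eq_left h, max_eq_right (by linarith)]; ring
    · rw [min_eq_right h, max_eq_left (by linarith)]; ring
  have hmin0 (a : Fin n) : 0 ≤ min (q a) (q' a) := le_min (hq.1 a) (hq'.1 a)
  -- Index `a` keeps `min (q a) (q' a)` and spreads its surplus in proportion to the deficits, of
  -- total `τ`. Where `q' a = 0` the numerator vanishes as well, so the identity `hqK` survives the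
  -- division by zero.
  set K : Fin n → Fin n → ℝ := fun a j => ((if a = j then min (q a) (q' a) else 0) +
    max (q' a - q a) 0 * (max (q j - q' j) 0 / τ)) / q' a with hK
  have hqK (a j : Fin n) : q' a * K a j = (if a = j then min (q a) (q' a) else 0) +
      max (q' a - q a) 0 * (max (q j - q' j) 0 / τ) := by
    rcases eq_or_ne (q' a) 0 with h | h
    · simp [h, hq.1 a]
    · rw [hK]; simp only; rw [mul_div_cancel₀ _ h]
  have hK0 (a j : Fin n) : 0 ≤ K a j := by
    refine div_nonneg (add_nonneg ?_ ?_) (hq'.1 a)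
    · split_ifs
      exacts [hmin0 a, le_rfl]
    · exact mul_nonneg (le_max_right _ _) (div_nonneg (le_max_right _ _) hτ0)
  refine ⟨K, hK0, fun a ha => ?_, fun j => ?_, ?_⟩
  · have h1 : q' a * ∑ j, K a j = q' a := by
      rw [Finset.mul_sum]
      simp only [hqK, Finset.sum_add_distrib, ← Finset.mul_sum, ← Finset.sum_div, ← hτ']
      rw [Finset.sum_ite_eq, if_pos (Finset.mem_univ a)]
      -- If `τ = 0` there is no surplus to move, and the quotients by `τ` are zero by convention.
      rcases eq_or_ne τ 0 with h | h
      · have := hmm a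
        rw [hex a h] at this ⊢
        simpa using this
      · rw [div_self h, mul_one, hmm]
    exact mul_left_cancel₀ ha (h1.trans (mul_one _).symm)
  · simp only [hqK, Finset.sum_add_distrib, ← Finset.sum_mul, ← hτ]
    rw [Finset.sum_ite_eq', if_pos (Finset.mem_univ j)]
    rcases eq_or_ne τ 0 with h | h
    · have := hmm' j
      rw [hex' j h] at this ⊢
      simpa using this
    · rw [mul_div_cancel₀ _ h, hmm']
  · have h1 : ∑ a, q' a * (1 - K a a) ≤ τ := by
      rw [hτ]
      refine Finset.sum_le_sum fun a _ => ?_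
      rw [mul_sub, hqK, if_pos rfl]
      have : 0 ≤ max (q' a - q a) 0 * (max (q a - q' a) 0 / τ) :=
        mul_nonneg (le_max_right _ _) (div_nonneg (le_max_right _ _) hτ0)
      linarith [hmm a]
    have h2 : ∑ j, |q' j - q j| = τ + τ := by
      nth_rewrite 2 [hτ']
      rw [hτ, ← Finset.sum_add_distrib]
      refine Finset.sum_congr rfl fun j _ => ?_
      rcases le_total (q j) (q' j) with h | h
      · rw [max_eq_left (by linarith), max_eq_right (by linarith), abs_of_nonneg (by linarith)]
        ring
      · rw [max_eq_right (by linarith), max_eq_left (by linarith), abs_of_nonpos (by linarith)]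
        ring
    linarith

/-- The distance at a mixture of atoms whose column weights differ from `q`. -/
lemma regW_le_sum_atomCost_add {T : Type*} [Fintype T] (hμ : 0 < μ) {c : ℝ}
    (hc : ∀ i j, |C i j| ≤ c) {q : Fin n → ℝ} (hq : q ∈ stdSimplex ℝ (Fin n))
    (w : T → ℝ) (J : T → Fin n) (θ : T → Fin n → ℝ) (hw : ∀ t, 0 ≤ w t) (hw1 : ∑ t, w t = 1)
    (hθ : ∀ t, θ t ∈ stdSimplex ℝ (Fin n)) :
    regW μ C q (fun l => ∑ t, w t * θ t l) ≤
      ∑ t, w t * atomCost μ C (J t) (θ t) +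
        c * ∑ j, |∑ t, w t * (if J t = j then 1 else 0) - q j| +
        μ * ∑ j, q j * Real.log (q j) := by
  set q' : Fin n → ℝ := fun j => ∑ t, w t * (if J t = j then 1 else 0) with hq'
  have hsum (f : Fin n → ℝ) : ∑ a, q' a * f a = ∑ t, w t * f (J t) := by
    simp only [hq', Finset.sum_mul]
    rw [Finset.sum_comm]
    refine Finset.sum_congr rfl fun t _ => ?_
    simp only [mul_assoc, ← Finset.mul_sum]
    simp
  have hq'mem : q' ∈ stdSimplex ℝ (Fin n) := by
    refine ⟨fun j => Finset.sum_nonneg fun t _ => mul_nonneg (hw t) (by split_ifs <;> norm_num), ?_⟩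
    simpa [hw1] using hsum fun _ => 1
  have hwz (t : T) (h : q' (J t) = 0) : w t = 0 := by
    have := (Finset.sum_eq_zero_iff_of_nonneg fun t _ =>
      mul_nonneg (hw t) (by split_ifs <;> norm_num)).1 h t (Finset.mem_univ t)
    simpa using this
  obtain ⟨K, hK0, hK1, hKq, hKd⟩ := exists_redistribution hq hq'mem
  -- Rows of `K` at indices of zero frequency need not sum to one, but atoms assigned to such
  -- indices have weight zero.
  have hrow (t : T) : w t * ∑ j, K (J t) j = w t := by
    rcases eq_or_ne (q' (J t)) 0 with h | h
    · rw [hwz t h, zero_mul]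
    · rw [hK1 _ h, mul_one]
  have hmain := regW_le_sum_atomCost (C := C) hμ hq (fun t j => w t * K (J t) j) θ
    (fun t j => mul_nonneg (hw t) (hK0 _ _))
    (fun j => by rw [← hsum fun a => K a j, hKq]) hθ
  simp only [← Finset.mul_sum, hrow] at hmain
  refine hmain.trans (add_le_add_left ?_ _)
  have hc0 (j : Fin n) : 0 ≤ c := (abs_nonneg _).trans (hc j j)
  -- Charging an atom to another column leaves its entropy unchanged and alters its linear cost by
  -- at most `2c`. The moved mass is at most half of the ℓ¹ discrepancy, whence the factor `c`.
  have hatom (t : T) (j : Fin n) : atomCost μ C j (θ t) ≤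
      atomCost μ C (J t) (θ t) + 2 * c * (1 - if j = J t then 1 else 0) := by
    split_ifs with h
    · rw [h]; simp
    · have : ∑ i, θ t i * C i j ≤ ∑ i, θ t i * C i (J t) + 2 * c := by
        have h2 : 2 * c = ∑ i, θ t i * (2 * c) := by rw [← Finset.sum_mul, (hθ t).2, one_mul]
        rw [h2, ← Finset.sum_add_distrib]
        refine Finset.sum_le_sum fun i _ => ?_
        rw [← mul_add]
        refine mul_le_mul_of_nonneg_left ?_ ((hθ t).1 i)
        linarith [le_abs_self (C i j), neg_le_abs (C i (J t)), hc i j, hc i (J t)]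
      simp only [atomCost]
      linarith
  have h1 (t : T) : ∑ j, w t * K (J t) j * atomCost μ C j (θ t) ≤
      w t * atomCost μ C (J t) (θ t) + 2 * c * (w t * (1 - K (J t) (J t))) := by
    calc ∑ j, w t * K (J t) j * atomCost μ C j (θ t)
        ≤ ∑ j, w t * K (J t) j * (atomCost μ C (J t) (θ t) +
            2 * c * (1 - if j = J t then 1 else 0)) :=
          Finset.sum_le_sum fun j _ => mul_le_mul_of_nonneg_left (hatom t j)
            (mul_nonneg (hw t) (hK0 _ _))
      _ = (w t * ∑ j, K (J t) j) * (atomCost μ C (J t) (θ t) + 2 * c) -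
            2 * c * (w t * K (J t) (J t)) := by
          simp only [mul_add, mul_sub, Finset.sum_add_distrib, Finset.sum_sub_distrib,
            ← Finset.sum_mul, ← Finset.mul_sum]
          simp only [mul_one, mul_ite, mul_zero, Finset.sum_ite_eq', Finset.mem_univ, if_true]
          ring
      _ = _ := by rw [hrow]; ring
  refine (Finset.sum_le_sum fun t _ => h1 t).trans ?_
  rw [Finset.sum_add_distrib, ← Finset.mul_sum, ← hsum fun a => 1 - K a a]
  refine add_le_add_right ?_ _
  rcases isEmpty_or_nonempty (Fin n) with h | ⟨⟨j⟩⟩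
  · simp
  · have := mul_le_mul_of_nonneg_left hKd (hc0 j)
    linarith

end Partition

namespace BaryProblem

/-! ## The operator `√W` -/

section Spectral

open scoped MatrixOrder

variable {m n : ℕ} (P : BaryProblem m n)

lemma posSemidef_W : P.W.PosSemidef := by
  classical
  have h : P.lap.PosSemidef := by
    unfold lap
    convert SimpleGraph.posSemidef_lapMatrix ℝ P.G
  exact h.kronecker Matrix.PosSemidef.one

lemma W_mulVec_apply (x : Fin m × Fin n → ℝ) (i : Fin m) (l : Fin n) :
    P.W.mulVec x (i, l) = P.lap.mulVec (fun j => x (j, l)) i := by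
  simp [Matrix.mulVec, dotProduct, W, Matrix.kroneckerMap_apply, Fintype.sum_prod_type,
    Matrix.one_apply]

lemma lap_mulVec_const (c : ℝ) : P.lap.mulVec (fun _ => c) = 0 := by
  classical
  have h : P.lap.mulVec (fun _ => (1 : ℝ)) = 0 := by
    unfold lap
    convert SimpleGraph.lapMatrix_mulVec_const_eq_zero (G := P.G) (R := ℝ)
  have h2 : (fun _ : Fin m => c) = c • fun _ => (1 : ℝ) := by ext; simp
  rw [h2, Matrix.mulVec_smul, h, smul_zero]

lemma eq_of_lap_mulVec_eq_zero (hG : P.G.Connected) {x : Fin m → ℝ} (hx : P.lap.mulVec x = 0)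
    (i j : Fin m) : x i = x j := by
  classical
  have h : P.lap = P.G.lapMatrix ℝ := by
    unfold lap
    congr!
  rw [h] at hx
  exact (SimpleGraph.lapMatrix_mulVec_eq_zero_iff_forall_reachable P.G).1 hx i j (hG i j)

lemma sqrtW_sqrtW (x : Stacked m n) :
    P.sqrtW (P.sqrtW x) = WithLp.toLp 2 (P.W.mulVec x.ofLp) := by
  have hs : CFC.sqrt P.W * CFC.sqrt P.W = P.W := by
    exact CFC.sqrt_mul_sqrt_self _ P.posSemidef_W.nonneg
  simp only [sqrtW, Matrix.toLpLin_apply, Matrix.mulVec_mulVec, hs]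

lemma inner_sqrtW_left (x y : Stacked m n) : inner ℝ (P.sqrtW x) y = inner ℝ x (P.sqrtW y) := by
  have hs : (CFC.sqrt P.W).IsHermitian := by
    exact (Matrix.nonneg_iff_posSemidef.1 (CFC.sqrt_nonneg P.W)).isHermitian
  exact (Matrix.isSymmetric_toEuclideanLin_iff.2 hs) x y

lemma norm_sqrtW_sq (x : Stacked m n) :
    ‖P.sqrtW x‖ ^ 2 = inner ℝ x (WithLp.toLp 2 (P.W.mulVec x.ofLp)) := by
  rw [← real_inner_self_eq_norm_sq, inner_sqrtW_left, sqrtW_sqrtW]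

/-- An orthonormal basis of eigenvectors of `W`. -/
noncomputable def eigBasis : OrthonormalBasis (Fin m × Fin n) ℝ (Stacked m n) :=
  P.posSemidef_W.isHermitian.eigenvectorBasis

/-- The eigenvalues of `W`. -/
noncomputable def eig : Fin m × Fin n → ℝ := P.posSemidef_W.isHermitian.eigenvalues

lemma eig_nonneg (k : Fin m × Fin n) : 0 ≤ P.eig k := P.posSemidef_W.eigenvalues_nonneg k

lemma W_mulVec_eigBasis (k : Fin m × Fin n) :
    WithLp.toLp 2 (P.W.mulVec (P.eigBasis k).ofLp) = P.eig k • P.eigBasis k := by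
  have h := P.posSemidef_W.isHermitian.mulVec_eigenvectorBasis k
  ext i
  exact congrFun h i

lemma spectrum_W : spectrum ℝ P.W = Set.range P.eig :=
  P.posSemidef_W.isHermitian.spectrum_real_eq_range_eigenvalues

lemma eig_le_lamMax (k : Fin m × Fin n) : P.eig k ≤ P.lamMax := by
  rw [lamMax, spectrum_W]
  exact le_csSup (Set.finite_range _).bddAbove ⟨k, rfl⟩

lemma inner_eigBasis_W (k : Fin m × Fin n) (x : Stacked m n) :
    inner ℝ (P.eigBasis k) (WithLp.toLp 2 (P.W.mulVec x.ofLp)) =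
      P.eig k * inner ℝ (P.eigBasis k) x := by
  rw [← sqrtW_sqrtW, ← inner_sqrtW_left, ← inner_sqrtW_left, sqrtW_sqrtW, W_mulVec_eigBasis,
    real_inner_smul_left]

lemma norm_sqrtW_sq_eq_sum (x : Stacked m n) :
    ‖P.sqrtW x‖ ^ 2 = ∑ k, P.eig k * (inner ℝ (P.eigBasis k) x) ^ 2 := by
  rw [norm_sqrtW_sq, ← P.eigBasis.sum_inner_mul_inner]
  refine Finset.sum_congr rfl fun k _ => ?_
  rw [inner_eigBasis_W, real_inner_comm]
  ring

lemma norm_sq_eq_sum (x : Stacked m n) : ‖x‖ ^ 2 = ∑ k, (inner ℝ (P.eigBasis k) x) ^ 2 := by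
  rw [← real_inner_self_eq_norm_sq, ← P.eigBasis.sum_inner_mul_inner]
  refine Finset.sum_congr rfl fun k _ => ?_
  rw [real_inner_comm]
  ring

lemma norm_sqrtW_sq_le (x : Stacked m n) : ‖P.sqrtW x‖ ^ 2 ≤ P.lamMax * ‖x‖ ^ 2 := by
  rw [norm_sqrtW_sq_eq_sum, P.norm_sq_eq_sum x, Finset.mul_sum]
  exact Finset.sum_le_sum fun k _ => mul_le_mul_of_nonneg_right (P.eig_le_lamMax k) (sq_nonneg _)

/-- Vectors that are equal at all nodes lie in the kernel of `W`, hence of `√W`; by symmetry the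
image of `√W` is orthogonal to them. -/
lemma sum_sqrtW_apply (y : Stacked m n) (l : Fin n) : ∑ i, P.sqrtW y (i, l) = 0 := by
  set c : Stacked m n := WithLp.toLp 2 fun il => if il.2 = l then 1 else 0 with hc
  have hWc : P.W.mulVec c.ofLp = 0 := by
    ext ⟨i, l'⟩
    rw [W_mulVec_apply]
    exact congrFun (P.lap_mulVec_const (if l' = l then 1 else 0)) i
  have h1 : ‖P.sqrtW c‖ ^ 2 = 0 := by
    rw [norm_sqrtW_sq, hWc]
    simp
  have h2 : P.sqrtW c = 0 := by simpa using h1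
  have h3 : inner ℝ c (P.sqrtW y) = ∑ i, P.sqrtW y (i, l) := by
    simp [PiLp.inner_apply, hc, Fintype.sum_prod_type]
  rw [← h3, ← inner_sqrtW_left, h2, inner_zero_left]

lemma eigBasis_apply_eq (hG : P.G.Connected) {k : Fin m × Fin n} (hk : P.eig k = 0)
    (i j : Fin m) (l : Fin n) : P.eigBasis k (i, l) = P.eigBasis k (j, l) := by
  have h := P.W_mulVec_eigBasis k
  rw [hk, zero_smul] at h
  refine P.eq_of_lap_mulVec_eq_zero hG (x := fun i => P.eigBasis k (i, l)) ?_ i j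
  ext i
  rw [← W_mulVec_apply]
  exact congrFun (congrArg WithLp.ofLp h) (i, l)

/-- Connectedness enters here: null eigenvectors of `W` are constant over the nodes, so vectors with
zero block sum have no component along them. -/
lemma inner_eigBasis_eq_zero (hG : P.G.Connected) {k : Fin m × Fin n} (hk : P.eig k = 0)
    {u : Stacked m n} (hu : ∀ l, ∑ i, u (i, l) = 0) : inner ℝ (P.eigBasis k) u = 0 := by
  obtain ⟨i0⟩ := hG.nonempty
  rw [PiLp.inner_apply, Fintype.sum_prod_type, Finset.sum_comm]
  refine Finset.sum_eq_zero fun l _ => ?_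
  simp only [RCLike.inner_apply, conj_trivial, P.eigBasis_apply_eq hG hk _ i0 l]
  rw [← Finset.sum_mul, hu, zero_mul]

lemma exists_eig_pos (hm : 2 ≤ m) (hG : P.G.Connected) (l : Fin n) : ∃ k, 0 < P.eig k := by
  by_contra! h
  have h0 (k : Fin m × Fin n) : P.eig k = 0 := le_antisymm (h k) (P.eig_nonneg k)
  let i0 : Fin m := ⟨0, by omega⟩
  let i1 : Fin m := ⟨1, by omega⟩
  have hne : i0 ≠ i1 := by simp [i0, i1]
  -- A nonzero vector with zero block sum, built from two distinct nodes. If all eigenvalues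
  -- vanished it would be orthogonal to the whole eigenbasis.
  set u : Stacked m n := EuclideanSpace.single (i0, l) 1 - EuclideanSpace.single (i1, l) 1 with hu
  have hu0 : ∀ l', ∑ i, u (i, l') = 0 := by
    intro l'
    by_cases h : l' = l <;>
      simp [hu, h, Finset.sum_sub_distrib]
  have h1 : ‖u‖ ^ 2 = 0 := by
    rw [P.norm_sq_eq_sum]
    exact Finset.sum_eq_zero fun k _ => by rw [P.inner_eigBasis_eq_zero hG (h0 k) hu0]; simp
  have h2 : u = 0 := by simpa using h1
  have h3 : u (i0, l) = 0 := by rw [h2]; rfl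
  simp [hu, hne] at h3

lemma lamMinPos_le {k : Fin m × Fin n} (hk : 0 < P.eig k) : P.lamMinPos ≤ P.eig k := by
  rw [lamMinPos, spectrum_W]
  exact csInf_le ((Set.finite_range _).inter_of_left _).bddBelow ⟨⟨k, rfl⟩, hk⟩

lemma lamMinPos_pos (hm : 2 ≤ m) (hG : P.G.Connected) (l : Fin n) : 0 < P.lamMinPos := by
  obtain ⟨k, hk⟩ := P.exists_eig_pos hm hG l
  have h : (Set.range P.eig ∩ Set.Ioi 0).Nonempty := ⟨_, ⟨k, rfl⟩, hk⟩
  have h2 := h.csInf_mem ((Set.finite_range P.eig).inter_of_left _)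
  rw [lamMinPos, spectrum_W]
  exact h2.2

lemma lamMinPos_le_lamMax (hm : 2 ≤ m) (hG : P.G.Connected) (l : Fin n) :
    P.lamMinPos ≤ P.lamMax := by
  obtain ⟨k, hk⟩ := P.exists_eig_pos hm hG l
  exact (P.lamMinPos_le hk).trans (P.eig_le_lamMax k)

/-- The preimage is `√W W⁺ u`. Coefficients with eigenvalue zero vanish, and the others lose at most
a factor `1/λ⁺_min` in squared norm. -/
lemma exists_sqrtW_eq (hG : P.G.Connected) {u : Stacked m n}
    (hu : ∀ l, ∑ i, u (i, l) = 0) :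
    ∃ y, P.sqrtW y = u ∧ P.lamMinPos * ‖y‖ ^ 2 ≤ ‖u‖ ^ 2 := by
  set v : Stacked m n := ∑ k, (inner ℝ (P.eigBasis k) u / P.eig k) • P.eigBasis k with hv
  have hvk (k : Fin m × Fin n) :
      inner ℝ (P.eigBasis k) v = inner ℝ (P.eigBasis k) u / P.eig k := by
    rw [hv]
    exact P.eigBasis.orthonormal.inner_right_fintype _ k
  have hWv : P.sqrtW (P.sqrtW v) = u := by
    rw [sqrtW_sqrtW]
    refine InnerProductSpace.ext_inner_left_basis P.eigBasis.toBasis fun k => ?_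
    rw [OrthonormalBasis.coe_toBasis]
    rw [inner_eigBasis_W, hvk]
    rcases eq_or_ne (P.eig k) 0 with h | h
    · rw [P.inner_eigBasis_eq_zero hG h hu, h, zero_mul]
    · rw [mul_div_cancel₀ _ h]
  refine ⟨P.sqrtW v, hWv, ?_⟩
  rw [norm_sqrtW_sq_eq_sum, P.norm_sq_eq_sum u, Finset.mul_sum]
  refine Finset.sum_le_sum fun k _ => ?_
  rw [hvk]
  rcases (P.eig_nonneg k).eq_or_lt with h | h
  · rw [← h]
    simp only [zero_mul, mul_zero]
    exact sq_nonneg _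
  · have h1 := P.lamMinPos_le h
    calc P.lamMinPos * (P.eig k * (inner ℝ (P.eigBasis k) u / P.eig k) ^ 2)
        = P.lamMinPos / P.eig k * inner ℝ (P.eigBasis k) u ^ 2 := by field_simp
      _ ≤ 1 * inner ℝ (P.eigBasis k) u ^ 2 :=
        mul_le_mul_of_nonneg_right ((div_le_one h).2 h1) (sq_nonneg _)
      _ = _ := one_mul _

end Spectral

/-! ## The dual function on the image of `√W` -/

section Dual

variable {m n : ℕ} (P : BaryProblem m n)

/-- `Ψ(u) = ∑_i ∑_j q_i(j) μ ln Z_j(u_i)`. -/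
noncomputable def Psi (u : Stacked m n) : ℝ := ∑ i, ∑ j, P.q i j * logZ P.mu P.C j (block u i)

/-- The gradient of `Ψ`. -/
noncomputable def meanX (u : Stacked m n) : Stacked m n :=
  WithLp.toLp 2 fun il => ∑ j, P.q il.1 j * compGrad P.mu P.C (block u il.1) j il.2

/-- `μ ∑_i ⟨q_i, ln q_i⟩`. -/
noncomputable def entropyQ : ℝ := ∑ i, P.mu * ∑ j, P.q i j * Real.log (P.q i j)

lemma psi_eq (y : Stacked m n) : P.psi y = P.Psi (P.sqrtW y) - P.entropyQ := by
  simp only [psi, conjW_eq, Psi, entropyQ, Finset.sum_sub_distrib]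

lemma abs_C_le (i j : Fin n) : |P.C i j| ≤ P.normC :=
  le_ciSup (f := fun ij : Fin n × Fin n => |P.C ij.1 ij.2|) (Set.finite_range _).bddAbove (i, j)

lemma normC_nonneg : 0 ≤ P.normC := Real.iSup_nonneg fun _ => abs_nonneg _

variable {P}

lemma meanX_mem_stdSimplex (hq : ∀ i, P.q i ∈ stdSimplex ℝ (Fin n)) (u : Stacked m n) (i : Fin m) :
    block (P.meanX u) i ∈ stdSimplex ℝ (Fin n) := by
  refine ⟨fun l => ?_, ?_⟩
  · change 0 ≤ ∑ j, P.q i j * compGrad P.mu P.C (block u i) j l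
    exact Finset.sum_nonneg fun j _ => mul_nonneg ((hq i).1 j) (compGrad_pos _ _ _).le
  simp only [block, meanX]
  rw [Finset.sum_comm]
  simp only [← Finset.mul_sum, compGrad_sum, mul_one, (hq i).2]

lemma inner_stacked (x y : Stacked m n) : inner ℝ x y = ∑ i, ∑ l, block x i l * block y i l := by
  simp only [PiLp.inner_apply, Fintype.sum_prod_type, block, RCLike.inner_apply, conj_trivial]
  exact Finset.sum_congr rfl fun i _ => Finset.sum_congr rfl fun l _ => mul_comm _ _

lemma norm_sq_stacked (x : Stacked m n) : ‖x‖ ^ 2 = ∑ i, ∑ l, block x i l ^ 2 := by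
  rw [← real_inner_self_eq_norm_sq, inner_stacked]
  exact Finset.sum_congr rfl fun i _ => Finset.sum_congr rfl fun l _ => (sq _).symm

lemma inner_meanX (u d : Stacked m n) : inner ℝ (P.meanX u) d =
    ∑ i, ∑ j, P.q i j * ∑ l, compGrad P.mu P.C (block u i) j l * block d i l := by
  rw [inner_stacked]
  refine Finset.sum_congr rfl fun i _ => ?_
  simp only [Finset.mul_sum]
  rw [Finset.sum_comm]
  refine Finset.sum_congr rfl fun l _ => ?_
  simp only [block, meanX, Finset.sum_mul, mul_assoc]

lemma Psi_ge (hμ : 0 < P.mu) (hq : ∀ i, P.q i ∈ stdSimplex ℝ (Fin n)) (u v : Stacked m n) :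
    P.Psi u + inner ℝ (P.meanX u) (v - u) ≤ P.Psi v := by
  rw [inner_meanX, Psi, Psi, ← Finset.sum_add_distrib]
  refine Finset.sum_le_sum fun i _ => ?_
  rw [← Finset.sum_add_distrib]
  refine Finset.sum_le_sum fun j _ => ?_
  rw [← mul_add]
  exact mul_le_mul_of_nonneg_left (logZ_ge hμ (block u i) (block v i) j) ((hq i).1 j)

lemma Psi_le (hμ : 0 < P.mu) (hq : ∀ i, P.q i ∈ stdSimplex ℝ (Fin n)) (u v : Stacked m n) :
    P.Psi v ≤ P.Psi u + inner ℝ (P.meanX u) (v - u) + ‖v - u‖ ^ 2 / (2 * P.mu) := by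
  rw [inner_meanX, Psi, Psi, norm_sq_stacked, Finset.sum_div, ← Finset.sum_add_distrib,
    ← Finset.sum_add_distrib]
  refine Finset.sum_le_sum fun i _ => ?_
  have h1 : (∑ l, block (v - u) i l ^ 2) / (2 * P.mu) =
      ∑ j, P.q i j * ((∑ l, block (v - u) i l ^ 2) / (2 * P.mu)) := by
    rw [← Finset.sum_mul, (hq i).2, one_mul]
  rw [h1, ← Finset.sum_add_distrib, ← Finset.sum_add_distrib]
  refine Finset.sum_le_sum fun j _ => ?_
  rw [← mul_add, ← mul_add]
  exact mul_le_mul_of_nonneg_left (logZ_le hμ (block u i) (block v i) j) ((hq i).1 j)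

lemma continuous_Psi : Continuous P.Psi := by
  refine continuous_finsetSum _ fun i _ => continuous_finsetSum _ fun j _ =>
    continuous_const.mul (continuous_const.mul (Continuous.log ?_ fun u => (partZ_pos _ _).ne'))
  unfold partZ block
  fun_prop

/-! ### Improving a dual point -/

/-- The weights `∑_j q_i(j) exp(-C_{lj}/μ) / Z_j(u_i)`. -/
noncomputable def scaling (P : BaryProblem m n) (u : Stacked m n) (i : Fin m) (l : Fin n) : ℝ :=
  ∑ j, P.q i j / partZ P.mu P.C j (block u i) * Real.exp (-P.C l j / P.mu)

lemma sum_mul_partZ_div (u v : Stacked m n) (i : Fin m) :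
    ∑ j, P.q i j * (partZ P.mu P.C j (block v i) / partZ P.mu P.C j (block u i)) =
      ∑ l, P.scaling u i l * Real.exp (block v i l / P.mu) := by
  simp only [scaling, Finset.sum_mul]
  rw [Finset.sum_comm]
  refine Finset.sum_congr rfl fun j _ => ?_
  nth_rewrite 1 [partZ]
  rw [Finset.sum_div, Finset.mul_sum]
  refine Finset.sum_congr rfl fun l _ => ?_
  rw [add_div, Real.exp_add]
  ring

/-- Jensen moves the average over `q_i` inside the logarithm. The resulting majorant of `Ψ` is
explicit in `v` and can be controlled by hand. -/
lemma Psi_sub_le (hμ : 0 < P.mu) (hq : ∀ i, P.q i ∈ stdSimplex ℝ (Fin n)) (u v : Stacked m n) :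
    P.Psi v - P.Psi u ≤
      P.mu * ∑ i, Real.log (∑ l, P.scaling u i l * Real.exp (block v i l / P.mu)) := by
  rw [Psi, Psi, ← Finset.sum_sub_distrib, Finset.mul_sum]
  refine Finset.sum_le_sum fun i _ => ?_
  rw [← sum_mul_partZ_div]
  have h := exp_sum_mul_le (P.q i)
    (fun j => Real.log (partZ P.mu P.C j (block v i) / partZ P.mu P.C j (block u i)))
    (hq i).1 (hq i).2
  have hpos (j : Fin n) : 0 < partZ P.mu P.C j (block v i) / partZ P.mu P.C j (block u i) :=
    div_pos (partZ_pos _ _) (partZ_pos _ _)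
  simp only [Real.exp_log (hpos _)] at h
  have h2 := Real.log_le_log (Real.exp_pos _) h
  rw [Real.log_exp] at h2
  refine le_trans (le_of_eq ?_) (mul_le_mul_of_nonneg_left h2 hμ.le)
  rw [Finset.mul_sum, ← Finset.sum_sub_distrib]
  refine Finset.sum_congr rfl fun j _ => ?_
  rw [Real.log_div (partZ_pos _ _).ne' (partZ_pos _ _).ne', logZ, logZ]
  ring

/-- A Sinkhorn-type update. With `a` the scaling weights of `u`, the choice `v = μ(ln b_i - ln a_il
- t_l)` turns the majorant into `μ(∑ ln b_i + m ln ∑ exp(-t_l))`, which is nonpositive by an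
arithmetic-geometric mean inequality. The size of `v` is controlled because the ratios `a_il / b_i`
lie within `exp(±‖C‖/μ)`, irrespective of `u`. -/
lemma exists_le_of_sum_eq_zero (hm : 0 < m) (hμ : 0 < P.mu)
    (hq : ∀ i, P.q i ∈ stdSimplex ℝ (Fin n)) {u : Stacked m n} (hu : ∀ l, ∑ i, u (i, l) = 0) :
    ∃ v : Stacked m n, (∀ l, ∑ i, v (i, l) = 0) ∧ ‖v‖ ^ 2 ≤ n * m * P.normC ^ 2 ∧
      P.Psi v ≤ P.Psi u := by
  have hm' : (m : ℝ) ≠ 0 := by positivity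
  set b : Fin m → ℝ := fun i => ∑ j, P.q i j / partZ P.mu P.C j (block u i) with hb
  have hbpos (i : Fin m) : 0 < b i := by
    obtain ⟨j, hj⟩ : ∃ j, P.q i j ≠ 0 := by
      by_contra! h
      simpa [h] using (hq i).2
    exact Finset.sum_pos' (fun j _ => div_nonneg ((hq i).1 j) (partZ_pos _ _).le)
      ⟨j, Finset.mem_univ j, div_pos (((hq i).1 j).lt_of_ne' hj) (partZ_pos _ _)⟩
  set a := P.scaling u with ha
  have ha1 (i : Fin m) (l : Fin n) : Real.exp (-P.normC / P.mu) * b i ≤ a i l := by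
    rw [hb, Finset.mul_sum]
    refine Finset.sum_le_sum fun j _ => ?_
    rw [mul_comm]
    refine mul_le_mul_of_nonneg_left (Real.exp_le_exp.2 (div_le_div_of_nonneg_right ?_ hμ.le))
      (div_nonneg ((hq i).1 j) (partZ_pos _ _).le)
    linarith [P.abs_C_le l j, le_abs_self (P.C l j)]
  have ha2 (i : Fin m) (l : Fin n) : a i l ≤ Real.exp (P.normC / P.mu) * b i := by
    rw [hb, Finset.mul_sum]
    refine Finset.sum_le_sum fun j _ => ?_
    rw [mul_comm (Real.exp _)]
    refine mul_le_mul_of_nonneg_left (Real.exp_le_exp.2 (div_le_div_of_nonneg_right ?_ hμ.le))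
      (div_nonneg ((hq i).1 j) (partZ_pos _ _).le)
    linarith [P.abs_C_le l j, neg_abs_le (P.C l j)]
  have hapos (i : Fin m) (l : Fin n) : 0 < a i l :=
    (mul_pos (Real.exp_pos _) (hbpos i)).trans_le (ha1 i l)
  set s : Fin m → Fin n → ℝ := fun i l => Real.log (b i) - Real.log (a i l) with hs
  have hs1 (i : Fin m) (l : Fin n) : (P.mu * s i l) ^ 2 ≤ P.normC ^ 2 := by
    rw [sq_le_sq, abs_of_nonneg P.normC_nonneg, abs_le]
    have h1 := Real.log_le_log (mul_pos (Real.exp_pos _) (hbpos i)) (ha1 i l)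
    have h2 := Real.log_le_log (hapos i l) (ha2 i l)
    rw [Real.log_mul (Real.exp_pos _).ne' (hbpos i).ne', Real.log_exp] at h1 h2
    rw [neg_div] at h1
    have h3 : P.normC = P.mu * (P.normC / P.mu) := by field_simp
    constructor
    · nth_rewrite 1 [h3]
      rw [← mul_neg]
      exact mul_le_mul_of_nonneg_left (by simp only [hs]; linarith) hμ.le
    · nth_rewrite 1 [h3]
      exact mul_le_mul_of_nonneg_left (by simp only [hs]; linarith) hμ.le
  set t : Fin n → ℝ := fun l => (∑ i, s i l) / m with ht
  set v : Stacked m n := WithLp.toLp 2 fun il => P.mu * (s il.1 il.2 - t il.2) with hv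
  have hst (l : Fin n) : ∑ i, (s i l - t l) = 0 := by
    simp only [Finset.sum_sub_distrib, Finset.sum_const, Finset.card_univ, Fintype.card_fin,
      nsmul_eq_mul, ht]
    rw [mul_div_cancel₀ _ hm', sub_self]
  refine ⟨v, fun l => ?_, ?_, ?_⟩
  · simp only [hv, ← Finset.mul_sum, hst, mul_zero]
  · rw [norm_sq_stacked, Finset.sum_comm]
    have h1 (l : Fin n) : ∑ i, block v i l ^ 2 ≤ m * P.normC ^ 2 := by
      -- Centring over the nodes is an orthogonal projection, so it cannot increase the sum of
      -- squares.
      have h2 : ∑ i, block v i l ^ 2 = ∑ i, (P.mu * s i l) ^ 2 - P.mu ^ 2 * (m * t l ^ 2) := by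
        have h3 : ∑ i, s i l = m * t l := by simp only [ht]; rw [mul_div_cancel₀ _ hm']
        have h4 (i : Fin m) : block v i l ^ 2 =
            (P.mu * s i l) ^ 2 - P.mu ^ 2 * (2 * t l * s i l - t l ^ 2) := by
          simp only [block, hv]; ring
        simp only [h4, Finset.sum_sub_distrib, ← Finset.mul_sum, h3, Finset.sum_const,
          Finset.card_univ, Fintype.card_fin, nsmul_eq_mul]
        ring
      rw [h2]
      have h5 : ∑ i, (P.mu * s i l) ^ 2 ≤ m * P.normC ^ 2 := by
        simpa using Finset.sum_le_sum fun i (_ : i ∈ Finset.univ) => hs1 i l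
      have h6 : 0 ≤ P.mu ^ 2 * (m * t l ^ 2) := by positivity
      linarith
    calc ∑ l, ∑ i, block v i l ^ 2 ≤ ∑ _l : Fin n, m * P.normC ^ 2 :=
          Finset.sum_le_sum fun l _ => h1 l
      _ = n * m * P.normC ^ 2 := by simp [mul_assoc]
  · have h1 := Psi_sub_le hμ hq u v
    have h2 (i : Fin m) (l : Fin n) : a i l * Real.exp (block v i l / P.mu) =
        b i * Real.exp (-t l) := by
      simp only [block, hv]
      rw [mul_div_cancel_left₀ _ hμ.ne']
      simp only [hs]
      rw [Real.exp_sub, Real.exp_sub, Real.exp_log (hbpos i), Real.exp_log (hapos i l),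
        Real.exp_neg]
      have := (hapos i l).ne'
      field_simp
    simp only [← ha, h2, ← Finset.mul_sum] at h1
    rcases isEmpty_or_nonempty (Fin n) with hn | hn
    · simp [Psi]
    have hG : 0 < ∑ l, Real.exp (-t l) :=
      Finset.sum_pos (fun _ _ => Real.exp_pos _) Finset.univ_nonempty
    have hlog (i : Fin m) : Real.log (b i * ∑ l, Real.exp (-t l)) =
        Real.log (b i) + Real.log (∑ l, Real.exp (-t l)) :=
      Real.log_mul (hbpos i).ne' hG.ne'
    simp only [hlog, Finset.sum_add_distrib, Finset.sum_const, Finset.card_univ, Fintype.card_fin,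
      nsmul_eq_mul] at h1
    -- Since `∑_i u_il = 0`, each summand is the geometric mean over the nodes of `a_il
    -- exp(u_il/μ)`. Its arithmetic mean, summed over `l`, is exactly 1.
    have h3 : Real.exp ((∑ i, Real.log (b i)) / m) * ∑ l, Real.exp (-t l) ≤ 1 := by
      rw [Finset.mul_sum]
      calc ∑ l, Real.exp ((∑ i, Real.log (b i)) / m) * Real.exp (-t l)
          ≤ ∑ l, ∑ i : Fin m, (1 / m : ℝ) * (a i l * Real.exp (block u i l / P.mu)) := by
            refine Finset.sum_le_sum fun l _ => ?_
            have h4 := exp_sum_mul_le (fun _ : Fin m => (1 / m : ℝ))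
              (fun i => Real.log (a i l) + block u i l / P.mu) (fun _ => by positivity)
              (by simp [hm'])
            simp only [Real.exp_add, Real.exp_log (hapos _ l)] at h4
            refine le_trans (le_of_eq ?_) h4
            rw [← Real.exp_add]
            congr 1
            have h5 : ∑ i, block u i l = 0 := hu l
            rw [← Finset.mul_sum, Finset.sum_add_distrib, ← Finset.sum_div, h5]
            simp only [ht, hs, Finset.sum_sub_distrib]
            ring
        _ = (1 / m : ℝ) * ∑ i, ∑ l, a i l * Real.exp (block u i l / P.mu) := by
            rw [Finset.sum_comm, Finset.mul_sum]
            simp only [Finset.mul_sum]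
        _ = 1 := by
            have h6 (i : Fin m) : ∑ l, a i l * Real.exp (block u i l / P.mu) = 1 := by
              rw [ha, ← sum_mul_partZ_div]
              simp only [div_self (partZ_pos _ _).ne', mul_one, (hq i).2]
            simp only [h6]
            simp [hm']
    have h7 := Real.log_le_log (mul_pos (Real.exp_pos _) hG) h3
    rw [Real.log_mul (Real.exp_pos _).ne' hG.ne', Real.log_exp, Real.log_one] at h7
    have h8 : ∑ i, Real.log (b i) + m * Real.log (∑ l, Real.exp (-t l)) ≤ 0 := by
      have h9 : (∑ i, Real.log (b i)) / m * m = ∑ i, Real.log (b i) := div_mul_cancel₀ _ hm'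
      nlinarith [mul_nonpos_of_nonpos_of_nonneg h7 (Nat.cast_nonneg (α := ℝ) m)]
    nlinarith [mul_nonpos_of_nonneg_of_nonpos hμ.le h8]

/-! ### Optimal solutions -/

/-- Improvement into a fixed ball reduces minimization over the unbounded subspace to a compact set.
-/
lemma exists_isMinOn_Psi (hm : 0 < m) (hμ : 0 < P.mu)
    (hq : ∀ i, P.q i ∈ stdSimplex ℝ (Fin n)) :
    ∃ u : Stacked m n, (∀ l, ∑ i, u (i, l) = 0) ∧ ‖u‖ ^ 2 ≤ n * m * P.normC ^ 2 ∧
      ∀ v : Stacked m n, (∀ l, ∑ i, v (i, l) = 0) → P.Psi u ≤ P.Psi v := by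
  set K : Set (Stacked m n) :=
    {u | (∀ l, ∑ i, u (i, l) = 0) ∧ ‖u‖ ^ 2 ≤ n * m * P.normC ^ 2} with hK
  have hcl : IsClosed K := by
    refine IsClosed.inter (s₁ := {u : Stacked m n | ∀ l, ∑ i, u (i, l) = 0})
      (s₂ := {u : Stacked m n | ‖u‖ ^ 2 ≤ n * m * P.normC ^ 2}) ?_ ?_
    · simp only [Set.ofPred_forall]
      exact isClosed_iInter fun l => isClosed_eq (by fun_prop) continuous_const
    · exact isClosed_le (by fun_prop) continuous_const
  have hsub : K ⊆ Metric.closedBall 0 (Real.sqrt (n * m * P.normC ^ 2)) := by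
    intro u hu
    rw [mem_closedBall_zero_iff]
    exact Real.le_sqrt_of_sq_le hu.2
  have hcomp : IsCompact K := (isCompact_closedBall _ _).of_isClosed_subset hcl hsub
  have hne : K.Nonempty := by
    refine ⟨0, fun l => by simp, ?_⟩
    rw [norm_zero, zero_pow two_ne_zero]
    positivity
  obtain ⟨u, hu, hmin⟩ := hcomp.exists_isMinOn hne P.continuous_Psi.continuousOn
  refine ⟨u, hu.1, hu.2, fun v hv => ?_⟩
  obtain ⟨v', h1, h2, h3⟩ := exists_le_of_sum_eq_zero hm hμ hq hv
  exact (hmin (show v' ∈ K from ⟨h1, h2⟩)).trans h3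

/-- First-order optimality: the deviation `e` of the gradient from its node average is a feasible
direction, and a step of length `μ`, the inverse smoothness constant, would decrease `Ψ` by at least
`μ‖e‖²/2`. -/
lemma block_meanX_eq (hm : 0 < m) (hμ : 0 < P.mu)
    (hq : ∀ i, P.q i ∈ stdSimplex ℝ (Fin n)) {u : Stacked m n} (hu : ∀ l, ∑ i, u (i, l) = 0)
    (hmin : ∀ v : Stacked m n, (∀ l, ∑ i, v (i, l) = 0) → P.Psi u ≤ P.Psi v) (i i' : Fin m) :
    block (P.meanX u) i = block (P.meanX u) i' := by
  have hm' : (m : ℝ) ≠ 0 := by positivity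
  set x := P.meanX u with hx
  set a : Fin n → ℝ := fun l => (∑ i, x (i, l)) / m with ha
  set e : Stacked m n := WithLp.toLp 2 fun il => x il - a il.2 with he
  have he0 (l : Fin n) : ∑ i, e (i, l) = 0 := by
    simp only [he, Finset.sum_sub_distrib, Finset.sum_const, Finset.card_univ, Fintype.card_fin,
      nsmul_eq_mul, ha]
    rw [mul_div_cancel₀ _ hm', sub_self]
  have hxe : inner ℝ x e = ‖e‖ ^ 2 := by
    have h1 : inner ℝ x e - ‖e‖ ^ 2 = 0 := by
      rw [inner_stacked, norm_sq_stacked, ← Finset.sum_sub_distrib]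
      have h2 (i : Fin m) (l : Fin n) :
          block x i l * block e i l - block e i l ^ 2 = a l * e (i, l) := by
        simp only [block, he]; ring
      simp only [← Finset.sum_sub_distrib, h2]
      rw [Finset.sum_comm]
      simp only [← Finset.mul_sum, he0, mul_zero, Finset.sum_const_zero]
    linarith
  have h1 := hmin (u - P.mu • e) fun l => by
    simp only [PiLp.sub_apply, PiLp.smul_apply, Finset.sum_sub_distrib, hu, smul_eq_mul,
      ← Finset.mul_sum, he0, mul_zero, sub_zero]
  have h2 := Psi_le hμ hq u (u - P.mu • e)
  rw [sub_sub_cancel_left, norm_neg, norm_smul, inner_neg_right, real_inner_smul_right, ← hx, hxe,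
    mul_pow, Real.norm_eq_abs, sq_abs] at h2
  have h3 : P.mu ^ 2 * ‖e‖ ^ 2 / (2 * P.mu) = P.mu * ‖e‖ ^ 2 / 2 := by field_simp
  have h4 : P.mu * ‖e‖ ^ 2 ≤ 0 := by linarith
  have h5 : ‖e‖ ^ 2 = 0 := by
    have := sq_nonneg ‖e‖
    nlinarith
  have h6 : e = 0 := by simpa using h5
  have h7 (i : Fin m) (l : Fin n) : x (i, l) = a l := by
    have : e (i, l) = 0 := by rw [h6]; rfl
    simp only [he] at this
    linarith
  funext l
  simp only [block, h7]

/-- Use one Gibbs atom per column with weights `q_i`: the frequencies match `q_i` exactly, so only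
Fenchel equalities remain. -/
lemma regW_meanX_le (hμ : 0 < P.mu) (hq : ∀ i, P.q i ∈ stdSimplex ℝ (Fin n)) (u : Stacked m n)
    (i : Fin m) : regW P.mu P.C (P.q i) (block (P.meanX u) i) ≤
      ∑ l, block u i l * block (P.meanX u) i l - conjW P.mu P.C (P.q i) (block u i) := by
  have h := regW_le_sum_atomCost_add hμ P.abs_C_le (hq i) (P.q i) id
    (fun j => compGrad P.mu P.C (block u i) j) (hq i).1 (hq i).2 fun j => compGrad_mem_stdSimplex _ j
  refine h.trans (le_of_eq ?_)
  rw [conjW_eq]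
  simp only [id, atomCost_compGrad hμ, mul_sub, Finset.sum_sub_distrib]
  have h1 : ∑ j, P.q i j * ∑ l, compGrad P.mu P.C (block u i) j l * block u i l =
      ∑ l, block u i l * block (P.meanX u) i l := by
    simp only [Finset.mul_sum]
    rw [Finset.sum_comm]
    refine Finset.sum_congr rfl fun l _ => ?_
    simp only [block, meanX, Finset.mul_sum]
    exact Finset.sum_congr rfl fun j _ => by ring
  have h2 : ∑ j, |∑ t, P.q i t * (if t = j then 1 else 0) - P.q i j| = 0 := by
    refine Finset.sum_eq_zero fun j _ => ?_
    simp
  rw [h1, h2]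
  ring

/-- Weak duality. -/
lemma inner_sub_psi_le (hμ : 0 < P.mu) (hq : ∀ i, P.q i ∈ stdSimplex ℝ (Fin n)) (y p : Stacked m n)
    (hp : ∀ i, block p i ∈ stdSimplex ℝ (Fin n)) :
    inner ℝ (P.sqrtW y) p - P.psi y ≤ ∑ i, regW P.mu P.C (P.q i) (block p i) := by
  rw [inner_stacked, psi, ← Finset.sum_sub_distrib]
  exact Finset.sum_le_sum fun i _ => sub_conjW_le_regW hμ (hp i) (hq i) _

/-- Strong duality, with a small dual solution. -/
theorem exists_dual_solution_and_barycenter (hm : 2 ≤ m) (hG : P.G.Connected) (hμ : 0 < P.mu)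
    (hq : ∀ i, P.q i ∈ stdSimplex ℝ (Fin n)) :
    (∃ y, P.IsDualSolution y ∧ ‖y‖ ≤ P.MF / Real.sqrt P.lamMinPos) ∧
      ∃ p, P.IsBarycenter p ∧ ∀ y, P.IsDualSolution y → P.objective p = -P.psi y := by
  have hm0 : 0 < m := by omega
  let i0 : Fin m := ⟨0, hm0⟩
  obtain ⟨l0⟩ : Nonempty (Fin n) := by
    by_contra h
    rw [not_nonempty_iff] at h
    simpa using (hq i0).2
  have hlam := P.lamMinPos_pos hm hG l0
  obtain ⟨u, hu0, hun, humin⟩ := exists_isMinOn_Psi hm0 hμ hq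
  obtain ⟨y, hyu, hyn⟩ := P.exists_sqrtW_eq hG hu0
  have hy : P.IsDualSolution y := by
    intro z _
    simp only [Set.mem_ofPred_eq, psi_eq, hyu]
    linarith [humin (P.sqrtW z) (P.sum_sqrtW_apply z)]
  refine ⟨⟨y, hy, ?_⟩, block (P.meanX u) i0, ?_⟩
  · rw [le_div_iff₀ (Real.sqrt_pos.2 hlam), MF]
    refine Real.le_sqrt_of_sq_le ?_
    rw [mul_pow, Real.sq_sqrt hlam.le]
    have : (0 : ℝ) ≤ n * m * P.normC ^ 2 := by positivity
    linarith
  have hp : block (P.meanX u) i0 ∈ stdSimplex ℝ (Fin n) := meanX_mem_stdSimplex hq u i0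
  -- At a consensus vector the inner product with the image of `√W` vanishes, so weak duality bounds
  -- the objective itself.
  have hlow (p : Fin n → ℝ) (hp : p ∈ stdSimplex ℝ (Fin n)) : -P.psi y ≤ P.objective p := by
    have h1 := inner_sub_psi_le hμ hq y (WithLp.toLp 2 fun il => p il.2) fun i => hp
    have h2 : inner ℝ (P.sqrtW y) (WithLp.toLp 2 fun il : Fin m × Fin n => p il.2) = (0 : ℝ) := by
      rw [inner_stacked, hyu, Finset.sum_comm]
      refine Finset.sum_eq_zero fun l _ => ?_
      simp only [block, ← Finset.sum_mul, hu0, zero_mul]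
    rw [h2, zero_sub] at h1
    exact h1
  have hupp : P.objective (block (P.meanX u) i0) ≤ -P.psi y := by
    have h1 := Finset.sum_le_sum fun i (_ : i ∈ Finset.univ) => regW_meanX_le hμ hq u i
    rw [Finset.sum_sub_distrib] at h1
    simp only [block_meanX_eq hm0 hμ hq hu0 humin _ i0] at h1
    rw [Finset.sum_comm] at h1
    have h2 (l : Fin n) : ∑ i, block u i l * block (P.meanX u) i0 l = 0 := by
      rw [← Finset.sum_mul]
      have : ∑ i, block u i l = 0 := hu0 l
      rw [this, zero_mul]
    simp only [h2, Finset.sum_const_zero, zero_sub] at h1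
    rw [psi, hyu]
    exact h1
  refine ⟨⟨hp, fun p hp => hupp.trans (hlow p hp)⟩, fun z hz => ?_⟩
  have h1 : P.psi z = P.psi y := le_antisymm (hz (Set.mem_univ y)) (hy (Set.mem_univ z))
  rw [h1]
  exact le_antisymm hupp (hlow _ hp)

end Dual

end BaryProblem

/-! ## Step sizes -/

lemma alpha_pos {L : ℝ} (hL : 0 < L) (k : ℕ) : 0 < alpha L (k + 1) := (alpha_spec hL k).1

lemma bigA_eq_sum (L : ℝ) (k : ℕ) : bigA L k = ∑ l ∈ Finset.range k, alpha L (l + 1) := by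
  induction k with
  | zero => rfl
  | succ k ih => rw [Finset.sum_range_succ, ← ih]; rfl

/-- The induction hypothesis gives `√(1 + 8 L A_k) ≥ k`, so the step is at least `(1 + k)/(4L)`,
more than the increment of `k²/(8L)`. -/
lemma sq_div_le_bigA {L : ℝ} (hL : 0 < L) (k : ℕ) : (k : ℝ) ^ 2 / (8 * L) ≤ bigA L k := by
  induction k with
  | zero => simp [bigA]
  | succ k ih =>
    have h1 : (k : ℝ) ≤ Real.sqrt (1 + 8 * L * bigA L k) := by
      refine Real.le_sqrt_of_sq_le ?_
      rw [div_le_iff₀ (by positivity)] at ih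
      linarith
    have h2 : (1 + (k : ℝ)) / (4 * L) ≤ stepRoot L (bigA L k) :=
      div_le_div_of_nonneg_right (by linarith) (by positivity)
    have h3 : ((k + 1 : ℕ) : ℝ) ^ 2 / (8 * L) ≤ k ^ 2 / (8 * L) + (1 + (k : ℝ)) / (4 * L) := by
      rw [show (1 + (k : ℝ)) / (4 * L) = (2 + 2 * k) / (8 * L) by field_simp; ring, ← add_div]
      refine div_le_div_of_nonneg_right ?_ (by positivity)
      push_cast
      linarith
    rw [bigA]
    linarith

lemma bigA_le_sq_div {L : ℝ} (hL : 0 < L) (k : ℕ) : bigA L k ≤ (k : ℝ) ^ 2 / (2 * L) := by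
  induction k with
  | zero => simp [bigA]
  | succ k ih =>
    have h1 : Real.sqrt (1 + 8 * L * bigA L k) ≤ 1 + 2 * k := by
      refine Real.sqrt_le_iff.2 ⟨by positivity, ?_⟩
      rw [le_div_iff₀ (by positivity)] at ih
      have hk : (0 : ℝ) ≤ k := Nat.cast_nonneg k
      nlinarith
    have h2 : stepRoot L (bigA L k) ≤ (2 + 2 * (k : ℝ)) / (4 * L) :=
      div_le_div_of_nonneg_right (by linarith) (by positivity)
    have h3 : (k : ℝ) ^ 2 / (2 * L) + (2 + 2 * (k : ℝ)) / (4 * L) ≤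
        ((k + 1 : ℕ) : ℝ) ^ 2 / (2 * L) := by
      rw [show (2 + 2 * (k : ℝ)) / (4 * L) = (1 + k) / (2 * L) by field_simp; ring, ← add_div]
      refine div_le_div_of_nonneg_right ?_ (by positivity)
      push_cast
      nlinarith
    rw [bigA]
    linarith

lemma bigA_pos {L : ℝ} (hL : 0 < L) {N : ℕ} (hN : 1 ≤ N) : 0 < bigA L N := by
  have : 0 < (N : ℝ) ^ 2 / (8 * L) := by positivity
  exact this.trans_le (sq_div_le_bigA hL N)

/-! ## One step of the accelerated method with an inexact gradient -/

/-- The estimate-sequence step for a biased `g`. The factor 2 in `A' = 2 L a²` leaves slack: the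
terms quadratic in `g` and `G lam` combine to `a²(‖g‖²/4 - ⟪G lam, g⟫ + ‖G lam‖²) ≥ 0`, and the
error enters only through `a²‖g - G lam‖²` and a term linear in it. -/
lemma accelerated_step {E : Type*} [NormedAddCommGroup E] [InnerProductSpace ℝ E] {f : E → ℝ}
    {G : E → E} {L a A A' : ℝ} (ha : 0 < a) (hA : 0 ≤ A) (hA' : A' = A + a)
    (hAa : A + a = 2 * L * a ^ 2) (hconv : ∀ x y, f x + inner ℝ (G x) (y - x) ≤ f y)
    (hsm : ∀ x y, f y ≤ f x + inner ℝ (G x) (y - x) + L / 2 * ‖y - x‖ ^ 2)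
    {ζ y lam ζ' y' g : E} (hlam : lam = A'⁻¹ • (a • ζ + A • y)) (hζ' : ζ' = ζ - a • g)
    (hy' : y' = A'⁻¹ • (a • ζ' + A • y)) (z : E) :
    A' * f y' ≤ A * f y + a * (f lam + inner ℝ g (z - lam)) + ‖ζ - z‖ ^ 2 / 2 - ‖ζ' - z‖ ^ 2 / 2 +
      a * inner ℝ (g - G lam) (lam - ζ) + a ^ 2 * ‖g - G lam‖ ^ 2 := by
  have hA'pos : 0 < A' := by linarith
  have hd : y' - lam = (-(a ^ 2 / A')) • g := by
    rw [hy', hlam, hζ', ← smul_sub, div_eq_inv_mul, ← mul_neg, mul_smul]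
    congr 1
    rw [smul_sub, smul_smul, neg_smul, sq]
    abel
  have h1 := hsm lam y'
  rw [hd, real_inner_smul_right, norm_smul, mul_pow, Real.norm_eq_abs, sq_abs] at h1
  have h1' : A' * f y' ≤ A' * f lam - a ^ 2 * inner ℝ (G lam) g + a ^ 2 / 4 * ‖g‖ ^ 2 := by
    have h2 := mul_le_mul_of_nonneg_left h1 hA'pos.le
    refine h2.trans (le_of_eq ?_)
    have h3 : A' * (L / 2 * ((-(a ^ 2 / A')) ^ 2 * ‖g‖ ^ 2)) = a ^ 2 / 4 * ‖g‖ ^ 2 := by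
      have h4 : L = A' / (2 * a ^ 2) := by rw [hA', hAa]; field_simp
      rw [h4]
      field_simp
      ring
    rw [mul_add, mul_add, h3]
    field_simp
    ring
  -- The definition of `lam` as a weighted mean turns the convexity term at `y` into one along `lam
  -- - ζ`.
  have h3 : A • (y - lam) = a • (lam - ζ) := by
    have h4 : A' • lam = a • ζ + A • y := by
      rw [hlam, smul_smul, mul_inv_cancel₀ hA'pos.ne', one_smul]
    rw [hA', add_smul] at h4
    rw [smul_sub, smul_sub, sub_eq_sub_iff_add_eq_add, add_comm (A • y), ← h4, add_comm]
  have h4 := mul_le_mul_of_nonneg_left (hconv lam y) hA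
  rw [mul_add, ← real_inner_smul_right, h3, real_inner_smul_right] at h4
  have h5 : ‖ζ' - z‖ ^ 2 = ‖ζ - z‖ ^ 2 - 2 * a * inner ℝ g (ζ - z) + a ^ 2 * ‖g‖ ^ 2 := by
    rw [hζ', sub_right_comm, norm_sub_sq_real, norm_smul, real_inner_smul_right, mul_pow,
      Real.norm_eq_abs, sq_abs, real_inner_comm]
    ring
  have h6 : ‖g - G lam‖ ^ 2 = ‖g‖ ^ 2 - 2 * inner ℝ (G lam) g + ‖G lam‖ ^ 2 := by
    rw [norm_sub_sq_real, real_inner_comm]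
  have h7 : 0 ≤ ‖g‖ ^ 2 / 4 - inner ℝ (G lam) g + ‖G lam‖ ^ 2 := by
    have h8 := real_inner_le_norm (G lam) g
    nlinarith [sq_nonneg (‖g‖ / 2 - ‖G lam‖)]
  have h9 : inner ℝ g (z - lam) = inner ℝ g (ζ - lam) - inner ℝ g (ζ - z) := by
    rw [← inner_sub_right]
    congr 1
    abel
  have h10 : inner ℝ (g - G lam) (lam - ζ) = -inner ℝ g (ζ - lam) - inner ℝ (G lam) (lam - ζ) := by
    rw [inner_sub_left, ← inner_neg_right, neg_sub]
  rw [h5, h6, h9, h10]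
  have h11 := mul_nonneg (sq_nonneg a) h7
  rw [hA'] at h1'
  rw [hA']
  linarith

namespace BaryProblem

/-! ### Primal-dual inequalities for a fixed realization of the samples -/

section Deterministic

variable {m n : ℕ} {P : BaryProblem m n}

lemma Lpsi_pos (hμ : 0 < P.mu) (hlam : 0 < P.lamMax) : 0 < P.Lpsi := div_pos hlam hμ

lemma psi_ge (hμ : 0 < P.mu) (hq : ∀ i, P.q i ∈ stdSimplex ℝ (Fin n)) (x y : Stacked m n) :
    P.psi x + inner ℝ (P.sqrtW (P.meanX (P.sqrtW x))) (y - x) ≤ P.psi y := by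
  rw [psi_eq, psi_eq, inner_sqrtW_left, map_sub]
  linarith [Psi_ge hμ hq (P.sqrtW x) (P.sqrtW y)]

lemma psi_le (hμ : 0 < P.mu) (hq : ∀ i, P.q i ∈ stdSimplex ℝ (Fin n)) (x y : Stacked m n) :
    P.psi y ≤ P.psi x + inner ℝ (P.sqrtW (P.meanX (P.sqrtW x))) (y - x) +
      P.Lpsi / 2 * ‖y - x‖ ^ 2 := by
  have h1 := Psi_le hμ hq (P.sqrtW x) (P.sqrtW y)
  rw [← map_sub, ← inner_sqrtW_left] at h1
  have h2 : ‖P.sqrtW (y - x)‖ ^ 2 / (2 * P.mu) ≤ P.Lpsi / 2 * ‖y - x‖ ^ 2 := by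
    rw [div_le_iff₀ (by positivity)]
    have h3 : P.Lpsi / 2 * ‖y - x‖ ^ 2 * (2 * P.mu) = P.lamMax * ‖y - x‖ ^ 2 := by
      rw [Lpsi]; field_simp
    rw [h3]
    exact P.norm_sqrtW_sq_le _
  rw [psi_eq, psi_eq]
  linarith

variable (P)

/-- The average of `logZ` over the samples, summed over the nodes. -/
noncomputable def sampleVal (r : ℕ) (ξ : ℕ → Fin m → Fin n) (u : Stacked m n) : ℝ :=
  ∑ i, (∑ s ∈ Finset.range r, logZ P.mu P.C (ξ s i) (block u i)) / r

/-- The average cost of the sampled atoms, summed over the nodes. -/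
noncomputable def sampleCost (r : ℕ) (ξ : ℕ → Fin m → Fin n) (u : Stacked m n) : ℝ :=
  ∑ i, (∑ s ∈ Finset.range r,
    atomCost P.mu P.C (ξ s i) (compGrad P.mu P.C (block u i) (ξ s i))) / r

/-- The point at which the `k`-th batch is drawn. -/
noncomputable def dualPoint (r : ℕ → ℕ) (ξ : ℕ → ℕ → Fin m → Fin n) (k : ℕ) : Stacked m n :=
  P.sqrtW (P.iterate r ξ k).lam

/-- The error of the `k`-th batch as an estimate of the mean. -/
noncomputable def noiseX (r : ℕ → ℕ) (ξ : ℕ → ℕ → Fin m → Fin n) (k : ℕ) : Stacked m n :=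
  P.batchX (r k) (ξ k) (P.dualPoint r ξ k) - P.meanX (P.dualPoint r ξ k)

/-- The error of the `k`-th batch in the value of `Ψ`. -/
noncomputable def noiseV (r : ℕ → ℕ) (ξ : ℕ → ℕ → Fin m → Fin n) (k : ℕ) : ℝ :=
  P.Psi (P.dualPoint r ξ k) - P.sampleVal (r k) (ξ k) (P.dualPoint r ξ k)

variable {P}

lemma sampleCost_eq (hμ : 0 < P.mu) (r : ℕ) (ξ : ℕ → Fin m → Fin n) (u : Stacked m n) :
    P.sampleCost r ξ u = inner ℝ (P.batchX r ξ u) u - P.sampleVal r ξ u := by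
  rw [inner_stacked, sampleCost, sampleVal, ← Finset.sum_sub_distrib]
  refine Finset.sum_congr rfl fun i _ => ?_
  simp only [atomCost_compGrad hμ, Finset.sum_sub_distrib, sub_div]
  congr 1
  rw [Finset.sum_comm, Finset.sum_div]
  refine Finset.sum_congr rfl fun l _ => ?_
  simp only [block, batchX, ← Finset.sum_mul]
  ring

variable {r : ℕ → ℕ} {ξ : ℕ → ℕ → Fin m → Fin n}

lemma iterate_step (hμ : 0 < P.mu) (hlam : 0 < P.lamMax)
    (hq : ∀ i, P.q i ∈ stdSimplex ℝ (Fin n)) (k : ℕ) (z : Stacked m n) :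
    bigA P.Lpsi (k + 1) * P.psi (P.iterate r ξ (k + 1)).y ≤
      bigA P.Lpsi k * P.psi (P.iterate r ξ k).y +
      alpha P.Lpsi (k + 1) * (P.psi (P.iterate r ξ (k + 1)).lam +
        inner ℝ (P.sqrtW (P.batchX (r (k + 1)) (ξ (k + 1)) (P.dualPoint r ξ (k + 1))))
          (z - (P.iterate r ξ (k + 1)).lam)) +
      ‖(P.iterate r ξ k).zeta - z‖ ^ 2 / 2 - ‖(P.iterate r ξ (k + 1)).zeta - z‖ ^ 2 / 2 +
      alpha P.Lpsi (k + 1) * inner ℝ (P.sqrtW (P.noiseX r ξ (k + 1)))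
        ((P.iterate r ξ (k + 1)).lam - (P.iterate r ξ k).zeta) +
      alpha P.Lpsi (k + 1) ^ 2 * ‖P.sqrtW (P.noiseX r ξ (k + 1))‖ ^ 2 := by
  have hL := Lpsi_pos hμ hlam
  obtain ⟨h1, h2, h3⟩ := alpha_spec hL k
  have h := accelerated_step (f := P.psi) (G := fun x => P.sqrtW (P.meanX (P.sqrtW x))) h1
    (bigA_nonneg hL k) h2 h3 (psi_ge hμ hq) (psi_le hμ hq)
    (ζ := (P.iterate r ξ k).zeta) (y := (P.iterate r ξ k).y) (lam := (P.iterate r ξ (k + 1)).lam)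
    (ζ' := (P.iterate r ξ (k + 1)).zeta) (y' := (P.iterate r ξ (k + 1)).y) rfl rfl rfl z
  rw [noiseX, map_sub]
  exact h

/-- Fenchel equality at the sampled atoms converts the linear model at `λ^k` into a linear function
of `√W z` minus the atom costs, up to the error in the value of `Ψ`. -/
lemma psi_add_inner_eq (hμ : 0 < P.mu) (k : ℕ) (z : Stacked m n) :
    P.psi (P.iterate r ξ k).lam + inner ℝ (P.sqrtW (P.batchX (r k) (ξ k) (P.dualPoint r ξ k)))
        (z - (P.iterate r ξ k).lam) =
      inner ℝ (P.batchX (r k) (ξ k) (P.dualPoint r ξ k)) (P.sqrtW z) + P.noiseV r ξ k -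
        (P.sampleCost (r k) (ξ k) (P.dualPoint r ξ k) + P.entropyQ) := by
  rw [inner_sqrtW_left, map_sub, inner_sub_right, sampleCost_eq hμ, noiseV, psi_eq]
  simp only [dualPoint]
  ring

/-- The primal-dual estimate of the method in terms of the sampling errors. -/
lemma primal_dual_sum (hμ : 0 < P.mu) (hlam : 0 < P.lamMax)
    (hq : ∀ i, P.q i ∈ stdSimplex ℝ (Fin n)) (N : ℕ) (z : Stacked m n) :
    bigA P.Lpsi N * P.psi (P.iterate r ξ N).y +
      ∑ k ∈ Finset.range N, alpha P.Lpsi (k + 1) *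
        (P.sampleCost (r (k + 1)) (ξ (k + 1)) (P.dualPoint r ξ (k + 1)) + P.entropyQ) ≤
      ∑ k ∈ Finset.range N, alpha P.Lpsi (k + 1) *
        inner ℝ (P.batchX (r (k + 1)) (ξ (k + 1)) (P.dualPoint r ξ (k + 1))) (P.sqrtW z) +
      ‖z‖ ^ 2 / 2 - ‖(P.iterate r ξ N).zeta - z‖ ^ 2 / 2 +
      ∑ k ∈ Finset.range N, alpha P.Lpsi (k + 1) * (P.noiseV r ξ (k + 1) +
        inner ℝ (P.sqrtW (P.noiseX r ξ (k + 1)))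
          ((P.iterate r ξ (k + 1)).lam - (P.iterate r ξ k).zeta)) +
      ∑ k ∈ Finset.range N,
        alpha P.Lpsi (k + 1) ^ 2 * ‖P.sqrtW (P.noiseX r ξ (k + 1))‖ ^ 2 := by
  induction N with
  | zero => simp [bigA, iterate]
  | succ N ih =>
    have h := iterate_step (r := r) (ξ := ξ) hμ hlam hq N z
    rw [psi_add_inner_eq hμ] at h
    simp only [Finset.sum_range_succ]
    linarith

/-- The distance to a dual solution in terms of the sampling errors. -/
lemma norm_zeta_sub_sq_le (hμ : 0 < P.mu) (hlam : 0 < P.lamMax)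
    (hq : ∀ i, P.q i ∈ stdSimplex ℝ (Fin n)) {z : Stacked m n} (hz : P.IsDualSolution z) (N : ℕ) :
    ‖(P.iterate r ξ N).zeta - z‖ ^ 2 / 2 ≤ ‖z‖ ^ 2 / 2 +
      ∑ k ∈ Finset.range N, alpha P.Lpsi (k + 1) * inner ℝ (P.sqrtW (P.noiseX r ξ (k + 1)))
          (z - (P.iterate r ξ k).zeta) +
      ∑ k ∈ Finset.range N,
        alpha P.Lpsi (k + 1) ^ 2 * ‖P.sqrtW (P.noiseX r ξ (k + 1))‖ ^ 2 := by
  have hL := Lpsi_pos hμ hlam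
  have key : bigA P.Lpsi N * (P.psi (P.iterate r ξ N).y - P.psi z) +
      ‖(P.iterate r ξ N).zeta - z‖ ^ 2 / 2 ≤ ‖z‖ ^ 2 / 2 +
      ∑ k ∈ Finset.range N, alpha P.Lpsi (k + 1) * inner ℝ (P.sqrtW (P.noiseX r ξ (k + 1)))
          (z - (P.iterate r ξ k).zeta) +
      ∑ k ∈ Finset.range N,
        alpha P.Lpsi (k + 1) ^ 2 * ‖P.sqrtW (P.noiseX r ξ (k + 1))‖ ^ 2 := by
    induction N with
    | zero => simp [bigA, iterate]
    | succ N ih =>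
      have h := iterate_step (r := r) (ξ := ξ) hμ hlam hq N z
      have h1 := psi_ge hμ hq (P.iterate r ξ (N + 1)).lam z
      set lam := (P.iterate r ξ (N + 1)).lam
      have h2 : inner ℝ (P.sqrtW (P.batchX (r (N + 1)) (ξ (N + 1)) (P.dualPoint r ξ (N + 1))))
          (z - lam) = inner ℝ (P.sqrtW (P.meanX (P.sqrtW lam))) (z - lam) +
            inner ℝ (P.sqrtW (P.noiseX r ξ (N + 1))) (z - lam) := by
        rw [← inner_add_left, ← map_add, noiseX]
        congr 2
        exact (add_sub_cancel _ _).symm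
      -- The errors against `z - λ` and `λ - ζ` merge into one against `z - ζ^N`. For fixed `z` this
      -- vector is determined before batch `N + 1` is drawn.
      have h3 : inner ℝ (P.sqrtW (P.noiseX r ξ (N + 1))) (z - (P.iterate r ξ N).zeta) =
          inner ℝ (P.sqrtW (P.noiseX r ξ (N + 1))) (z - lam) +
          inner ℝ (P.sqrtW (P.noiseX r ξ (N + 1))) (lam - (P.iterate r ξ N).zeta) := by
        rw [← inner_add_right, sub_add_sub_cancel]
      have ha := alpha_pos hL N
      have h4 := mul_le_mul_of_nonneg_left h1 ha.le
      have h5 := (alpha_spec hL N).2.1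
      simp only [Finset.sum_range_succ]
      rw [h2] at h
      rw [h3]
      rw [h5] at h ⊢
      linarith
  have h1 : 0 ≤ bigA P.Lpsi N * (P.psi (P.iterate r ξ N).y - P.psi z) :=
    mul_nonneg (bigA_nonneg hL N) (sub_nonneg.2 (hz (Set.mem_univ _)))
  linarith

end Deterministic

end BaryProblem

/-! ## Supermartingales of independent samples from a finite set -/

section Supermartingale

variable {ι S Ω : Type*} [Fintype S] [MeasurableSpace S] [DiscreteMeasurableSpace S]
  [MeasurableSpace Ω] {Pr : Measure Ω} {X : ι → Ω → S}

/-- The function factors through finitely many coordinates in a finite set, hence through a discrete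
space. -/
lemma measurable_comp_of_dependsOn {β : Type*} [MeasurableSpace β] (hX : ∀ i, Measurable (X i))
    [Nonempty β] {J : Finset ι} {V : (ι → S) → β} (hV : DependsOn V (J : Set ι)) :
    Measurable fun w => V fun i => X i w := by
  obtain ⟨g, hg⟩ := dependsOn_iff_exists_comp.1 hV
  have h1 : Measurable fun w => fun j : (J : Set ι) => X j w := measurable_pi_lambda _ fun j => hX j
  have h2 : Measurable g := Measurable.of_discrete
  have h3 : (fun w => V fun i => X i w) = g ∘ fun w => fun j : (J : Set ι) => X j w := by
    rw [hg]; rfl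
  rw [h3]
  exact h2.comp h1

/-- One supermartingale step without conditional expectations: split according to the value of the
fresh coordinate `i`, which is independent of those in `J`, and integrate it out. -/
lemma lintegral_le_of_sum_update_le [DecidableEq ι] [IsProbabilityMeasure Pr]
    (hX : ∀ i, Measurable (X i)) (hind : iIndepFun X Pr) {J : Finset ι} {i : ι} (hi : i ∉ J)
    {V V' : (ι → S) → ENNReal} (hV' : DependsOn V' (insert i J : Finset ι))
    (h : ∀ ω, ∑ x, Pr (X i ⁻¹' {x}) * V' (Function.update ω i x) ≤ V ω) :
    ∫⁻ w, V' (fun j => X j w) ∂Pr ≤ ∫⁻ w, V (fun j => X j w) ∂Pr := by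
  classical
  have hdep (x : S) : DependsOn (fun ω => V' (Function.update ω i x)) (J : Set ι) := by
    intro ω ω' hω
    refine hV' fun j hj => ?_
    rcases eq_or_ne j i with rfl | hji
    · simp
    · rw [Function.update_of_ne hji, Function.update_of_ne hji]
      exact hω j ((Finset.mem_insert.1 (Finset.mem_coe.1 hj)).resolve_left hji)
  have hsum (w : Ω) : V' (fun j => X j w) =
      ∑ x, (X i ⁻¹' {x}).indicator 1 w * V' (Function.update (fun j => X j w) i x) := by
    rw [Finset.sum_eq_single (X i w)]
    · simp
    · intro x _ hx
      simp [Ne.symm hx]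
    · simp
  have hterm (x : S) : ∫⁻ w, (X i ⁻¹' {x}).indicator 1 w *
      V' (Function.update (fun j => X j w) i x) ∂Pr =
        ∫⁻ w, Pr (X i ⁻¹' {x}) * V' (Function.update (fun j => X j w) i x) ∂Pr := by
    obtain ⟨g, hg⟩ := dependsOn_iff_exists_comp.1 (hdep x)
    have hmeas := measurable_comp_of_dependsOn hX (hdep x)
    have hind2 := hind.indepFun_finset J {i} (Finset.disjoint_singleton_right.2 hi) hX
    have h1 : Measurable g := Measurable.of_discrete
    have h2 : Measurable fun ρ : ({i} : Finset ι) → S =>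
        ({x} : Set S).indicator (1 : S → ENNReal) (ρ ⟨i, Finset.mem_singleton_self i⟩) :=
      Measurable.of_discrete
    have hind3 := hind2.symm.comp h2 h1
    have h3 := lintegral_mul_eq_lintegral_mul_lintegral_of_indepFun
      (h2.comp (measurable_pi_lambda _ fun j => hX j))
      (h1.comp (measurable_pi_lambda _ fun j => hX j)) hind3
    have hfun : (fun w => V' (Function.update (fun j => X j w) i x)) =
        g ∘ fun w (j : J) => X j w := by
      funext w
      exact congrFun hg fun j => X j w
    have hfun2 : ((X i ⁻¹' {x}).indicator 1 : Ω → ENNReal) =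
        (fun ρ : ({i} : Finset ι) → S => ({x} : Set S).indicator (1 : S → ENNReal)
          (ρ ⟨i, Finset.mem_singleton_self i⟩)) ∘ fun w (j : ({i} : Finset ι)) => X j w := by
      funext w
      rfl
    rw [lintegral_const_mul _ hmeas, hfun]
    have h4 : ∫⁻ w, (X i ⁻¹' {x}).indicator 1 w ∂Pr = Pr (X i ⁻¹' {x}) :=
      lintegral_indicator_one (hX i (measurableSet_singleton x))
    rw [← h4, hfun2]
    refine (lintegral_congr fun w => ?_).trans h3
    exact congrArg _ (congrFun hfun w)
  calc ∫⁻ w, V' (fun j => X j w) ∂Pr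
      = ∫⁻ w, ∑ x, (X i ⁻¹' {x}).indicator 1 w *
          V' (Function.update (fun j => X j w) i x) ∂Pr := lintegral_congr hsum
    _ = ∑ x, ∫⁻ w, (X i ⁻¹' {x}).indicator 1 w *
          V' (Function.update (fun j => X j w) i x) ∂Pr := by
        refine lintegral_finsetSum _ fun x _ => Measurable.mul ?_
          (measurable_comp_of_dependsOn hX (hdep x))
        exact measurable_one.indicator (hX i (measurableSet_singleton x))
    _ = ∑ x, ∫⁻ w, Pr (X i ⁻¹' {x}) * V' (Function.update (fun j => X j w) i x) ∂Pr :=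
        Finset.sum_congr rfl fun x _ => hterm x
    _ = ∫⁻ w, ∑ x, Pr (X i ⁻¹' {x}) * V' (Function.update (fun j => X j w) i x) ∂Pr := by
        rw [lintegral_finsetSum]
        exact fun x _ => (measurable_comp_of_dependsOn hX (hdep x)).const_mul _
    _ ≤ _ := lintegral_mono fun w => h _

end Supermartingale

/-- Bound `exp` by its chord on `[-c, c]`. The mean-zero condition removes the linear part, and
`cosh c ≤ exp(c²/2)` finishes. -/
lemma sum_mul_exp_le_of_abs_le {S : Type*} [Fintype S] {p φ : S → ℝ} (hp : ∀ x, 0 ≤ p x) (hp1 : ∑ x, p x = 1)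
    (hφ : ∑ x, p x * φ x = 0) {c : ℝ} (hc : ∀ x, |φ x| ≤ c) :
    ∑ x, p x * Real.exp (φ x) ≤ Real.exp (c ^ 2 / 2) := by
  have hc0 : 0 ≤ c := by
    by_contra h
    have : IsEmpty S := ⟨fun x => h ((abs_nonneg _).trans (hc x))⟩
    simp at hp1
  rcases hc0.eq_or_lt with rfl | hc0
  · have h (x : S) : φ x = 0 := abs_nonpos_iff.1 (hc x)
    simp [h, hp1]
  · have key (x : S) : Real.exp (φ x) ≤ Real.cosh c + φ x / c * Real.sinh c := by
      have h1 := abs_le.1 (hc x)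
      have h2 := convexOn_exp.2 (Set.mem_univ c) (Set.mem_univ (-c))
        (show 0 ≤ (1 + φ x / c) / 2 by
          have : -1 ≤ φ x / c := by rw [le_div_iff₀ hc0]; linarith
          linarith)
        (show 0 ≤ (1 - φ x / c) / 2 by
          have : φ x / c ≤ 1 := by rw [div_le_iff₀ hc0]; linarith
          linarith) (by ring)
      have h3 : (1 + φ x / c) / 2 * c + (1 - φ x / c) / 2 * (-c) = φ x := by field_simp; ring
      simp only [smul_eq_mul] at h2
      rw [h3] at h2
      rw [Real.cosh_eq, Real.sinh_eq]
      linarith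
    calc ∑ x, p x * Real.exp (φ x) ≤ ∑ x, p x * (Real.cosh c + φ x / c * Real.sinh c) :=
          Finset.sum_le_sum fun x _ => mul_le_mul_of_nonneg_left (key x) (hp x)
      _ = (∑ x, p x) * Real.cosh c + (∑ x, p x * φ x) * (Real.sinh c / c) := by
          rw [Finset.sum_mul, Finset.sum_mul, ← Finset.sum_add_distrib]
          exact Finset.sum_congr rfl fun x _ => by ring
      _ = Real.cosh c := by rw [hp1, hφ]; ring
      _ ≤ _ := Real.cosh_le_exp_half_sq c

/-! ## Batches -/

section Batches

variable {S Ω : Type*}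

/-- The samples `(k', s)` with `k' ≤ k` and `s < r_{k'}`. -/
def hist (r : ℕ → ℕ) (k : ℕ) : Finset (ℕ × ℕ) :=
  (Finset.range (k + 1)).biUnion fun k' => (Finset.range (r k')).image fun s => (k', s)

lemma mem_hist {r : ℕ → ℕ} {k : ℕ} {a : ℕ × ℕ} : a ∈ hist r k ↔ a.1 ≤ k ∧ a.2 < r a.1 := by
  obtain ⟨a, b⟩ := a
  simp only [hist, Finset.mem_biUnion, Finset.mem_range, Finset.mem_image, Prod.mk.injEq]
  constructor
  · rintro ⟨k', h1, s, h2, rfl, rfl⟩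
    exact ⟨by omega, h2⟩
  · rintro ⟨h1, h2⟩
    exact ⟨a, by omega, b, h2, rfl, rfl⟩

lemma hist_mono {r : ℕ → ℕ} {k k' : ℕ} (h : k ≤ k') :
    ((hist r k : Finset (ℕ × ℕ)) : Set (ℕ × ℕ)) ⊆ hist r k' := by
  intro a ha
  rw [Finset.mem_coe, mem_hist] at ha ⊢
  exact ⟨ha.1.trans h, ha.2⟩

/-- The state after `N` batches and `t` samples of the next one, when each sample of batch `l + 1`
adds the increment `D l`, which may depend on the samples of the previous batches. -/
def walk {E : Type*} [AddCommMonoid E] (r : ℕ → ℕ) (D : ℕ → (ℕ × ℕ → S) → S → E) (N t : ℕ)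
    (ω : ℕ × ℕ → S) : E :=
  ∑ l ∈ Finset.range N, ∑ s ∈ Finset.range (r (l + 1)), D l ω (ω (l + 1, s)) +
    ∑ s ∈ Finset.range t, D N ω (ω (N + 1, s))

lemma walk_zero {E : Type*} [AddCommMonoid E] (r : ℕ → ℕ) (D : ℕ → (ℕ × ℕ → S) → S → E) (N : ℕ)
    (ω : ℕ × ℕ → S) : walk r D N 0 ω =
      ∑ l ∈ Finset.range N, ∑ s ∈ Finset.range (r (l + 1)), D l ω (ω (l + 1, s)) := by
  simp [walk]

lemma dependsOn_walk {E : Type*} [AddCommMonoid E] {r : ℕ → ℕ} {D : ℕ → (ℕ × ℕ → S) → S → E}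
    {N t : ℕ} (hD : ∀ l ≤ N, DependsOn (D l) (hist r l : Set (ℕ × ℕ))) :
    DependsOn (walk r D N t) ((hist r N ∪ (Finset.range t).image fun s => (N + 1, s) :
      Finset (ℕ × ℕ)) : Set (ℕ × ℕ)) := by
  intro ω ω' h
  have h1 (l : ℕ) (hl : l ≤ N) : D l ω = D l ω' := hD l hl fun a ha =>
    h a (Finset.mem_coe.2 (Finset.mem_union_left _ (hist_mono hl ha)))
  rw [walk, walk]
  congr 1
  · refine Finset.sum_congr rfl fun l hl => Finset.sum_congr rfl fun s hs => ?_
    rw [Finset.mem_range] at hl hs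
    rw [h1 l hl.le, h (l + 1, s) (Finset.mem_coe.2 (Finset.mem_union_left _
      (mem_hist.2 ⟨Nat.succ_le_of_lt hl, hs⟩)))]
  · refine Finset.sum_congr rfl fun s hs => ?_
    rw [h1 N le_rfl, h (N + 1, s) (Finset.mem_coe.2 (Finset.mem_union_right _
      (Finset.mem_image.2 ⟨s, hs, rfl⟩)))]

variable [Fintype S] [MeasurableSpace S] [DiscreteMeasurableSpace S]
  [MeasurableSpace Ω] {Pr : Measure Ω} [IsProbabilityMeasure Pr] {X : ℕ × ℕ → Ω → S}

/-- If a potential does not increase on average with any increment, then its mean along the walk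
is at most its initial value. -/
lemma lintegral_walk_le {E : Type*} [AddCommMonoid E] (hX : ∀ i, Measurable (X i))
    (hind : iIndepFun X Pr) {r : ℕ → ℕ} {D : ℕ → (ℕ × ℕ → S) → S → E} {N : ℕ}
    (hD : ∀ l < N, DependsOn (D l) (hist r l : Set (ℕ × ℕ))) {Φ : E → ENNReal}
    (hΦ : ∀ l < N, ∀ s ω v, ∑ x, Pr (X (l + 1, s) ⁻¹' {x}) * Φ (v + D l ω x) ≤ Φ v) :
    ∫⁻ w, Φ (walk r D N 0 fun i => X i w) ∂Pr ≤ Φ 0 := by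
  induction N with
  | zero => simp [walk]
  | succ N ih =>
    have hstep : ∀ t ≤ r (N + 1), ∫⁻ w, Φ (walk r D N t fun i => X i w) ∂Pr ≤
        ∫⁻ w, Φ (walk r D N 0 fun i => X i w) ∂Pr := by
      intro t ht
      induction t with
      | zero => exact le_rfl
      | succ t iht =>
        refine le_trans ?_ (iht (by omega))
        have hdep := dependsOn_walk (N := N) (t := t) fun l hl => hD l (by omega)
        have hdep' := dependsOn_walk (N := N) (t := t + 1) fun l hl => hD l (by omega)
        -- The next sample is fresh: neither the walk so far nor its next increment map depends on
        -- it.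
        have hi : (N + 1, t) ∉ hist r N ∪ (Finset.range t).image fun s => (N + 1, s) := by
          simp [mem_hist]
        refine lintegral_le_of_sum_update_le hX hind hi
          (V := fun ω => Φ (walk r D N t ω)) (V' := fun ω => Φ (walk r D N (t + 1) ω)) ?_ fun ω => ?_
        · intro ω ω' h
          refine congrArg Φ (hdep' fun a ha => h a ?_)
          rw [Finset.mem_coe] at ha ⊢
          rw [Finset.mem_insert]
          rcases Finset.mem_union.1 ha with ha | ha
          · exact Or.inr (Finset.mem_union_left _ ha)
          · obtain ⟨s, hs, rfl⟩ := Finset.mem_image.1 ha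
            rcases eq_or_ne s t with rfl | hst
            · exact Or.inl rfl
            · exact Or.inr (Finset.mem_union_right _ (Finset.mem_image.2 ⟨s, by
                rw [Finset.mem_range] at hs ⊢; omega, rfl⟩))
        · refine le_trans (le_of_eq ?_) (hΦ N (by omega) t ω _)
          refine Finset.sum_congr rfl fun x _ => ?_
          have h1 : walk r D N t (Function.update ω (N + 1, t) x) = walk r D N t ω := by
            refine hdep fun a ha => Function.update_of_ne ?_ _ _
            rintro rfl
            exact hi (Finset.mem_coe.1 ha)
          have h2 : D N (Function.update ω (N + 1, t) x) = D N ω := by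
            refine hD N (by omega) fun a ha => Function.update_of_ne ?_ _ _
            rintro rfl
            exact hi (Finset.mem_union_left _ (Finset.mem_coe.1 ha))
          have h3 : walk r D N (t + 1) (Function.update ω (N + 1, t) x) =
              walk r D N t ω + D N ω x := by
            rw [← h1, walk, walk, Finset.sum_range_succ, ← add_assoc, Function.update_self, h2]
          rw [h3]
    have h1 : ∀ ω, walk r D (N + 1) 0 ω = walk r D N (r (N + 1)) ω := by
      intro ω
      simp [walk, Finset.sum_range_succ]
    simp only [h1]
    exact (hstep _ le_rfl).trans (ih (fun l hl => hD l (by omega)) fun l hl => hΦ l (by omega))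

/-- The exponential Markov inequality applied to the supermartingale `exp Φ` along the walk. -/
lemma measure_walk_ge_le {E : Type*} [AddCommMonoid E] (hX : ∀ i, Measurable (X i))
    (hind : iIndepFun X Pr) {r : ℕ → ℕ} {D : ℕ → (ℕ × ℕ → S) → S → E} {N : ℕ}
    (hD : ∀ l < N, DependsOn (D l) (hist r l : Set (ℕ × ℕ))) {Φ : E → ℝ}
    (hΦ : ∀ l < N, ∀ s ω v, ∑ x, Pr.real (X (l + 1, s) ⁻¹' {x}) * Real.exp (Φ (v + D l ω x)) ≤
      Real.exp (Φ v)) (t : ℝ) :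
    Pr.real {w | t ≤ Φ (walk r D N 0 fun i => X i w)} ≤ Real.exp (Φ 0 - t) := by
  have h := lintegral_walk_le hX hind hD (Φ := fun v => ENNReal.ofReal (Real.exp (Φ v))) ?_
  · have hdep : DependsOn (walk r D N 0) (hist r N : Set (ℕ × ℕ)) := by
      intro ω ω' hω
      have h1 (l : ℕ) (hl : l < N) : D l ω = D l ω' := hD l hl fun a ha =>
        hω a (hist_mono hl.le ha)
      simp only [walk_zero]
      refine Finset.sum_congr rfl fun l hl => Finset.sum_congr rfl fun s hs => ?_
      rw [Finset.mem_range] at hl hs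
      rw [h1 l hl, hω (l + 1, s) (Finset.mem_coe.2 (mem_hist.2 ⟨Nat.succ_le_of_lt hl, hs⟩))]
    have hmeas : Measurable fun w =>
        ENNReal.ofReal (Real.exp (Φ (walk r D N 0 fun i => X i w))) :=
      measurable_comp_of_dependsOn hX (J := hist r N)
        (V := fun ω => ENNReal.ofReal (Real.exp (Φ (walk r D N 0 ω))))
        fun ω ω' hω => by simp only [hdep hω]
    have hM := (mul_meas_ge_le_lintegral (μ := Pr) hmeas (ENNReal.ofReal (Real.exp t))).trans h
    have hset : {w | ENNReal.ofReal (Real.exp t) ≤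
        ENNReal.ofReal (Real.exp (Φ (walk r D N 0 fun i => X i w)))} =
          {w | t ≤ Φ (walk r D N 0 fun i => X i w)} := by
      ext w
      simp only [Set.mem_ofPred_eq]
      rw [ENNReal.ofReal_le_ofReal_iff (Real.exp_pos _).le, Real.exp_le_exp]
    rw [hset] at hM
    have h2 := ENNReal.toReal_mono ENNReal.ofReal_ne_top hM
    rw [ENNReal.toReal_mul, ENNReal.toReal_ofReal (Real.exp_pos _).le,
      ENNReal.toReal_ofReal (Real.exp_pos _).le] at h2
    rw [Real.exp_sub, le_div_iff₀ (Real.exp_pos _), mul_comm]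
    exact h2
  · intro l hl s ω v
    have h1 (x : S) : Pr (X (l + 1, s) ⁻¹' {x}) = ENNReal.ofReal (Pr.real (X (l + 1, s) ⁻¹' {x})) :=
      (ofReal_measureReal).symm
    simp only [h1, ← ENNReal.ofReal_mul measureReal_nonneg]
    rw [← ENNReal.ofReal_sum_of_nonneg fun x _ => mul_nonneg measureReal_nonneg (Real.exp_pos _).le]
    exact ENNReal.ofReal_le_ofReal (hΦ l hl s ω v)

/-! ### Tail bounds -/

lemma sum_measureReal_preimage {Y : Ω → S} (hY : Measurable Y) :
    ∑ x, Pr.real (Y ⁻¹' {x}) = 1 := by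
  rw [sum_measureReal_preimage_singleton _ fun x _ => hY (measurableSet_singleton x)]
  simp

/-- Self-normalized tail bound for a scalar walk. -/
lemma measure_scalar_walk_ge_le (hX : ∀ i, Measurable (X i)) (hind : iIndepFun X Pr) {r : ℕ → ℕ}
    {N : ℕ} {φ : ℕ → (ℕ × ℕ → S) → S → ℝ} {c : ℕ → (ℕ × ℕ → S) → ℝ}
    (hφ : ∀ l < N, DependsOn (φ l) (hist r l : Set (ℕ × ℕ)))
    (hc : ∀ l < N, DependsOn (c l) (hist r l : Set (ℕ × ℕ)))
    (hmean : ∀ l < N, ∀ s ω, ∑ x, Pr.real (X (l + 1, s) ⁻¹' {x}) * φ l ω x = 0)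
    (hbd : ∀ l < N, ∀ ω x, |φ l ω x| ≤ c l ω) (τ t : ℝ) :
    Pr.real {w | t ≤ τ * ∑ l ∈ Finset.range N, ∑ s ∈ Finset.range (r (l + 1)),
        φ l (fun i => X i w) (X (l + 1, s) w) -
      τ ^ 2 / 2 * ∑ l ∈ Finset.range N, r (l + 1) * c l (fun i => X i w) ^ 2} ≤ Real.exp (-t) := by
  have h := measure_walk_ge_le hX hind (N := N) (r := r)
    -- The compensator is subtracted from each increment, and `c l` is fixed by earlier batches;
    -- this keeps the bound valid for a random quadratic variation.
    (D := fun l ω x => τ * φ l ω x - τ ^ 2 / 2 * c l ω ^ 2) (Φ := id)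
    (fun l hl ω ω' hω => by simp only [hφ l hl hω, hc l hl hω]) ?_ t
  · rw [id, zero_sub] at h
    refine le_trans (le_of_eq ?_) h
    congr 1
    ext w
    simp only [Set.mem_ofPred_eq, walk_zero, id,
      Finset.sum_sub_distrib, Finset.sum_const, Finset.card_range, nsmul_eq_mul, Finset.mul_sum]
    refine iff_of_eq (congrArg (t ≤ ·) (congrArg₂ (· - ·) rfl ?_))
    exact Finset.sum_congr rfl fun l _ => by ring
  · intro l hl s ω v
    have h1 := sum_mul_exp_le_of_abs_le (p := fun x => Pr.real (X (l + 1, s) ⁻¹' {x}))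
      (φ := fun x => τ * φ l ω x) (c := |τ| * c l ω) (fun x => measureReal_nonneg)
      (sum_measureReal_preimage (hX _))
      (by simp only [mul_left_comm _ τ, ← Finset.mul_sum, hmean l hl, mul_zero])
      (fun x => by rw [abs_mul]; exact mul_le_mul_of_nonneg_left (hbd l hl ω x) (abs_nonneg _))
    rw [mul_pow, sq_abs] at h1
    calc ∑ x, Pr.real (X (l + 1, s) ⁻¹' {x}) *
          Real.exp (id (v + (τ * φ l ω x - τ ^ 2 / 2 * c l ω ^ 2)))
        = Real.exp (v - τ ^ 2 / 2 * c l ω ^ 2) *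
          ∑ x, Pr.real (X (l + 1, s) ⁻¹' {x}) * Real.exp (τ * φ l ω x) := by
          rw [Finset.mul_sum]
          refine Finset.sum_congr rfl fun x _ => ?_
          rw [mul_left_comm, ← Real.exp_add, id]
          ring_nf
      _ ≤ Real.exp (v - τ ^ 2 / 2 * c l ω ^ 2) * Real.exp (τ ^ 2 * c l ω ^ 2 / 2) :=
          mul_le_mul_of_nonneg_left h1 (Real.exp_pos _).le
      _ = Real.exp (id v) := by rw [← Real.exp_add, id]; ring_nf

/-- Concavity of the square root at `b² + ‖x‖²`. The smoothed norm has curvature at most `1/b`, so a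
Hilbert-space walk can be treated through a scalar potential. -/
lemma sqrt_norm_add_sq_le {E : Type*} [NormedAddCommGroup E] [InnerProductSpace ℝ E] {b : ℝ}
    (hb : 0 < b) (x y : E) : Real.sqrt (b ^ 2 + ‖x + y‖ ^ 2) ≤ Real.sqrt (b ^ 2 + ‖x‖ ^ 2) +
      inner ℝ x y / Real.sqrt (b ^ 2 + ‖x‖ ^ 2) + ‖y‖ ^ 2 / (2 * b) := by
  set a := Real.sqrt (b ^ 2 + ‖x‖ ^ 2) with ha
  have hpos : 0 < b ^ 2 + ‖x‖ ^ 2 := by positivity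
  have ha2 : a ^ 2 = b ^ 2 + ‖x‖ ^ 2 := Real.sq_sqrt hpos.le
  have hab : b ≤ a := Real.le_sqrt_of_sq_le (by linarith [sq_nonneg ‖x‖])
  have hapos : 0 < a := hb.trans_le hab
  have h1 : ‖y‖ ^ 2 / (2 * a) ≤ ‖y‖ ^ 2 / (2 * b) :=
    div_le_div_of_nonneg_left (sq_nonneg _) (by positivity) (by linarith)
  refine le_trans (b := a + inner ℝ x y / a + ‖y‖ ^ 2 / (2 * a)) ?_ (by linarith)
  have h2 : a + inner ℝ x y / a + ‖y‖ ^ 2 / (2 * a) =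
      (a ^ 2 + (b ^ 2 + ‖x + y‖ ^ 2)) / (2 * a) := by
    rw [norm_add_sq_real]
    field_simp
    rw [ha2]
    ring
  rw [h2, le_div_iff₀ (by positivity)]
  have h3 : 0 ≤ b ^ 2 + ‖x + y‖ ^ 2 := by positivity
  nlinarith [Real.sq_sqrt h3, sq_nonneg (Real.sqrt (b ^ 2 + ‖x + y‖ ^ 2) - a)]

/-- Tail bound for the norm of a walk in an inner product space. -/
lemma measure_norm_walk_ge_le {E : Type*} [NormedAddCommGroup E] [InnerProductSpace ℝ E]
    (hX : ∀ i, Measurable (X i)) (hind : iIndepFun X Pr) {r : ℕ → ℕ}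
    {N : ℕ} {Y : ℕ → (ℕ × ℕ → S) → S → E} {c : ℕ → ℝ}
    (hY : ∀ l < N, DependsOn (Y l) (hist r l : Set (ℕ × ℕ)))
    (hmean : ∀ l < N, ∀ s ω, ∑ x, Pr.real (X (l + 1, s) ⁻¹' {x}) • Y l ω x = 0)
    (hbd : ∀ l < N, ∀ ω x, ‖Y l ω x‖ ^ 2 ≤ c l) {V t : ℝ} (hV : 0 < V)
    (hcV : ∑ l ∈ Finset.range N, r (l + 1) * c l ≤ V) (ht : 1 ≤ t) :
    Pr.real {w | 3 * Real.sqrt (V * t) ≤ ‖∑ l ∈ Finset.range N, ∑ s ∈ Finset.range (r (l + 1)),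
        Y l (fun i => X i w) (X (l + 1, s) w)‖} ≤ Real.exp (-t) := by
  -- With this scale and `lam = t/b` the potential starts at `lam * b = t` and exceeds `3t - κV ≥
  -- 2t` on the bad event, so Markov yields `exp(-t)`.
  set b := Real.sqrt (V * t) with hb
  have hbpos : 0 < b := Real.sqrt_pos.2 (by positivity)
  have hb2 : b ^ 2 = V * t := Real.sq_sqrt (by positivity)
  set lam := t / b with hlam
  have hlampos : 0 < lam := by positivity
  -- The first summand pays for the curvature of the smoothed norm, the second for Hoeffding's
  -- lemma. Then `κV = 1/2 + t/2`, which is where `1 ≤ t` is needed.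
  set κ := lam / (2 * b) + lam ^ 2 / 2 with hκ
  have hκ0 : 0 ≤ κ := by positivity
  have hκV : κ * V ≤ t := by
    have h1 : lam / (2 * b) * V = 1 / 2 := by
      rw [hlam, div_div, mul_left_comm, ← sq, hb2]; field_simp
    have h2 : lam ^ 2 / 2 * V = t / 2 := by
      rw [hlam, div_pow, hb2]; field_simp
    rw [hκ, add_mul, h1, h2]
    linarith
  have h := measure_walk_ge_le hX hind (N := N) (r := r)
    -- The second coordinate accumulates the variance bounds, so that the compensator becomes part
    -- of the state.
    (D := fun l ω x => ((Y l ω x, c l) : E × ℝ))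
    (Φ := fun v => lam * Real.sqrt (b ^ 2 + ‖v.1‖ ^ 2) - κ * v.2)
    (fun l hl ω ω' hω => by simp only [hY l hl hω]) ?_ (2 * t)
  · have h0 : lam * Real.sqrt (b ^ 2 + ‖(0 : E × ℝ).1‖ ^ 2) - κ * (0 : E × ℝ).2 = t := by
      simp only [Prod.fst_zero, Prod.snd_zero, norm_zero, mul_zero, sub_zero]
      rw [zero_pow two_ne_zero, add_zero, Real.sqrt_sq hbpos.le, hlam, div_mul_cancel₀ _ hbpos.ne']
    rw [h0] at h
    refine le_trans (measureReal_mono ?_) (h.trans (le_of_eq (by ring_nf)))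
    intro w hw
    simp only [Set.mem_ofPred_eq] at hw ⊢
    have h1 : (walk r (fun l ω x => ((Y l ω x, c l) : E × ℝ)) N 0 fun i => X i w) =
        (∑ l ∈ Finset.range N, ∑ s ∈ Finset.range (r (l + 1)),
          Y l (fun i => X i w) (X (l + 1, s) w),
          ∑ l ∈ Finset.range N, r (l + 1) * c l) := by
      simp only [walk_zero]
      ext
      · simp only [Prod.fst_sum]
      · simp only [Prod.snd_sum, Finset.sum_const, Finset.card_range, nsmul_eq_mul]
    rw [h1]
    have h2 : 3 * b ≤ Real.sqrt (b ^ 2 + ‖∑ l ∈ Finset.range N, ∑ s ∈ Finset.range (r (l + 1)),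
          Y l (fun i => X i w) (X (l + 1, s) w)‖ ^ 2) := by
      refine hw.trans (Real.le_sqrt_of_sq_le ?_)
      linarith [sq_nonneg b]
    have h3 : lam * (3 * b) = 3 * t := by rw [hlam]; field_simp
    have h4 := mul_le_mul_of_nonneg_left h2 hlampos.le
    have h5 := mul_le_mul_of_nonneg_left hcV hκ0
    simp only
    linarith
  · rintro l hl s ω ⟨v, q⟩
    simp only [Prod.mk_add_mk]
    set a := Real.sqrt (b ^ 2 + ‖v‖ ^ 2) with ha
    have hapos : 0 < a := Real.sqrt_pos.2 (by positivity)
    have hva : ‖v‖ ≤ a := Real.le_sqrt_of_sq_le (by linarith [sq_nonneg b])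
    have hcl (x : S) : 0 ≤ c l := (sq_nonneg _).trans (hbd l hl ω x)
    have hle (x : S) : lam * Real.sqrt (b ^ 2 + ‖v + Y l ω x‖ ^ 2) - κ * (q + c l) ≤
        (lam * a - κ * q - lam ^ 2 / 2 * c l) + lam * (inner ℝ v (Y l ω x) / a) := by
      have h1 := mul_le_mul_of_nonneg_left (sqrt_norm_add_sq_le hbpos v (Y l ω x)) hlampos.le
      have h2 : lam * (‖Y l ω x‖ ^ 2 / (2 * b)) ≤ lam / (2 * b) * c l := by
        have h3 : lam * (‖Y l ω x‖ ^ 2 / (2 * b)) = lam / (2 * b) * ‖Y l ω x‖ ^ 2 := by ring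
        rw [h3]
        exact mul_le_mul_of_nonneg_left (hbd l hl ω x) (by positivity)
      rw [hκ]
      linarith
    have hmean' : ∑ x, Pr.real (X (l + 1, s) ⁻¹' {x}) *
        (lam * (inner ℝ v (Y l ω x) / a)) = 0 := by
      have h1 : ∑ x, Pr.real (X (l + 1, s) ⁻¹' {x}) * (lam * (inner ℝ v (Y l ω x) / a)) =
          lam / a * inner ℝ v (∑ x, Pr.real (X (l + 1, s) ⁻¹' {x}) • Y l ω x) := by
        rw [inner_sum, Finset.mul_sum]
        refine Finset.sum_congr rfl fun x _ => ?_
        rw [real_inner_smul_right]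
        ring
      rw [h1, hmean l hl, inner_zero_right, mul_zero]
    have hab (x : S) : |lam * (inner ℝ v (Y l ω x) / a)| ≤ lam * Real.sqrt (c l) := by
      rw [abs_mul, abs_of_pos hlampos, abs_div, abs_of_pos hapos]
      refine mul_le_mul_of_nonneg_left ?_ hlampos.le
      rw [div_le_iff₀ hapos, mul_comm]
      exact (abs_real_inner_le_norm _ _).trans (mul_le_mul hva (Real.le_sqrt_of_sq_le (hbd l hl ω x))
        (norm_nonneg _) hapos.le)
    have h1 := sum_mul_exp_le_of_abs_le (p := fun x => Pr.real (X (l + 1, s) ⁻¹' {x}))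
      (fun x => measureReal_nonneg) (sum_measureReal_preimage (hX _)) hmean' hab
    have hS : Nonempty S := by
      by_contra hne
      rw [not_nonempty_iff] at hne
      simpa using sum_measureReal_preimage (Pr := Pr) (hX (l + 1, s))
    rw [mul_pow, Real.sq_sqrt (hcl hS.some)] at h1
    calc ∑ x, Pr.real (X (l + 1, s) ⁻¹' {x}) *
          Real.exp (lam * Real.sqrt (b ^ 2 + ‖v + Y l ω x‖ ^ 2) - κ * (q + c l))
        ≤ ∑ x, Pr.real (X (l + 1, s) ⁻¹' {x}) *
          Real.exp ((lam * a - κ * q - lam ^ 2 / 2 * c l) + lam * (inner ℝ v (Y l ω x) / a)) :=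
          Finset.sum_le_sum fun x _ => mul_le_mul_of_nonneg_left (Real.exp_le_exp.2 (hle x))
            measureReal_nonneg
      _ = Real.exp (lam * a - κ * q - lam ^ 2 / 2 * c l) *
          ∑ x, Pr.real (X (l + 1, s) ⁻¹' {x}) * Real.exp (lam * (inner ℝ v (Y l ω x) / a)) := by
          rw [Finset.mul_sum]
          refine Finset.sum_congr rfl fun x _ => ?_
          rw [Real.exp_add]
          ring
      _ ≤ Real.exp (lam * a - κ * q - lam ^ 2 / 2 * c l) * Real.exp (lam ^ 2 * c l / 2) :=
          mul_le_mul_of_nonneg_left h1 (Real.exp_pos _).le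
      _ = Real.exp (lam * a - κ * q) := by rw [← Real.exp_add]; ring_nf

end Batches

namespace BaryProblem

/-! ## Accuracy on the event of small sampling errors -/

section Accuracy

variable {m n : ℕ}

/-- The empirical distributions of the sampled indices. -/
noncomputable def freqX (r : ℕ) (ξ : ℕ → Fin m → Fin n) : Stacked m n :=
  WithLp.toLp 2 fun ij => (∑ s ∈ Finset.range r, if ξ s ij.1 = ij.2 then 1 else 0) / r

/-- The stacked vector of the measures `q_i`. -/
noncomputable def qX (P : BaryProblem m n) : Stacked m n := WithLp.toLp 2 fun ij => P.q ij.1 ij.2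

variable {P : BaryProblem m n} {r : ℕ → ℕ} {ξ : ℕ → ℕ → Fin m → Fin n} {N : ℕ}

lemma output_eq (r : ℕ → ℕ) (ξ : ℕ → ℕ → Fin m → Fin n) (N : ℕ) : P.output r ξ N =
    (bigA P.Lpsi N)⁻¹ • ∑ k ∈ Finset.range N, alpha P.Lpsi (k + 1) •
      P.batchX (r (k + 1)) (ξ (k + 1)) (P.dualPoint r ξ (k + 1)) := by
  rw [output, Finset.sum_range_succ']
  simp only [alpha, zero_smul, add_zero]
  rfl

/-- Flattens iterations and batches into one index set, so that the output is a single mixture of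
atoms. -/
lemma sum_sigma_weights (f : ℕ → ℕ → ℝ) :
    ∑ t : (Σ k : Fin N, Fin (r (k + 1))),
      (bigA P.Lpsi N)⁻¹ * (alpha P.Lpsi (t.1 + 1) / r (t.1 + 1)) * f t.1 t.2 =
    (bigA P.Lpsi N)⁻¹ * ∑ k ∈ Finset.range N, alpha P.Lpsi (k + 1) *
      ((∑ s ∈ Finset.range (r (k + 1)), f k s) / r (k + 1)) := by
  rw [Fintype.sum_sigma, Finset.mul_sum]
  rw [← Fin.sum_univ_eq_sum_range (fun k => (bigA P.Lpsi N)⁻¹ * (alpha P.Lpsi (k + 1) *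
      ((∑ s ∈ Finset.range (r (k + 1)), f k s) / r (k + 1))))]
  refine Finset.sum_congr rfl fun k _ => ?_
  rw [← Fin.sum_univ_eq_sum_range (fun s => f k s)]
  dsimp only
  rw [← Finset.mul_sum]
  ring

lemma sum_weights_eq_one (hμ : 0 < P.mu) (hlam : 0 < P.lamMax) (hN : 1 ≤ N)
    (hr : ∀ k < N, 0 < r (k + 1)) :
    ∑ t : (Σ k : Fin N, Fin (r (k + 1))),
      (bigA P.Lpsi N)⁻¹ * (alpha P.Lpsi (t.1 + 1) / r (t.1 + 1)) = 1 := by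
  have h := sum_sigma_weights (P := P) (r := r) (N := N) fun _ _ => 1
  simp only [mul_one] at h
  rw [h]
  have h1 : ∑ k ∈ Finset.range N, alpha P.Lpsi (k + 1) *
      ((∑ _s ∈ Finset.range (r (k + 1)), (1 : ℝ)) / r (k + 1)) = bigA P.Lpsi N := by
    rw [bigA_eq_sum]
    refine Finset.sum_congr rfl fun k hk => ?_
    have := hr k (Finset.mem_range.1 hk)
    rw [Finset.sum_const, Finset.card_range, nsmul_eq_mul, mul_one, div_self (by positivity),
      mul_one]
  rw [h1, inv_mul_cancel₀ (bigA_pos (Lpsi_pos hμ hlam) hN).ne']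

lemma block_output_eq (i : Fin m) : block (P.output r ξ N) i = fun l =>
    ∑ t : (Σ k : Fin N, Fin (r (k + 1))),
      (bigA P.Lpsi N)⁻¹ * (alpha P.Lpsi (t.1 + 1) / r (t.1 + 1)) *
        compGrad P.mu P.C (block (P.dualPoint r ξ (t.1 + 1)) i) (ξ (t.1 + 1) t.2 i) l := by
  funext l
  rw [sum_sigma_weights fun k s =>
    compGrad P.mu P.C (block (P.dualPoint r ξ (k + 1)) i) (ξ (k + 1) s i) l, output_eq]
  simp [block, batchX]

lemma weight_nonneg (hμ : 0 < P.mu) (hlam : 0 < P.lamMax) (k : ℕ) :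
    0 ≤ (bigA P.Lpsi N)⁻¹ * (alpha P.Lpsi (k + 1) / r (k + 1)) :=
  mul_nonneg (inv_nonneg.2 (bigA_nonneg (Lpsi_pos hμ hlam) N))
    (div_nonneg (alpha_pos (Lpsi_pos hμ hlam) k).le (Nat.cast_nonneg _))

lemma block_output_mem_stdSimplex (hμ : 0 < P.mu) (hlam : 0 < P.lamMax) (hN : 1 ≤ N)
    (hr : ∀ k < N, 0 < r (k + 1)) (i : Fin m) :
    block (P.output r ξ N) i ∈ stdSimplex ℝ (Fin n) := by
  rw [block_output_eq]
  refine ⟨fun l => Finset.sum_nonneg fun t _ => mul_nonneg (weight_nonneg hμ hlam _)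
    (compGrad_pos _ _ _).le, ?_⟩
  rw [Finset.sum_comm]
  simp only [← Finset.mul_sum, compGrad_sum, mul_one]
  simpa only [← Finset.mul_sum] using sum_weights_eq_one (P := P) hμ hlam hN hr

/-- The objective at the output is bounded by the costs of the sampled atoms. -/
lemma sum_regW_output_le (hμ : 0 < P.mu) (hlam : 0 < P.lamMax) (hN : 1 ≤ N)
    (hq : ∀ i, P.q i ∈ stdSimplex ℝ (Fin n)) (hr : ∀ k < N, 0 < r (k + 1)) :
    bigA P.Lpsi N * ∑ i, regW P.mu P.C (P.q i) (block (P.output r ξ N) i) ≤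
      ∑ k ∈ Finset.range N, alpha P.Lpsi (k + 1) *
        (P.sampleCost (r (k + 1)) (ξ (k + 1)) (P.dualPoint r ξ (k + 1)) + P.entropyQ) +
      P.normC * (Real.sqrt (n * m) * ‖∑ k ∈ Finset.range N, alpha P.Lpsi (k + 1) •
        (freqX (r (k + 1)) (ξ (k + 1)) - P.qX)‖) := by
  have hA := bigA_pos (Lpsi_pos hμ hlam) hN
  set D := ∑ k ∈ Finset.range N, alpha P.Lpsi (k + 1) •
        (freqX (r (k + 1)) (ξ (k + 1)) - P.qX) with hD
  have h1 (i : Fin m) : bigA P.Lpsi N * regW P.mu P.C (P.q i) (block (P.output r ξ N) i) ≤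
      ∑ k ∈ Finset.range N, alpha P.Lpsi (k + 1) * ((∑ s ∈ Finset.range (r (k + 1)),
        atomCost P.mu P.C (ξ (k + 1) s i) (compGrad P.mu P.C
          (block (P.dualPoint r ξ (k + 1)) i) (ξ (k + 1) s i))) / r (k + 1)) +
      P.normC * ∑ j, |block D i j| +
      bigA P.Lpsi N * (P.mu * ∑ j, P.q i j * Real.log (P.q i j)) := by
    have h2 := regW_le_sum_atomCost_add hμ P.abs_C_le (hq i)
      (fun t : (Σ k : Fin N, Fin (r (k + 1))) =>
        (bigA P.Lpsi N)⁻¹ * (alpha P.Lpsi (t.1 + 1) / r (t.1 + 1)))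
      (fun t => ξ (t.1 + 1) t.2 i)
      (fun t => compGrad P.mu P.C (block (P.dualPoint r ξ (t.1 + 1)) i) (ξ (t.1 + 1) t.2 i))
      (fun t => weight_nonneg hμ hlam _) (sum_weights_eq_one hμ hlam hN hr)
      (fun t => compGrad_mem_stdSimplex _ _)
    rw [← block_output_eq, sum_sigma_weights fun k s => atomCost P.mu P.C (ξ (k + 1) s i)
      (compGrad P.mu P.C (block (P.dualPoint r ξ (k + 1)) i) (ξ (k + 1) s i))] at h2
    have h3 (j : Fin n) : ∑ t : (Σ k : Fin N, Fin (r (k + 1))),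
        (bigA P.Lpsi N)⁻¹ * (alpha P.Lpsi (t.1 + 1) / r (t.1 + 1)) *
          (if ξ (t.1 + 1) t.2 i = j then 1 else 0) - P.q i j =
        (bigA P.Lpsi N)⁻¹ * block D i j := by
      rw [sum_sigma_weights fun k s => if ξ (k + 1) s i = j then 1 else 0]
      have h4 : block D i j = ∑ k ∈ Finset.range N, alpha P.Lpsi (k + 1) *
          ((∑ s ∈ Finset.range (r (k + 1)), if ξ (k + 1) s i = j then 1 else 0) / r (k + 1)) -
          bigA P.Lpsi N * P.q i j := by
        rw [bigA_eq_sum, Finset.sum_mul, ← Finset.sum_sub_distrib]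
        simp [block, hD, freqX, qX, mul_sub]
      rw [h4, mul_sub, inv_mul_cancel_left₀ hA.ne']
    simp only [h3, abs_mul, abs_inv, abs_of_pos hA, ← Finset.mul_sum] at h2
    have h5 := mul_le_mul_of_nonneg_left h2 hA.le
    rw [mul_add, mul_add, mul_inv_cancel_left₀ hA.ne', mul_left_comm _ P.normC,
      mul_inv_cancel_left₀ hA.ne'] at h5
    exact h5
  -- Cauchy–Schwarz over all `nm` coordinates passes from ℓ¹ to the Euclidean norm.
  have h2 : ∑ i, ∑ j, |block D i j| ≤ Real.sqrt (n * m) * ‖D‖ := by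
    rw [← Real.sqrt_sq (norm_nonneg D), ← Real.sqrt_mul (by positivity)]
    refine Real.le_sqrt_of_sq_le ?_
    have h3 := sq_sum_le_card_mul_sum_sq (s := (Finset.univ : Finset (Fin m × Fin n)))
      (f := fun ij => |block D ij.1 ij.2|)
    simp only [sq_abs, Fintype.sum_prod_type, Finset.card_univ, Fintype.card_prod,
      Fintype.card_fin, Nat.cast_mul] at h3
    rw [norm_sq_stacked, mul_comm (n : ℝ)]
    exact h3
  have h3 := Finset.sum_le_sum fun i (_ : i ∈ Finset.univ) => h1 i
  rw [← Finset.mul_sum, Finset.sum_add_distrib, Finset.sum_add_distrib, ← Finset.mul_sum,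
    ← Finset.mul_sum, Finset.sum_comm] at h3
  simp only [← Finset.mul_sum] at h3
  simp only [mul_add, Finset.sum_add_distrib, ← Finset.sum_mul, ← bigA_eq_sum]
  have h4 := mul_le_mul_of_nonneg_left h2 P.normC_nonneg
  simp only [sampleCost, entropyQ, ← Finset.mul_sum] at h3 ⊢
  linarith

end Accuracy

/-! ### The error budget and the control of the iterates -/

section GoodEvent

variable {m n : ℕ} {P : BaryProblem m n} {r : ℕ → ℕ} {ξ : ℕ → ℕ → Fin m → Fin n} {N : ℕ}
  {ε L : ℝ} {ystar : Stacked m n}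

lemma norm_smul_add_sq_le {E : Type*} [NormedAddCommGroup E] [InnerProductSpace ℝ E] {a A B : ℝ}
    (ha : 0 ≤ a) (hA : 0 ≤ A) (haA : 0 < A + a) {x y z : E} (hx : ‖x - z‖ ^ 2 ≤ B)
    (hy : ‖y - z‖ ^ 2 ≤ B) : ‖(A + a)⁻¹ • (a • x + A • y) - z‖ ^ 2 ≤ B := by
  have h1 : (A + a)⁻¹ • (a • x + A • y) - z = (A + a)⁻¹ • (a • (x - z) + A • (y - z)) := by
    have h2 : (A + a)⁻¹ • ((A + a) • z) = z := by
      rw [smul_smul, inv_mul_cancel₀ haA.ne', one_smul]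
    conv_lhs => rw [← h2, ← smul_sub]
    congr 1
    rw [add_smul, smul_sub, smul_sub]
    abel
  have hx' := Real.le_sqrt_of_sq_le hx
  have hy' := Real.le_sqrt_of_sq_le hy
  have hB : 0 ≤ B := (sq_nonneg _).trans hx
  have h3 : ‖(A + a)⁻¹ • (a • (x - z) + A • (y - z))‖ ≤ Real.sqrt B := by
    rw [norm_smul, norm_inv, Real.norm_eq_abs, abs_of_pos haA, inv_mul_le_iff₀ haA]
    refine (norm_add_le _ _).trans ?_
    rw [norm_smul, norm_smul, Real.norm_eq_abs, Real.norm_eq_abs, abs_of_nonneg ha,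
      abs_of_nonneg hA]
    nlinarith
  rw [h1]
  calc _ ≤ Real.sqrt B ^ 2 := by gcongr
    _ = B := Real.sq_sqrt hB

/-- The purpose of the batch-size condition: a term quadratic in `α` becomes linear in `α ε`, and
the latter sums to the budget `A_N ε`. -/
lemma alpha_sq_div_le (hμ : 0 < P.mu) (hlam : 0 < P.lamMax) {k : ℕ} (hr0 : 0 < r (k + 1))
    (hr : 3600 * (m * P.lamMax * L * alpha P.Lpsi (k + 1)) ≤ ε * r (k + 1)) :
    alpha P.Lpsi (k + 1) ^ 2 / r (k + 1) * (3600 * (m * P.lamMax * L)) ≤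
      alpha P.Lpsi (k + 1) * ε := by
  have ha := alpha_pos (Lpsi_pos hμ hlam) k
  have hr0' : (0 : ℝ) < r (k + 1) := by exact_mod_cast hr0
  rw [div_mul_eq_mul_div, div_le_iff₀ hr0']
  have := mul_le_mul_of_nonneg_left hr ha.le
  linarith

/-- The hypotheses on the batch sizes and on the number of iterations. -/
structure Regime (P : BaryProblem m n) (r : ℕ → ℕ) (N : ℕ) (ε L : ℝ) : Prop where
  mu_pos : 0 < P.mu
  m_pos : 0 < m
  n_pos : 0 < n
  lamMinPos_pos : 0 < P.lamMinPos
  lamMinPos_le : P.lamMinPos ≤ P.lamMax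
  q_mem : ∀ i, P.q i ∈ stdSimplex ℝ (Fin n)
  eps_pos : 0 < ε
  one_le_L : 1 ≤ L
  one_le_N : 1 ≤ N
  radius_le : P.MF ^ 2 / P.lamMinPos ≤ bigA P.Lpsi N * ε / 8
  batch_pos : ∀ k < N, 0 < r (k + 1)
  batch_ge : ∀ k < N, 3600 * (m * P.lamMax * L * alpha P.Lpsi (k + 1)) ≤ ε * r (k + 1)

namespace Regime

variable (H : Regime P r N ε L)
include H

lemma lamMax_pos : 0 < P.lamMax := H.lamMinPos_pos.trans_le H.lamMinPos_le

lemma Lpsi_pos : 0 < P.Lpsi := BaryProblem.Lpsi_pos H.mu_pos H.lamMax_pos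

lemma budget_pos : 0 < bigA P.Lpsi N * ε := mul_pos (bigA_pos H.Lpsi_pos H.one_le_N) H.eps_pos

lemma L_pos : 0 < L := one_pos.trans_le H.one_le_L

lemma sum_alpha_mul_le {f : ℕ → ℝ} {B : ℝ} {K : ℕ} (hK : K ≤ N) (hB : 0 ≤ B)
    (hf : ∀ k < K, f k ≤ B) :
    ∑ k ∈ Finset.range K, alpha P.Lpsi (k + 1) * ε * f k ≤ bigA P.Lpsi N * ε * B := by
  rw [bigA_eq_sum, Finset.sum_mul, Finset.sum_mul]
  have hnn (k : ℕ) : 0 ≤ alpha P.Lpsi (k + 1) * ε :=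
    mul_nonneg (alpha_pos H.Lpsi_pos k).le H.eps_pos.le
  calc ∑ k ∈ Finset.range K, alpha P.Lpsi (k + 1) * ε * f k
      ≤ ∑ k ∈ Finset.range K, alpha P.Lpsi (k + 1) * ε * B :=
        Finset.sum_le_sum fun k hk => mul_le_mul_of_nonneg_left (hf k (Finset.mem_range.1 hk)) (hnn k)
    _ ≤ _ := Finset.sum_le_sum_of_subset_of_nonneg (Finset.range_mono hK)
        fun k _ _ => mul_nonneg (hnn k) hB

lemma sum_alpha_sq_div_mul_le {f : ℕ → ℝ} {B : ℝ} {K : ℕ} (hK : K ≤ N) (hB : 0 ≤ B)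
    (hf0 : ∀ k, 0 ≤ f k) (hf : ∀ k < K, f k ≤ B) :
    (∑ k ∈ Finset.range K, alpha P.Lpsi (k + 1) ^ 2 / r (k + 1) * f k) *
      (3600 * (m * P.lamMax * L)) ≤ bigA P.Lpsi N * ε * B := by
  refine le_trans ?_ (H.sum_alpha_mul_le hK hB hf)
  rw [Finset.sum_mul]
  refine Finset.sum_le_sum fun k hk => ?_
  have hkN := (Finset.mem_range.1 hk).trans_le hK
  rw [mul_right_comm]
  exact mul_le_mul_of_nonneg_right (alpha_sq_div_le H.mu_pos H.lamMax_pos (H.batch_pos k hkN)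
    (H.batch_ge k hkN)) (hf0 k)

/-- The batch averages deviate little: total contribution of the squared errors. -/
lemma sum_norm_noise_sq_le {K : ℕ} (hK : K ≤ N)
    (ha : ∀ k < N, ‖P.noiseX r ξ (k + 1)‖ ^ 2 ≤ 18 * m * L / r (k + 1)) :
    ∑ k ∈ Finset.range K, alpha P.Lpsi (k + 1) ^ 2 * ‖P.sqrtW (P.noiseX r ξ (k + 1))‖ ^ 2 ≤
      bigA P.Lpsi N * ε / 200 := by
  have h1 : ∑ k ∈ Finset.range K,
      alpha P.Lpsi (k + 1) ^ 2 * ‖P.sqrtW (P.noiseX r ξ (k + 1))‖ ^ 2 ≤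
      ∑ k ∈ Finset.range K, alpha P.Lpsi (k + 1) * ε * (1 / 200) := by
    refine Finset.sum_le_sum fun k hk => ?_
    have hkN := (Finset.mem_range.1 hk).trans_le hK
    have h2 := (P.norm_sqrtW_sq_le (P.noiseX r ξ (k + 1))).trans
      (mul_le_mul_of_nonneg_left (ha k hkN) H.lamMax_pos.le)
    have h3 := alpha_sq_div_le H.mu_pos H.lamMax_pos (H.batch_pos k hkN) (H.batch_ge k hkN)
    have h4 := mul_le_mul_of_nonneg_left h2 (sq_nonneg (alpha P.Lpsi (k + 1)))
    refine h4.trans ?_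
    have h5 : alpha P.Lpsi (k + 1) ^ 2 * (P.lamMax * (18 * m * L / r (k + 1))) =
        alpha P.Lpsi (k + 1) ^ 2 / r (k + 1) * (3600 * (m * P.lamMax * L)) * (1 / 200) := by ring
    rw [h5]
    linarith
  refine h1.trans ((H.sum_alpha_mul_le hK (by norm_num) fun _ _ => le_rfl).trans (le_of_eq ?_))
  ring

lemma norm_zeta_sub_sq_le (hy : P.IsDualSolution ystar)
    (hyn : ‖ystar‖ ^ 2 ≤ bigA P.Lpsi N * ε / 8)
    (ha : ∀ k < N, ‖P.noiseX r ξ (k + 1)‖ ^ 2 ≤ 18 * m * L / r (k + 1))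
    (hb : ∀ K ≤ N, ∑ k ∈ Finset.range K, alpha P.Lpsi (k + 1) *
      inner ℝ (P.sqrtW (P.noiseX r ξ (k + 1))) (ystar - (P.iterate r ξ k).zeta) ≤
      bigA P.Lpsi N * ε + L / (2 * (bigA P.Lpsi N * ε)) * ∑ k ∈ Finset.range K,
        alpha P.Lpsi (k + 1) ^ 2 / r (k + 1) *
          (2 * m * P.lamMax * ‖(P.iterate r ξ k).zeta - ystar‖ ^ 2)) :
    ∀ K ≤ N, ‖(P.iterate r ξ K).zeta - ystar‖ ^ 2 ≤ 3 * (bigA P.Lpsi N * ε) := by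
  -- The bound on `ζ^K` involves only `ζ^k` with `k < K`, through the quadratic variation; strong
  -- induction closes this loop.
  set E := bigA P.Lpsi N * ε with hE
  have hEpos : 0 < E := H.budget_pos
  intro K
  induction K using Nat.strong_induction_on with
  | _ K ih =>
    intro hK
    have h1 := BaryProblem.norm_zeta_sub_sq_le (r := r) (ξ := ξ) H.mu_pos H.lamMax_pos H.q_mem hy K
    have h2 := hb K hK
    have h3 := H.sum_norm_noise_sq_le hK ha
    have hml : 0 < m * P.lamMax := mul_pos (Nat.cast_pos.2 H.m_pos) H.lamMax_pos
    have h4 := H.sum_alpha_sq_div_mul_le hK (B := 2 * m * P.lamMax * (3 * E))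
      (f := fun k => 2 * m * P.lamMax * ‖(P.iterate r ξ k).zeta - ystar‖ ^ 2)
      (by rw [mul_assoc 2]; positivity) (fun k => by rw [mul_assoc 2]; positivity)
      (fun k hk => mul_le_mul_of_nonneg_left (ih k hk (hk.le.trans hK)) (by rw [mul_assoc 2]; positivity))
    set Q := ∑ k ∈ Finset.range K, alpha P.Lpsi (k + 1) ^ 2 / r (k + 1) *
          (2 * m * P.lamMax * ‖(P.iterate r ξ k).zeta - ystar‖ ^ 2) with hQ
    have h5 : L / (2 * E) * Q ≤ E / 1200 := by
      rw [div_mul_eq_mul_div, div_le_iff₀ (by positivity)]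
      have h6 : Q * L * (m * P.lamMax) ≤ E / 1200 * (2 * E) * (m * P.lamMax) := by
        rw [← hE] at h4
        linarith
      linarith [le_of_mul_le_mul_right h6 hml]
    -- The contributions are `E/16` from `‖y*‖²/2`, `E` from the tail bound, `E/1200` from the
    -- quadratic variation and `E/200` from the squared noise, in total below `3E/2`.
    linarith

/-- Both `y^k` and `λ^{k+1}` are convex combinations of points in the ball of squared radius `3E`
about `y*`; two points of this ball have squared distance at most `12E`. -/
lemma norm_lam_sub_zeta_sq_le (hyn : ‖ystar‖ ^ 2 ≤ bigA P.Lpsi N * ε / 8)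
    (hζ : ∀ K ≤ N, ‖(P.iterate r ξ K).zeta - ystar‖ ^ 2 ≤ 3 * (bigA P.Lpsi N * ε)) {k : ℕ}
    (hk : k < N) : ‖(P.iterate r ξ (k + 1)).lam - (P.iterate r ξ k).zeta‖ ^ 2 ≤
      12 * (bigA P.Lpsi N * ε) := by
  have hE := H.budget_pos
  have hA (k : ℕ) : 0 < bigA P.Lpsi k + alpha P.Lpsi (k + 1) :=
    add_pos_of_nonneg_of_pos (bigA_nonneg H.Lpsi_pos k) (alpha_pos H.Lpsi_pos k)
  have hy : ∀ K ≤ N, ‖(P.iterate r ξ K).y - ystar‖ ^ 2 ≤ 3 * (bigA P.Lpsi N * ε) := by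
    intro K
    induction K with
    | zero =>
      intro _
      simp only [iterate, zero_sub, norm_neg]
      linarith
    | succ K ih =>
      intro hK
      exact norm_smul_add_sq_le (alpha_pos H.Lpsi_pos K).le (bigA_nonneg H.Lpsi_pos K) (hA K)
        (hζ (K + 1) hK) (ih (by omega))
  have hl : ‖(P.iterate r ξ (k + 1)).lam - ystar‖ ^ 2 ≤ 3 * (bigA P.Lpsi N * ε) :=
    norm_smul_add_sq_le (alpha_pos H.Lpsi_pos k).le (bigA_nonneg H.Lpsi_pos k) (hA k)
      (hζ k hk.le) (hy k hk.le)
  have h1 := norm_sub_le ((P.iterate r ξ (k + 1)).lam - ystar) ((P.iterate r ξ k).zeta - ystar)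
  rw [sub_sub_sub_cancel_right] at h1
  have h2 := hζ k hk.le
  have h3 := mul_self_le_mul_self (norm_nonneg _) h1
  nlinarith [sq_nonneg (‖(P.iterate r ξ (k + 1)).lam - ystar‖ - ‖(P.iterate r ξ k).zeta - ystar‖)]

lemma normC_sq_le : 2 * (n * m * P.normC ^ 2) ≤ P.lamMinPos * (bigA P.Lpsi N * ε / 8) := by
  have h1 := H.radius_le
  have h2 : P.MF ^ 2 = 2 * (n * m * P.normC ^ 2) := by
    rw [MF, Real.sq_sqrt (by positivity)]; ring
  rw [div_le_iff₀ H.lamMinPos_pos, h2] at h1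
  linarith

/-- Accuracy of the output when the sampling errors are small. -/
theorem accuracy (hy : P.IsDualSolution ystar) (hyn : ‖ystar‖ ≤ P.MF / Real.sqrt P.lamMinPos)
    (ha : ∀ k < N, ‖P.noiseX r ξ (k + 1)‖ ^ 2 ≤ 18 * m * L / r (k + 1))
    (hb : ∀ K ≤ N, ∑ k ∈ Finset.range K, alpha P.Lpsi (k + 1) *
      inner ℝ (P.sqrtW (P.noiseX r ξ (k + 1))) (ystar - (P.iterate r ξ k).zeta) ≤
      bigA P.Lpsi N * ε + L / (2 * (bigA P.Lpsi N * ε)) * ∑ k ∈ Finset.range K,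
        alpha P.Lpsi (k + 1) ^ 2 / r (k + 1) *
          (2 * m * P.lamMax * ‖(P.iterate r ξ k).zeta - ystar‖ ^ 2))
    (hc : ∑ k ∈ Finset.range N, alpha P.Lpsi (k + 1) * (P.noiseV r ξ (k + 1) +
      inner ℝ (P.sqrtW (P.noiseX r ξ (k + 1)))
        ((P.iterate r ξ (k + 1)).lam - (P.iterate r ξ k).zeta)) ≤
      bigA P.Lpsi N * ε / 4 + 2 * L / (bigA P.Lpsi N * ε) * ∑ k ∈ Finset.range N,
        alpha P.Lpsi (k + 1) ^ 2 / r (k + 1) * (8 * m ^ 2 * P.normC ^ 2 +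
          4 * m * P.lamMax * ‖(P.iterate r ξ (k + 1)).lam - (P.iterate r ξ k).zeta‖ ^ 2))
    (hd : ‖∑ k ∈ Finset.range N, alpha P.Lpsi (k + 1) •
      (freqX (r (k + 1)) (ξ (k + 1)) - P.qX)‖ ≤
        3 * Real.sqrt (bigA P.Lpsi N * ε / (1800 * P.lamMax)))
    {R : ℝ} (hR : R ≤ P.MF / Real.sqrt P.lamMinPos) {y : Stacked m n} (hyR : P.IsDualSolution y)
    (hyR' : ‖y‖ ≤ R) :
    ∑ i, regW P.mu P.C (P.q i) (block (P.output r ξ N) i) + P.psi y ≤ ε ∧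
      R * ‖P.sqrtW (P.output r ξ N)‖ ≤ ε := by
  set E := bigA P.Lpsi N * ε with hE
  have hEpos : 0 < E := H.budget_pos
  have hApos := bigA_pos H.Lpsi_pos H.one_le_N
  have hml : 0 < m * P.lamMax := mul_pos (Nat.cast_pos.2 H.m_pos) H.lamMax_pos
  have hrad {t : ℝ} (ht0 : 0 ≤ t) (ht : t ≤ P.MF / Real.sqrt P.lamMinPos) : t ^ 2 ≤ E / 8 := by
    refine le_trans ?_ H.radius_le
    rw [← Real.sq_sqrt H.lamMinPos_pos.le, ← div_pow]
    exact pow_le_pow_left₀ ht0 ht 2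
  have hyn2 := hrad (norm_nonneg _) hyn
  have hR0 : 0 ≤ R := (norm_nonneg y).trans hyR'
  have hR2 := hrad hR0 hR
  have hζ := H.norm_zeta_sub_sq_le hy hyn2 ha hb
  have hnC := H.normC_sq_le
  have hnoise1 := H.sum_norm_noise_sq_le le_rfl ha
  rw [← hE] at hζ hnC hnoise1
  have hlamE : P.lamMinPos * (E / 8) ≤ P.lamMax * (E / 8) :=
    mul_le_mul_of_nonneg_right H.lamMinPos_le (by positivity)
  -- The `49` is `1 + 48`: at most `1` from the values of `Ψ`, and `4 * 12` from the distances.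
  have hnoise2 : 2 * L / E * ∑ k ∈ Finset.range N,
        alpha P.Lpsi (k + 1) ^ 2 / r (k + 1) * (8 * m ^ 2 * P.normC ^ 2 +
          4 * m * P.lamMax * ‖(P.iterate r ξ (k + 1)).lam - (P.iterate r ξ k).zeta‖ ^ 2) ≤
      E / 30 := by
    have h1 := H.sum_alpha_sq_div_mul_le le_rfl (B := m * P.lamMax * (49 * E))
      (f := fun k => 8 * m ^ 2 * P.normC ^ 2 +
          4 * m * P.lamMax * ‖(P.iterate r ξ (k + 1)).lam - (P.iterate r ξ k).zeta‖ ^ 2)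
      (by positivity) (fun k => by rw [mul_assoc 4]; positivity) (fun k hk => ?_)
    · rw [← hE] at h1
      set Q := ∑ k ∈ Finset.range N,
        alpha P.Lpsi (k + 1) ^ 2 / r (k + 1) * (8 * m ^ 2 * P.normC ^ 2 +
          4 * m * P.lamMax * ‖(P.iterate r ξ (k + 1)).lam - (P.iterate r ξ k).zeta‖ ^ 2)
      rw [div_mul_eq_mul_div, div_le_iff₀ hEpos]
      have h2 : 2 * L * Q * (m * P.lamMax) ≤ E / 30 * E * (m * P.lamMax) := by
        have h3 : 0 ≤ E * E * (m * P.lamMax) := by positivity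
        linarith
      exact le_of_mul_le_mul_right h2 hml
    · have h2 := H.norm_lam_sub_zeta_sq_le hyn2 hζ hk
      have h3 := mul_le_mul_of_nonneg_left h2 (show 0 ≤ 4 * (m * P.lamMax) by positivity)
      have hn : (1 : ℝ) ≤ n := by exact_mod_cast H.n_pos
      have h4 : (m : ℝ) * P.normC ^ 2 ≤ n * m * P.normC ^ 2 := by
        rw [mul_assoc]
        exact le_mul_of_one_le_left (by positivity) hn
      have h5 : (m : ℝ) * P.normC ^ 2 * 8 ≤ P.lamMax * E := by
        have : 0 ≤ P.lamMax * E := mul_nonneg H.lamMax_pos.le hEpos.le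
        linarith
      have h6 := mul_le_mul_of_nonneg_left h5 (Nat.cast_nonneg (α := ℝ) m)
      linarith
  have hrep : P.normC * (Real.sqrt (n * m) * ‖∑ k ∈ Finset.range N, alpha P.Lpsi (k + 1) •
      (freqX (r (k + 1)) (ξ (k + 1)) - P.qX)‖) ≤ E / 10 := by
    have h1 : P.normC * (Real.sqrt (n * m) * ‖∑ k ∈ Finset.range N, alpha P.Lpsi (k + 1) •
        (freqX (r (k + 1)) (ξ (k + 1)) - P.qX)‖) ≤
        P.normC * (Real.sqrt (n * m) * (3 * Real.sqrt (E / (1800 * P.lamMax)))) :=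
      mul_le_mul_of_nonneg_left (mul_le_mul_of_nonneg_left hd (Real.sqrt_nonneg _)) P.normC_nonneg
    refine h1.trans (abs_le_of_sq_le_sq' ?_ (by positivity)).2
    rw [mul_pow, mul_pow, mul_pow, Real.sq_sqrt (by positivity),
      Real.sq_sqrt (div_nonneg hEpos.le (by linarith [H.lamMax_pos]))]
    have h2 : n * m * P.normC ^ 2 ≤ P.lamMax * E / 16 := by linarith
    have h3 : P.normC ^ 2 * (n * m * (3 ^ 2 * (E / (1800 * P.lamMax)))) =
        (n * m * P.normC ^ 2) * (E / (200 * P.lamMax)) := by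
      have := H.lamMax_pos.ne'
      field_simp
      ring
    rw [h3]
    have h4 := mul_le_mul_of_nonneg_right h2 (show 0 ≤ E / (200 * P.lamMax) from
      div_nonneg hEpos.le (by linarith [H.lamMax_pos]))
    refine h4.trans ?_
    have h5 : P.lamMax * E / 16 * (E / (200 * P.lamMax)) = E ^ 2 / 3200 := by
      have := H.lamMax_pos.ne'
      field_simp
      norm_num
    rw [h5]
    nlinarith [sq_nonneg E]
  have hout := sum_regW_output_le (ξ := ξ) H.mu_pos H.lamMax_pos H.one_le_N H.q_mem H.batch_pos
  set p := P.output r ξ N with hp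
  set v := P.sqrtW p with hv
  -- The length `2R`, twice what weak duality gives back, leaves a surplus `R‖v‖` for the
  -- feasibility bound. If `v = 0`, then `z = 0` and nothing is needed.
  set z : Stacked m n := (-(2 * R / ‖v‖)) • v with hz
  have hvz : inner ℝ v z = -(2 * R * ‖v‖) := by
    rw [hz, real_inner_smul_right, real_inner_self_eq_norm_sq]
    rcases eq_or_ne ‖v‖ 0 with h | h
    · rw [h]; simp
    · field_simp
  have hzn : ‖z‖ ^ 2 ≤ 4 * R ^ 2 := by
    rw [hz, norm_smul, mul_pow, Real.norm_eq_abs, sq_abs]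
    rcases eq_or_ne ‖v‖ 0 with h | h
    · rw [h]; simp; positivity
    · refine le_of_eq ?_
      field_simp
      ring_nf
  have hpd := primal_dual_sum (r := r) (ξ := ξ) H.mu_pos H.lamMax_pos H.q_mem N z
  have hsum : ∑ k ∈ Finset.range N, alpha P.Lpsi (k + 1) *
        inner ℝ (P.batchX (r (k + 1)) (ξ (k + 1)) (P.dualPoint r ξ (k + 1))) (P.sqrtW z) =
      bigA P.Lpsi N * -(2 * R * ‖v‖) := by
    rw [← hvz, hv, inner_sqrtW_left, hp, output_eq, real_inner_smul_left, sum_inner,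
      mul_inv_cancel_left₀ hApos.ne']
    exact Finset.sum_congr rfl fun k _ => (real_inner_smul_left _ _ _).symm
  rw [hsum] at hpd
  have hyN : P.psi y ≤ P.psi (P.iterate r ξ N).y := hyR (Set.mem_univ _)
  have hyN' := mul_le_mul_of_nonneg_left hyN hApos.le
  have hweak := inner_sub_psi_le H.mu_pos H.q_mem y p
    (fun i => block_output_mem_stdSimplex H.mu_pos H.lamMax_pos H.one_le_N H.batch_pos i)
  have hinner : -(R * ‖v‖) ≤ inner ℝ (P.sqrtW y) p := by
    rw [inner_sqrtW_left]
    have h1 := neg_le_of_abs_le (abs_real_inner_le_norm y v)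
    have h2 := mul_le_mul_of_nonneg_right hyR' (norm_nonneg v)
    linarith
  have hpos1 : 0 ≤ ‖(P.iterate r ξ N).zeta - z‖ ^ 2 := sq_nonneg _
  -- The budget: `‖z‖²/2 ≤ 2R² ≤ E/4`, noise `E/200`, tail `E/4 + E/30`, frequencies `E/10`;
  -- together less than `E`.
  have hfinal : bigA P.Lpsi N * (∑ i, regW P.mu P.C (P.q i) (block p i) + P.psi y +
      2 * (R * ‖v‖)) ≤ bigA P.Lpsi N * ε := by
    rw [← hE]
    linarith
  have hfinal' := le_of_mul_le_mul_left hfinal hApos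
  have hRv : 0 ≤ R * ‖v‖ := mul_nonneg hR0 (norm_nonneg _)
  constructor <;> linarith

end Regime

end GoodEvent

/-! ## Sampling errors -/

section Sampling

variable {m n : ℕ} {P : BaryProblem m n} {r : ℕ → ℕ}

/-- The gradient of one sample. -/
noncomputable def atomX (P : BaryProblem m n) (u : Stacked m n) (x : Fin m → Fin n) : Stacked m n :=
  WithLp.toLp 2 fun il => compGrad P.mu P.C (block u il.1) (x il.1) il.2

/-- The indicator of one sample. -/
noncomputable def countX (x : Fin m → Fin n) : Stacked m n :=
  WithLp.toLp 2 fun ij => if x ij.1 = ij.2 then 1 else 0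

/-- The error of one sample in the value of `Ψ`. -/
noncomputable def atomV (P : BaryProblem m n) (u : Stacked m n) (x : Fin m → Fin n) : ℝ :=
  P.Psi u - ∑ i, logZ P.mu P.C (x i) (block u i)

lemma batchX_sub_meanX {k : ℕ} (hk : 0 < k) (ξ : ℕ → Fin m → Fin n) (u : Stacked m n) :
    P.batchX k ξ u - P.meanX u =
      ∑ s ∈ Finset.range k, (k : ℝ)⁻¹ • (P.atomX u (ξ s) - P.meanX u) := by
  have hk' : (k : ℝ) ≠ 0 := by positivity
  rw [← Finset.smul_sum, Finset.sum_sub_distrib, Finset.sum_const, Finset.card_range, smul_sub,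
    ← Nat.cast_smul_eq_nsmul ℝ, smul_smul, inv_mul_cancel₀ hk', one_smul]
  congr 1
  ext il
  simp [batchX, atomX, div_eq_inv_mul]

lemma freqX_sub_qX {k : ℕ} (hk : 0 < k) (ξ : ℕ → Fin m → Fin n) :
    freqX k ξ - P.qX = ∑ s ∈ Finset.range k, (k : ℝ)⁻¹ • (countX (ξ s) - P.qX) := by
  have hk' : (k : ℝ) ≠ 0 := by positivity
  rw [← Finset.smul_sum, Finset.sum_sub_distrib, Finset.sum_const, Finset.card_range, smul_sub,
    ← Nat.cast_smul_eq_nsmul ℝ, smul_smul, inv_mul_cancel₀ hk', one_smul]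
  congr 1
  ext il
  simp [freqX, countX, div_eq_inv_mul]

lemma Psi_sub_sampleVal {k : ℕ} (hk : 0 < k) (ξ : ℕ → Fin m → Fin n) (u : Stacked m n) :
    P.Psi u - P.sampleVal k ξ u = ∑ s ∈ Finset.range k, (k : ℝ)⁻¹ * P.atomV u (ξ s) := by
  have hk' : (k : ℝ) ≠ 0 := by positivity
  simp only [atomV, ← Finset.mul_sum, Finset.sum_sub_distrib, Finset.sum_const, Finset.card_range,
    nsmul_eq_mul, mul_sub, inv_mul_cancel_left₀ hk']
  rw [Finset.sum_comm, sampleVal, Finset.mul_sum]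
  simp only [div_eq_inv_mul]

/-- Entries lie in `[0, 1]`, so `(x - y)² ≤ x + y`. Each block thus contributes at most 2,
independently of `n`. -/
lemma norm_sub_sq_le_of_mem_stdSimplex {x y : Stacked m n}
    (hx : ∀ i, block x i ∈ stdSimplex ℝ (Fin n)) (hy : ∀ i, block y i ∈ stdSimplex ℝ (Fin n)) :
    ‖x - y‖ ^ 2 ≤ 2 * m := by
  rw [norm_sq_stacked]
  have h1 (i : Fin m) : ∑ l, block (x - y) i l ^ 2 ≤ 2 := by
    have h2 (l : Fin n) : block (x - y) i l ^ 2 ≤ block x i l + block y i l := by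
      have hx0 := (hx i).1 l
      have hy0 := (hy i).1 l
      have hx1 : block x i l ≤ 1 := (mem_Icc_of_mem_stdSimplex (hx i) l).2
      have hy1 : block y i l ≤ 1 := (mem_Icc_of_mem_stdSimplex (hy i) l).2
      change (block x i l - block y i l) ^ 2 ≤ _
      nlinarith [mul_nonneg hx0 hy0]
    refine (Finset.sum_le_sum fun l _ => h2 l).trans ?_
    rw [Finset.sum_add_distrib, (hx i).2, (hy i).2]
    norm_num
  refine (Finset.sum_le_sum fun i _ => h1 i).trans ?_
  simp [mul_comm]

lemma block_atomX_mem (u : Stacked m n) (x : Fin m → Fin n) (i : Fin m) :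
    block (P.atomX u x) i ∈ stdSimplex ℝ (Fin n) := compGrad_mem_stdSimplex (block u i) (x i)

lemma block_countX_mem (x : Fin m → Fin n) (i : Fin m) :
    block (countX x) i ∈ stdSimplex ℝ (Fin n) := by
  refine ⟨fun j => ?_, by simp [block, countX]⟩
  simp only [block, countX]
  split_ifs <;> norm_num

lemma norm_atomX_sub_sq_le (hq : ∀ i, P.q i ∈ stdSimplex ℝ (Fin n)) (u : Stacked m n)
    (x : Fin m → Fin n) : ‖P.atomX u x - P.meanX u‖ ^ 2 ≤ 2 * m :=
  norm_sub_sq_le_of_mem_stdSimplex (block_atomX_mem u x) (meanX_mem_stdSimplex hq u)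

lemma norm_countX_sub_sq_le (hq : ∀ i, P.q i ∈ stdSimplex ℝ (Fin n))
    (x : Fin m → Fin n) : ‖countX x - P.qX‖ ^ 2 ≤ 2 * m :=
  norm_sub_sq_le_of_mem_stdSimplex (block_countX_mem x) hq

lemma abs_atomV_le (hμ : 0 < P.mu) (hq : ∀ i, P.q i ∈ stdSimplex ℝ (Fin n)) (u : Stacked m n)
    (x : Fin m → Fin n) : |P.atomV u x| ≤ 2 * m * P.normC := by
  have h1 (i : Fin m) : |∑ j, P.q i j * logZ P.mu P.C j (block u i) -
      logZ P.mu P.C (x i) (block u i)| ≤ 2 * P.normC := by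
    have h2 : logZ P.mu P.C (x i) (block u i) =
        ∑ j, P.q i j * logZ P.mu P.C (x i) (block u i) := by
      rw [← Finset.sum_mul, (hq i).2, one_mul]
    have h3 : 2 * P.normC = ∑ j, P.q i j * (2 * P.normC) := by
      rw [← Finset.sum_mul, (hq i).2, one_mul]
    rw [h2, h3, ← Finset.sum_sub_distrib]
    refine (Finset.abs_sum_le_sum_abs _ _).trans (Finset.sum_le_sum fun j _ => ?_)
    rw [← mul_sub, abs_mul, abs_of_nonneg ((hq i).1 j)]
    refine mul_le_mul_of_nonneg_left (abs_sub_le_iff.2 ⟨?_, ?_⟩) ((hq i).1 j)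
    · exact logZ_sub_logZ_le hμ P.abs_C_le _ _ _
    · exact logZ_sub_logZ_le hμ P.abs_C_le _ _ _
  rw [atomV, Psi, ← Finset.sum_sub_distrib]
  refine (Finset.abs_sum_le_sum_abs _ _).trans ((Finset.sum_le_sum fun i _ => h1 i).trans ?_)
  simp only [Finset.sum_const, Finset.card_univ, Fintype.card_fin, nsmul_eq_mul]
  exact le_of_eq (by ring)

lemma abs_inner_sqrtW_le (hlam : 0 ≤ P.lamMax) {x : Stacked m n} (hx : ‖x‖ ^ 2 ≤ 2 * m)
    (d : Stacked m n) : |inner ℝ (P.sqrtW x) d| ≤ Real.sqrt (2 * m * P.lamMax * ‖d‖ ^ 2) := by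
  refine (abs_real_inner_le_norm _ _).trans (Real.le_sqrt_of_sq_le ?_)
  rw [mul_pow]
  refine mul_le_mul_of_nonneg_right ?_ (sq_nonneg _)
  refine (P.norm_sqrtW_sq_le x).trans ?_
  rw [mul_comm (2 * (m : ℝ))]
  exact mul_le_mul_of_nonneg_left hx hlam

/-! ### Dependence on the past -/

/-- The samples as a sequence of batches. -/
def paths (ω : ℕ × ℕ → Fin m → Fin n) : ℕ → ℕ → Fin m → Fin n := fun k s => ω (k, s)

lemma dependsOn_iterate (P : BaryProblem m n) (r : ℕ → ℕ) (k : ℕ) :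
    DependsOn (fun ω => P.iterate r (paths ω) k) (hist r k : Set (ℕ × ℕ)) := by
  intro ω ω' h
  induction k with
  | zero => rfl
  | succ k ih =>
    have h1 := ih fun a ha => h a (hist_mono (Nat.le_succ k) ha)
    have h2 (u : Stacked m n) : P.batchX (r (k + 1)) (paths ω (k + 1)) u =
        P.batchX (r (k + 1)) (paths ω' (k + 1)) u := by
      ext il
      simp only [batchX]
      congr 1
      refine Finset.sum_congr rfl fun s hs => ?_
      simp only [paths]
      rw [h (k + 1, s) (Finset.mem_coe.2 (mem_hist.2 ⟨le_rfl, Finset.mem_range.1 hs⟩))]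
    simp only [iterate]
    simp only at h1
    rw [h1, h2]

/-- The query point of batch `k + 1` is built from the state after batch `k`, which makes the
increments of that batch conditionally centred. -/
lemma dependsOn_lam (P : BaryProblem m n) (r : ℕ → ℕ) (k : ℕ) :
    DependsOn (fun ω => (P.iterate r (paths ω) (k + 1)).lam) (hist r k : Set (ℕ × ℕ)) := by
  intro ω ω' h
  have h1 : P.iterate r (paths ω) k = P.iterate r (paths ω') k := dependsOn_iterate P r k h
  simp only [iterate, h1]

/-! ### Means -/

variable {Ω : Type*} [MeasurableSpace Ω] {Pr : Measure Ω} [IsProbabilityMeasure Pr]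
  {ξ : ℕ → ℕ → Ω → Fin m → Fin n}

/-- Only the marginal law at one node is used; this is why the choices of different nodes within a
sample may be dependent. -/
lemma sum_measureReal_mul (hs : IsSampling P.q Pr ξ) (k s : ℕ) (i : Fin m) (f : Fin n → ℝ) :
    ∑ x, Pr.real (ξ k s ⁻¹' {x}) * f (x i) = ∑ j, P.q i j * f j := by
  have h1 (j : Fin n) : P.q i j =
      ∑ x : Fin m → Fin n, if x i = j then Pr.real (ξ k s ⁻¹' {x}) else 0 := by
    rw [← hs.law k s i j, ← Finset.sum_filter, sum_measureReal_preimage_singleton _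
      fun x _ => hs.measurable k s (measurableSet_singleton x)]
    congr 1
    ext w
    simp
  simp only [h1, Finset.sum_mul]
  rw [Finset.sum_comm]
  refine Finset.sum_congr rfl fun x _ => ?_
  simp

lemma sum_smul_atomX_sub (hs : IsSampling P.q Pr ξ) (k s : ℕ) (u : Stacked m n) :
    ∑ x, Pr.real (ξ k s ⁻¹' {x}) • (P.atomX u x - P.meanX u) = 0 := by
  simp only [smul_sub, Finset.sum_sub_distrib, ← Finset.sum_smul,
    sum_measureReal_preimage (hs.measurable k s), one_smul]
  rw [sub_eq_zero]
  ext il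
  simp only [WithLp.ofLp_sum, Finset.sum_apply, PiLp.smul_apply, smul_eq_mul, atomX, meanX]
  exact sum_measureReal_mul hs k s il.1 fun j => compGrad P.mu P.C (block u il.1) j il.2

lemma sum_smul_countX_sub (hs : IsSampling P.q Pr ξ) (k s : ℕ) :
    ∑ x, Pr.real (ξ k s ⁻¹' {x}) • (countX x - P.qX) = 0 := by
  simp only [smul_sub, Finset.sum_sub_distrib, ← Finset.sum_smul,
    sum_measureReal_preimage (hs.measurable k s), one_smul]
  rw [sub_eq_zero]
  ext il
  simp only [WithLp.ofLp_sum, Finset.sum_apply, PiLp.smul_apply, smul_eq_mul, countX, qX]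
  rw [sum_measureReal_mul hs k s il.1 fun j => if j = il.2 then 1 else 0]
  simp

lemma sum_mul_atomV (hs : IsSampling P.q Pr ξ) (k s : ℕ) (u : Stacked m n) :
    ∑ x, Pr.real (ξ k s ⁻¹' {x}) * P.atomV u x = 0 := by
  simp only [atomV, mul_sub, Finset.sum_sub_distrib, ← Finset.sum_mul,
    sum_measureReal_preimage (hs.measurable k s), one_mul, Finset.mul_sum]
  rw [sub_eq_zero, Psi]
  refine Eq.trans (Finset.sum_congr rfl fun i _ => ?_) Finset.sum_comm
  exact (sum_measureReal_mul hs k s i fun j => logZ P.mu P.C j (block u i)).symm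

lemma sum_mul_inner_atomX (hs : IsSampling P.q Pr ξ) (k s : ℕ) (u d : Stacked m n) :
    ∑ x, Pr.real (ξ k s ⁻¹' {x}) * inner ℝ (P.sqrtW (P.atomX u x - P.meanX u)) d = 0 := by
  simp only [inner_sqrtW_left, ← real_inner_smul_left]
  rw [← sum_inner, sum_smul_atomX_sub hs, inner_zero_left]

/-! ### Probabilities of the bad events -/

namespace Regime

variable {N : ℕ} {ε L : ℝ} (H : Regime P r N ε L) (hs : IsSampling P.q Pr ξ)
include H hs

/-- Batch `k + 1` alone is viewed as a walk whose earlier increments are zero; its variance bound is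
`2m/r_{k+1}`. -/
lemma measure_noiseX_gt_le {k : ℕ} (hk : k < N) :
    Pr.real {w | ¬ ‖P.noiseX r (fun k s => ξ k s w) (k + 1)‖ ^ 2 ≤ 18 * m * L / r (k + 1)} ≤
      Real.exp (-L) := by
  have hr0 := H.batch_pos k hk
  have hr0' : (0 : ℝ) < r (k + 1) := by exact_mod_cast hr0
  have hm : (0 : ℝ) < m := by exact_mod_cast H.m_pos
  have h := measure_norm_walk_ge_le (X := fun a : ℕ × ℕ => ξ a.1 a.2) (Pr := Pr)
    (fun a => hs.measurable a.1 a.2) hs.indep (r := r) (N := k + 1)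
    (Y := fun l ω x => (if l = k then (r (k + 1) : ℝ)⁻¹ else 0) •
      (P.atomX (P.dualPoint r (paths ω) (l + 1)) x - P.meanX (P.dualPoint r (paths ω) (l + 1))))
    (c := fun l => if l = k then ((r (k + 1) : ℝ)⁻¹) ^ 2 * (2 * m) else 0)
    (fun l _ ω ω' hω => by
      have h1 : P.dualPoint r (paths ω) (l + 1) = P.dualPoint r (paths ω') (l + 1) :=
        congrArg P.sqrtW (dependsOn_lam P r l hω)
      simp only [h1])
    (fun l _ s ω => by
      simp only [smul_comm _ (if l = k then (r (k + 1) : ℝ)⁻¹ else 0), ← Finset.smul_sum]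
      rw [sum_smul_atomX_sub hs, smul_zero])
    (fun l _ ω x => by
      split_ifs
      · rw [norm_smul, mul_pow, Real.norm_eq_abs, sq_abs]
        exact mul_le_mul_of_nonneg_left (norm_atomX_sub_sq_le H.q_mem _ _) (sq_nonneg _)
      · simp)
    (V := 2 * m / r (k + 1)) (t := L) (by positivity)
    (by
      rw [Finset.sum_range_succ, Finset.sum_eq_zero, if_pos rfl]
      · refine le_of_eq ?_
        field_simp
        ring
      · intro l hl
        rw [if_neg (Finset.mem_range.1 hl).ne, mul_zero]) H.one_le_L
  refine le_trans (measureReal_mono fun w hw => ?_) h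
  simp only [Set.mem_ofPred_eq, not_le] at hw ⊢
  have h1 : ∑ l ∈ Finset.range (k + 1), ∑ s ∈ Finset.range (r (l + 1)),
      (if l = k then (r (k + 1) : ℝ)⁻¹ else 0) •
      (P.atomX (P.dualPoint r (paths fun a => ξ a.1 a.2 w) (l + 1)) (ξ (l + 1) s w) -
        P.meanX (P.dualPoint r (paths fun a => ξ a.1 a.2 w) (l + 1))) =
      P.noiseX r (fun k s => ξ k s w) (k + 1) := by
    rw [Finset.sum_range_succ, Finset.sum_eq_zero, zero_add, noiseX, batchX_sub_meanX hr0]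
    · simp only [if_true]
      rfl
    · intro l hl
      rw [if_neg (Finset.mem_range.1 hl).ne]
      simp
  rw [h1]
  refine (abs_le_of_sq_le_sq' (le_trans (le_of_eq ?_) hw.le) (norm_nonneg _)).2
  rw [mul_pow, Real.sq_sqrt (by have := H.L_pos; positivity)]
  ring

/-- The scalar tail bound with `τ = L/E`: dividing by `τ` turns the level `L` into `E` and the
compensator into `L/(2E)` times the quadratic variation. -/
lemma measure_inner_gt_le (ystar : Stacked m n) {K : ℕ} (hK : K ≤ N) :
    Pr.real {w | ¬ ∑ k ∈ Finset.range K, alpha P.Lpsi (k + 1) *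
      inner ℝ (P.sqrtW (P.noiseX r (fun k s => ξ k s w) (k + 1)))
        (ystar - (P.iterate r (fun k s => ξ k s w) k).zeta) ≤
      bigA P.Lpsi N * ε + L / (2 * (bigA P.Lpsi N * ε)) * ∑ k ∈ Finset.range K,
        alpha P.Lpsi (k + 1) ^ 2 / r (k + 1) *
          (2 * m * P.lamMax * ‖(P.iterate r (fun k s => ξ k s w) k).zeta - ystar‖ ^ 2)} ≤
      Real.exp (-L) := by
  set E := bigA P.Lpsi N * ε with hE
  have hEpos : 0 < E := H.budget_pos
  have hlam := H.lamMax_pos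
  have h := measure_scalar_walk_ge_le (X := fun a : ℕ × ℕ => ξ a.1 a.2) (Pr := Pr)
    (fun a => hs.measurable a.1 a.2) hs.indep (r := r) (N := K)
    (φ := fun l ω x => alpha P.Lpsi (l + 1) / r (l + 1) * inner ℝ (P.sqrtW
      (P.atomX (P.dualPoint r (paths ω) (l + 1)) x - P.meanX (P.dualPoint r (paths ω) (l + 1))))
      (ystar - (P.iterate r (paths ω) l).zeta))
    (c := fun l ω => alpha P.Lpsi (l + 1) / r (l + 1) *
      Real.sqrt (2 * m * P.lamMax * ‖ystar - (P.iterate r (paths ω) l).zeta‖ ^ 2))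
    (fun l _ ω ω' hω => by
      have h1 : P.dualPoint r (paths ω) (l + 1) = P.dualPoint r (paths ω') (l + 1) :=
        congrArg P.sqrtW (dependsOn_lam P r l hω)
      have h2 : P.iterate r (paths ω) l = P.iterate r (paths ω') l := dependsOn_iterate P r l hω
      simp only [h1, h2])
    (fun l _ ω ω' hω => by
      have h2 : P.iterate r (paths ω) l = P.iterate r (paths ω') l := dependsOn_iterate P r l hω
      simp only [h2])
    (fun l _ s ω => by
      simp only [mul_left_comm _ (alpha P.Lpsi (l + 1) / r (l + 1)), ← Finset.mul_sum]
      rw [sum_mul_inner_atomX hs, mul_zero])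
    (fun l _ ω x => by
      have h0 : 0 ≤ alpha P.Lpsi (l + 1) / r (l + 1) :=
        div_nonneg (alpha_pos H.Lpsi_pos l).le (Nat.cast_nonneg _)
      rw [abs_mul, abs_of_nonneg h0]
      exact mul_le_mul_of_nonneg_left (abs_inner_sqrtW_le hlam.le
        (norm_atomX_sub_sq_le H.q_mem _ _) _) h0) (L / E) L
  refine le_trans (measureReal_mono fun w hw => ?_) h
  simp only [Set.mem_ofPred_eq, not_le] at hw ⊢
  have h1 : ∑ l ∈ Finset.range K, ∑ s ∈ Finset.range (r (l + 1)),
      alpha P.Lpsi (l + 1) / r (l + 1) * inner ℝ (P.sqrtW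
      (P.atomX (P.dualPoint r (paths fun a => ξ a.1 a.2 w) (l + 1)) (ξ (l + 1) s w) -
        P.meanX (P.dualPoint r (paths fun a => ξ a.1 a.2 w) (l + 1))))
      (ystar - (P.iterate r (paths fun a => ξ a.1 a.2 w) l).zeta) =
      ∑ k ∈ Finset.range K, alpha P.Lpsi (k + 1) *
        inner ℝ (P.sqrtW (P.noiseX r (fun k s => ξ k s w) (k + 1)))
        (ystar - (P.iterate r (fun k s => ξ k s w) k).zeta) := by
    refine Finset.sum_congr rfl fun l hl => ?_
    rw [noiseX, batchX_sub_meanX (H.batch_pos l ((Finset.mem_range.1 hl).trans_le hK)), map_sum,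
      sum_inner, Finset.mul_sum]
    refine Finset.sum_congr rfl fun s _ => ?_
    rw [map_smul, real_inner_smul_left, ← mul_assoc, div_eq_mul_inv]
    rfl
  have h2 : ∑ l ∈ Finset.range K, (r (l + 1) : ℝ) * (alpha P.Lpsi (l + 1) / r (l + 1) *
      Real.sqrt (2 * m * P.lamMax *
        ‖ystar - (P.iterate r (paths fun a => ξ a.1 a.2 w) l).zeta‖ ^ 2)) ^ 2 =
      ∑ k ∈ Finset.range K, alpha P.Lpsi (k + 1) ^ 2 / r (k + 1) *
          (2 * m * P.lamMax * ‖(P.iterate r (fun k s => ξ k s w) k).zeta - ystar‖ ^ 2) := by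
    refine Finset.sum_congr rfl fun l hl => ?_
    have hr0' : (r (l + 1) : ℝ) ≠ 0 :=
      Nat.cast_ne_zero.2 (H.batch_pos l ((Finset.mem_range.1 hl).trans_le hK)).ne'
    rw [mul_pow, Real.sq_sqrt (by positivity), norm_sub_rev]
    field_simp
    rfl
  rw [h1, h2]
  set M := ∑ k ∈ Finset.range K, alpha P.Lpsi (k + 1) *
        inner ℝ (P.sqrtW (P.noiseX r (fun k s => ξ k s w) (k + 1)))
        (ystar - (P.iterate r (fun k s => ξ k s w) k).zeta)
  set Q := ∑ k ∈ Finset.range K, alpha P.Lpsi (k + 1) ^ 2 / r (k + 1) *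
          (2 * m * P.lamMax * ‖(P.iterate r (fun k s => ξ k s w) k).zeta - ystar‖ ^ 2)
  have h3 := mul_le_mul_of_nonneg_left hw.le (div_pos H.L_pos hEpos).le
  have h4 : L / E * (E + L / (2 * E) * Q) = L + (L / E) ^ 2 / 2 * Q := by field_simp
  rw [h4] at h3
  linarith

/-- As before with `τ = 4L/E`, which lowers the level to `E/4`. The increments combine value and
gradient errors via `(a + b)² ≤ 2a² + 2b²`. -/
lemma measure_value_gt_le :
    Pr.real {w | ¬ ∑ k ∈ Finset.range N, alpha P.Lpsi (k + 1) *
      (P.noiseV r (fun k s => ξ k s w) (k + 1) +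
      inner ℝ (P.sqrtW (P.noiseX r (fun k s => ξ k s w) (k + 1)))
        ((P.iterate r (fun k s => ξ k s w) (k + 1)).lam -
          (P.iterate r (fun k s => ξ k s w) k).zeta)) ≤
      bigA P.Lpsi N * ε / 4 + 2 * L / (bigA P.Lpsi N * ε) * ∑ k ∈ Finset.range N,
        alpha P.Lpsi (k + 1) ^ 2 / r (k + 1) * (8 * m ^ 2 * P.normC ^ 2 +
          4 * m * P.lamMax * ‖(P.iterate r (fun k s => ξ k s w) (k + 1)).lam -
            (P.iterate r (fun k s => ξ k s w) k).zeta‖ ^ 2)} ≤ Real.exp (-L) := by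
  set E := bigA P.Lpsi N * ε with hE
  have hEpos : 0 < E := H.budget_pos
  have hlam := H.lamMax_pos
  have h := measure_scalar_walk_ge_le (X := fun a : ℕ × ℕ => ξ a.1 a.2) (Pr := Pr)
    (fun a => hs.measurable a.1 a.2) hs.indep (r := r) (N := N)
    (φ := fun l ω x => alpha P.Lpsi (l + 1) / r (l + 1) *
      (P.atomV (P.dualPoint r (paths ω) (l + 1)) x + inner ℝ (P.sqrtW
      (P.atomX (P.dualPoint r (paths ω) (l + 1)) x - P.meanX (P.dualPoint r (paths ω) (l + 1))))
      ((P.iterate r (paths ω) (l + 1)).lam - (P.iterate r (paths ω) l).zeta)))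
    (c := fun l ω => alpha P.Lpsi (l + 1) / r (l + 1) *
      Real.sqrt (8 * m ^ 2 * P.normC ^ 2 + 4 * m * P.lamMax *
        ‖(P.iterate r (paths ω) (l + 1)).lam - (P.iterate r (paths ω) l).zeta‖ ^ 2))
    (fun l _ ω ω' hω => by
      have h1 : P.dualPoint r (paths ω) (l + 1) = P.dualPoint r (paths ω') (l + 1) :=
        congrArg P.sqrtW (dependsOn_lam P r l hω)
      have h2 : P.iterate r (paths ω) l = P.iterate r (paths ω') l := dependsOn_iterate P r l hω
      have h3 : (P.iterate r (paths ω) (l + 1)).lam = (P.iterate r (paths ω') (l + 1)).lam :=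
        dependsOn_lam P r l hω
      simp only [h1, h2, h3])
    (fun l _ ω ω' hω => by
      have h2 : P.iterate r (paths ω) l = P.iterate r (paths ω') l := dependsOn_iterate P r l hω
      have h3 : (P.iterate r (paths ω) (l + 1)).lam = (P.iterate r (paths ω') (l + 1)).lam :=
        dependsOn_lam P r l hω
      simp only [h2, h3])
    (fun l _ s ω => by
      simp only [mul_left_comm _ (alpha P.Lpsi (l + 1) / r (l + 1)), ← Finset.mul_sum, mul_add,
        Finset.sum_add_distrib]
      rw [sum_mul_inner_atomX hs, sum_mul_atomV hs, mul_zero, add_zero])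
    (fun l _ ω x => by
      have h0 : 0 ≤ alpha P.Lpsi (l + 1) / r (l + 1) :=
        div_nonneg (alpha_pos H.Lpsi_pos l).le (Nat.cast_nonneg _)
      rw [abs_mul, abs_of_nonneg h0]
      refine mul_le_mul_of_nonneg_left (Real.le_sqrt_of_sq_le ?_) h0
      rw [sq_abs]
      set d := (P.iterate r (paths ω) (l + 1)).lam - (P.iterate r (paths ω) l).zeta
      have h1 := abs_atomV_le H.mu_pos H.q_mem (P.dualPoint r (paths ω) (l + 1)) x
      have h2 := abs_inner_sqrtW_le hlam.le
        (norm_atomX_sub_sq_le H.q_mem (P.dualPoint r (paths ω) (l + 1)) x) d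
      have h3 := pow_le_pow_left₀ (abs_nonneg _) h1 2
      have h4 := pow_le_pow_left₀ (abs_nonneg _) h2 2
      rw [sq_abs, Real.sq_sqrt (by positivity)] at h4
      rw [sq_abs] at h3
      set a := P.atomV (P.dualPoint r (paths ω) (l + 1)) x
      set b : ℝ := inner ℝ (P.sqrtW (P.atomX (P.dualPoint r (paths ω) (l + 1)) x -
        P.meanX (P.dualPoint r (paths ω) (l + 1)))) d
      have h5 : (a + b) ^ 2 ≤ 2 * a ^ 2 + 2 * b ^ 2 := by linarith [sq_nonneg (a - b)]
      linarith) (4 * L / E) L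
  refine le_trans (measureReal_mono fun w hw => ?_) h
  simp only [Set.mem_ofPred_eq, not_le] at hw ⊢
  have h1 : ∑ l ∈ Finset.range N, ∑ s ∈ Finset.range (r (l + 1)),
      alpha P.Lpsi (l + 1) / r (l + 1) *
      (P.atomV (P.dualPoint r (paths fun a => ξ a.1 a.2 w) (l + 1)) (ξ (l + 1) s w) +
      inner ℝ (P.sqrtW
      (P.atomX (P.dualPoint r (paths fun a => ξ a.1 a.2 w) (l + 1)) (ξ (l + 1) s w) -
        P.meanX (P.dualPoint r (paths fun a => ξ a.1 a.2 w) (l + 1))))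
      ((P.iterate r (paths fun a => ξ a.1 a.2 w) (l + 1)).lam -
        (P.iterate r (paths fun a => ξ a.1 a.2 w) l).zeta)) =
      ∑ k ∈ Finset.range N, alpha P.Lpsi (k + 1) *
      (P.noiseV r (fun k s => ξ k s w) (k + 1) +
      inner ℝ (P.sqrtW (P.noiseX r (fun k s => ξ k s w) (k + 1)))
        ((P.iterate r (fun k s => ξ k s w) (k + 1)).lam -
          (P.iterate r (fun k s => ξ k s w) k).zeta)) := by
    refine Finset.sum_congr rfl fun l hl => ?_
    have hr0 := H.batch_pos l (Finset.mem_range.1 hl)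
    rw [noiseX, noiseV, batchX_sub_meanX hr0, Psi_sub_sampleVal hr0, map_sum,
      sum_inner, ← Finset.sum_add_distrib, Finset.mul_sum]
    refine Finset.sum_congr rfl fun s _ => ?_
    rw [map_smul, real_inner_smul_left, ← mul_add, ← mul_assoc, div_eq_mul_inv]
    rfl
  have h2 : ∑ l ∈ Finset.range N, (r (l + 1) : ℝ) * (alpha P.Lpsi (l + 1) / r (l + 1) *
      Real.sqrt (8 * m ^ 2 * P.normC ^ 2 + 4 * m * P.lamMax *
        ‖(P.iterate r (paths fun a => ξ a.1 a.2 w) (l + 1)).lam -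
          (P.iterate r (paths fun a => ξ a.1 a.2 w) l).zeta‖ ^ 2)) ^ 2 =
      ∑ k ∈ Finset.range N, alpha P.Lpsi (k + 1) ^ 2 / r (k + 1) *
          (8 * m ^ 2 * P.normC ^ 2 + 4 * m * P.lamMax *
            ‖(P.iterate r (fun k s => ξ k s w) (k + 1)).lam -
            (P.iterate r (fun k s => ξ k s w) k).zeta‖ ^ 2) := by
    refine Finset.sum_congr rfl fun l hl => ?_
    have hr0' : (r (l + 1) : ℝ) ≠ 0 :=
      Nat.cast_ne_zero.2 (H.batch_pos l (Finset.mem_range.1 hl)).ne'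
    rw [mul_pow, Real.sq_sqrt (by positivity)]
    have h3 : (r (l + 1) : ℝ) * (alpha P.Lpsi (l + 1) / r (l + 1)) ^ 2 =
        alpha P.Lpsi (l + 1) ^ 2 / r (l + 1) := by field_simp
    rw [← mul_assoc, h3]
    rfl
  rw [h1, h2]
  set M := ∑ k ∈ Finset.range N, alpha P.Lpsi (k + 1) *
      (P.noiseV r (fun k s => ξ k s w) (k + 1) +
      inner ℝ (P.sqrtW (P.noiseX r (fun k s => ξ k s w) (k + 1)))
        ((P.iterate r (fun k s => ξ k s w) (k + 1)).lam -
          (P.iterate r (fun k s => ξ k s w) k).zeta))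
  set Q := ∑ k ∈ Finset.range N, alpha P.Lpsi (k + 1) ^ 2 / r (k + 1) *
          (8 * m ^ 2 * P.normC ^ 2 + 4 * m * P.lamMax *
            ‖(P.iterate r (fun k s => ξ k s w) (k + 1)).lam -
            (P.iterate r (fun k s => ξ k s w) k).zeta‖ ^ 2)
  have hL := H.L_pos
  have h3 := mul_le_mul_of_nonneg_left hw.le (show 0 ≤ 4 * L / E by positivity)
  have h4 : 4 * L / E * (E / 4 + 2 * L / E * Q) = L + (4 * L / E) ^ 2 / 2 * Q := by
    field_simp
    ring
  rw [h4] at h3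
  linarith

lemma measure_freqX_gt_le :
    Pr.real {w | ¬ ‖∑ k ∈ Finset.range N, alpha P.Lpsi (k + 1) •
      (freqX (r (k + 1)) (fun s => ξ (k + 1) s w) - P.qX)‖ ≤
        3 * Real.sqrt (bigA P.Lpsi N * ε / (1800 * P.lamMax))} ≤ Real.exp (-L) := by
  have hEpos : 0 < bigA P.Lpsi N * ε := H.budget_pos
  have hlam := H.lamMax_pos
  have hL := H.L_pos
  have hm : (0 : ℝ) < m := by exact_mod_cast H.m_pos
  have h := measure_norm_walk_ge_le (X := fun a : ℕ × ℕ => ξ a.1 a.2) (Pr := Pr)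
    (fun a => hs.measurable a.1 a.2) hs.indep (r := r) (N := N)
    (Y := fun l _ x => (alpha P.Lpsi (l + 1) / r (l + 1)) • (countX x - P.qX))
    (c := fun l => (alpha P.Lpsi (l + 1) / r (l + 1)) ^ 2 * (2 * m))
    (fun l _ ω ω' _ => rfl)
    (fun l _ s ω => by
      simp only [smul_comm _ (alpha P.Lpsi (l + 1) / r (l + 1)), ← Finset.smul_sum]
      rw [sum_smul_countX_sub hs, smul_zero])
    (fun l _ ω x => by
      rw [norm_smul, mul_pow, Real.norm_eq_abs, sq_abs]
      exact mul_le_mul_of_nonneg_left (norm_countX_sub_sq_le H.q_mem _) (sq_nonneg _))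
    (V := bigA P.Lpsi N * ε / (1800 * P.lamMax * L)) (t := L) (by positivity)
    (by
      have h1 := H.sum_alpha_sq_div_mul_le le_rfl (f := fun _ => 1) zero_le_one
        (fun _ => zero_le_one) (fun _ _ => le_rfl)
      rw [le_div_iff₀ (by positivity)]
      have h2 : ∑ l ∈ Finset.range N, (r (l + 1) : ℝ) *
          ((alpha P.Lpsi (l + 1) / r (l + 1)) ^ 2 * (2 * (m : ℝ))) =
          (∑ l ∈ Finset.range N, alpha P.Lpsi (l + 1) ^ 2 / (r (l + 1) : ℝ) * 1) *
            (2 * (m : ℝ)) := by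
        rw [Finset.sum_mul]
        refine Finset.sum_congr rfl fun l hl => ?_
        have hr0' : (r (l + 1) : ℝ) ≠ 0 :=
          Nat.cast_ne_zero.2 (H.batch_pos l (Finset.mem_range.1 hl)).ne'
        field_simp
      rw [h2]
      linarith) H.one_le_L
  refine le_trans (measureReal_mono fun w hw => ?_) h
  simp only [Set.mem_ofPred_eq, not_le] at hw ⊢
  have h1 : ∑ l ∈ Finset.range N, ∑ s ∈ Finset.range (r (l + 1)),
      (alpha P.Lpsi (l + 1) / r (l + 1)) • (countX (ξ (l + 1) s w) - P.qX) =
      ∑ k ∈ Finset.range N, alpha P.Lpsi (k + 1) •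
      (freqX (r (k + 1)) (fun s => ξ (k + 1) s w) - P.qX) := by
    refine Finset.sum_congr rfl fun l hl => ?_
    rw [freqX_sub_qX (H.batch_pos l (Finset.mem_range.1 hl)), Finset.smul_sum]
    refine Finset.sum_congr rfl fun s _ => ?_
    rw [smul_smul, div_eq_mul_inv]
  rw [h1]
  have h2 : bigA P.Lpsi N * ε / (1800 * P.lamMax * L) * L =
      bigA P.Lpsi N * ε / (1800 * P.lamMax) := by field_simp
  rw [h2]
  exact hw.le

/-- Accuracy of the output with high probability. -/
theorem measure_accuracy {ystar : Stacked m n} (hy : P.IsDualSolution ystar)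
    (hyn : ‖ystar‖ ≤ P.MF / Real.sqrt P.lamMinPos) {R : ℝ}
    (hR : R ≤ P.MF / Real.sqrt P.lamMinPos) {y : Stacked m n} (hyR : P.IsDualSolution y)
    (hyR' : ‖y‖ ≤ R) :
    1 - (2 * N + 2) * Real.exp (-L) ≤ Pr.real {w |
      ∑ i, regW P.mu P.C (P.q i) (block (P.output r (fun k s => ξ k s w) N) i) + P.psi y ≤ ε ∧
      R * ‖P.sqrtW (P.output r (fun k s => ξ k s w) N)‖ ≤ ε} := by
  set good := {w |
      ∑ i, regW P.mu P.C (P.q i) (block (P.output r (fun k s => ξ k s w) N) i) + P.psi y ≤ ε ∧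
      R * ‖P.sqrtW (P.output r (fun k s => ξ k s w) N)‖ ≤ ε} with hgood
  set B1 : ℕ → Set Ω := fun k =>
    {w | ¬ ‖P.noiseX r (fun k s => ξ k s w) (k + 1)‖ ^ 2 ≤ 18 * m * L / r (k + 1)} with hB1
  set B2 : ℕ → Set Ω := fun K => {w | ¬ ∑ k ∈ Finset.range K, alpha P.Lpsi (k + 1) *
      inner ℝ (P.sqrtW (P.noiseX r (fun k s => ξ k s w) (k + 1)))
        (ystar - (P.iterate r (fun k s => ξ k s w) k).zeta) ≤
      bigA P.Lpsi N * ε + L / (2 * (bigA P.Lpsi N * ε)) * ∑ k ∈ Finset.range K,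
        alpha P.Lpsi (k + 1) ^ 2 / r (k + 1) *
          (2 * m * P.lamMax * ‖(P.iterate r (fun k s => ξ k s w) k).zeta - ystar‖ ^ 2)} with hB2
  set B3 : Set Ω := {w | ¬ ∑ k ∈ Finset.range N, alpha P.Lpsi (k + 1) *
      (P.noiseV r (fun k s => ξ k s w) (k + 1) +
      inner ℝ (P.sqrtW (P.noiseX r (fun k s => ξ k s w) (k + 1)))
        ((P.iterate r (fun k s => ξ k s w) (k + 1)).lam -
          (P.iterate r (fun k s => ξ k s w) k).zeta)) ≤
      bigA P.Lpsi N * ε / 4 + 2 * L / (bigA P.Lpsi N * ε) * ∑ k ∈ Finset.range N,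
        alpha P.Lpsi (k + 1) ^ 2 / r (k + 1) * (8 * m ^ 2 * P.normC ^ 2 +
          4 * m * P.lamMax * ‖(P.iterate r (fun k s => ξ k s w) (k + 1)).lam -
            (P.iterate r (fun k s => ξ k s w) k).zeta‖ ^ 2)} with hB3
  set B4 : Set Ω := {w | ¬ ‖∑ k ∈ Finset.range N, alpha P.Lpsi (k + 1) •
      (freqX (r (k + 1)) (fun s => ξ (k + 1) s w) - P.qX)‖ ≤
        3 * Real.sqrt (bigA P.Lpsi N * ε / (1800 * P.lamMax))} with hB4
  have hcover : (Set.univ : Set Ω) ⊆ good ∪ ((⋃ k ∈ Finset.range N, B1 k) ∪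
      (⋃ K ∈ Finset.range N, B2 (K + 1)) ∪ (B3 ∪ B4)) := by
    intro w _
    by_contra hw
    simp only [Set.mem_union, not_or, Set.mem_iUnion, not_exists, Finset.mem_range] at hw
    obtain ⟨hg, ⟨h1, h2⟩, h3, h4⟩ := hw
    refine hg (H.accuracy hy hyn (fun k hk => not_not.1 (h1 k hk)) (fun K hK => ?_)
      (not_not.1 h3) (not_not.1 h4) hR hyR hyR')
    -- The empty sum needs no event, so `N` events cover all prefixes.
    rcases K with _ | K
    · simpa using H.budget_pos.le
    · exact not_not.1 (h2 K hK)
  have h1 : Pr.real (⋃ k ∈ Finset.range N, B1 k) ≤ N * Real.exp (-L) := by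
    refine (measureReal_biUnion_finset_le _ _).trans ?_
    refine (Finset.sum_le_sum fun k hk =>
      H.measure_noiseX_gt_le hs (Finset.mem_range.1 hk)).trans (le_of_eq ?_)
    simp
  have h2 : Pr.real (⋃ K ∈ Finset.range N, B2 (K + 1)) ≤ N * Real.exp (-L) := by
    refine (measureReal_biUnion_finset_le _ _).trans ?_
    refine (Finset.sum_le_sum fun k hk =>
      H.measure_inner_gt_le hs ystar (Finset.mem_range.1 hk)).trans (le_of_eq ?_)
    simp
  have h3 := (measureReal_mono (μ := Pr) hcover).trans (measureReal_union_le _ _)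
  have h4 := measureReal_union_le (μ := Pr) ((⋃ k ∈ Finset.range N, B1 k) ∪
      (⋃ K ∈ Finset.range N, B2 (K + 1))) (B3 ∪ B4)
  have h5 := measureReal_union_le (μ := Pr) (⋃ k ∈ Finset.range N, B1 k)
      (⋃ K ∈ Finset.range N, B2 (K + 1))
  have h6 := measureReal_union_le (μ := Pr) B3 B4
  have h7 := H.measure_value_gt_le hs
  have h8 := H.measure_freqX_gt_le hs
  rw [probReal_univ] at h3
  linarith

end Regime

end Sampling

end BaryProblem

/-! ## Operation counts -/

namespace Counted

lemma pure_ops {α : Type} (a : α) : (pure a : Counted α).ops = 0 := rfl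

lemma bind_ops {α β : Type} (x : Counted α) (f : α → Counted β) :
    (x >>= f).ops = x.ops + (f x.val).ops := rfl

lemma vec_ops {n : ℕ} {f : Fin n → Counted ℝ} {c : ℕ} (h : ∀ i, (f i).ops = c) :
    (vec f).ops = n * c := by
  simp [vec, h]

lemma loop_ops {α : Type} {f : ℕ → α → Counted α} {c : ℕ} (h : ∀ t a, (f t a).ops = c) (r : ℕ)
    (a : α) : (loop r f a).ops = r * c := by
  induction r with
  | zero => simp [loop, pure_ops]
  | succ r ih => rw [loop, bind_ops, ih, h, Nat.succ_mul]

end Counted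

open Counted

lemma oracleProg_ops {n : ℕ} (μ : ℝ) (C : Matrix (Fin n) (Fin n) ℝ) (u : Fin n → ℝ) (j : Fin n) :
    (oracleProg μ C u j).ops = 6 * n := by
  simp only [oracleProg, bind_ops]
  rw [vec_ops (c := 3) fun _ => rfl, vec_ops (c := 1) fun _ => rfl]
  simp only [draw, Counted.sum]
  ring

lemma batchProg_ops {n : ℕ} (μ : ℝ) (C : Matrix (Fin n) (Fin n) ℝ) (r : ℕ) (ξ : ℕ → Fin n)
    (u : Fin n → ℝ) : (batchProg μ C r ξ u).ops = 7 * n * r + n := by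
  simp only [batchProg, bind_ops]
  rw [loop_ops (c := 7 * n), vec_ops (c := 1) fun _ => rfl]
  · ring
  · intro t a
    rw [bind_ops, oracleProg_ops, vec_ops (c := 1) fun _ => rfl]
    ring

lemma combineProg_ops {n : ℕ} (a A A' : ℝ) (z y : Fin n → ℝ) :
    (combineProg a A A' z y).ops = n * 4 :=
  vec_ops fun _ => rfl

namespace BaryProblem

variable {m n : ℕ} (P : BaryProblem m n)

lemma afterProg_ops {n : ℕ} (s : NodeState n) (w : NodeMessage n) (g : Fin n → ℝ) :
    (afterProg s w g).ops = 8 * n := by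
  simp only [afterProg, bind_ops, pure_ops, combineProg_ops]
  rw [vec_ops (c := 2) fun _ => rfl, vec_ops (c := 2) fun _ => rfl]
  ring

lemma beforeProg_ops (r : ℕ) (ξ : ℕ → Fin n) (s : NodeState n) :
    (P.beforeProg r ξ s).ops = 8 + 5 * n + 7 * n * r := by
  have h : (stepProg P.Lpsi s.A).ops = 7 := rfl
  simp only [beforeProg, bind_ops, pure_ops, combineProg_ops, batchProg_ops, h]
  simp only [Counted.add]
  ring

lemma nodeRun_ops (r : ℕ → ℕ) (ξ : ℕ → ℕ → Fin m → Fin n) (N : ℕ) (i : Fin m) :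
    (P.nodeRun r ξ N i).ops = N * (8 + 13 * n) + 7 * n * ∑ k ∈ Finset.range N, r (k + 1) := by
  induction N with
  | zero => simp [nodeRun, pure_ops]
  | succ N ih =>
    simp only [nodeRun, bind_ops]
    rw [ih, beforeProg_ops, afterProg_ops, Finset.sum_range_succ]
    ring

lemma nodeComplexity_eq (r : ℕ → ℕ) (ξ : ℕ → ℕ → Fin m → Fin n) (N : ℕ) (i : Fin m) :
    P.nodeComplexity r ξ N i =
      N * (8 + 13 * n) + 7 * n * ∑ k ∈ Finset.range N, r (k + 1) + n := by
  simp only [nodeComplexity, nodeOutput, bind_ops]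
  rw [nodeRun_ops, vec_ops (c := 1) fun _ => rfl, mul_one]

variable {P}

lemma one_le_log_div {a δ : ℝ} (ha : 1 ≤ a) (hδ : 0 < δ) (hδ' : δ < 1 / 4) :
    1 ≤ Real.log (a / δ) := by
  rw [Real.le_log_iff_exp_le (by positivity), le_div_iff₀ hδ]
  nlinarith [Real.exp_one_lt_d9, Real.exp_pos 1]

/-- The maximum is bounded by a sum, and the step sizes add up to `A_N ≤ N²/(2L_ψ)`; the factor
`λ_max` in `σ_ψ²` cancels against `L_ψ`. -/
lemma sum_batch_le (hlam : 0 < P.lamMax) (hμ : 0 < P.mu) {κ ε L : ℝ} (hκ : 0 < κ) (hε : 0 < ε)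
    (hL : 0 ≤ L) {N : ℕ} {r : ℕ → ℕ}
    (hr : ∀ k ∈ Finset.Icc 1 N, r k ≤ κ * max 1 (P.sigmaPsiSq * alpha P.Lpsi k * L / ε)) :
    ∑ k ∈ Finset.range N, (r (k + 1) : ℝ) ≤ κ * N + κ * (m * P.mu * N ^ 2 * L / (2 * ε)) := by
  have hLpsi : 0 < P.Lpsi := Lpsi_pos hμ hlam
  have hσ : 0 ≤ P.sigmaPsiSq := mul_nonneg (Nat.cast_nonneg _) hlam.le
  have h1 : ∑ k ∈ Finset.range N, (r (k + 1) : ℝ) ≤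
      ∑ k ∈ Finset.range N, (κ + κ * (P.sigmaPsiSq * L / ε) * alpha P.Lpsi (k + 1)) := by
    refine Finset.sum_le_sum fun k hk => ?_
    have hk' := Finset.mem_range.1 hk
    refine (hr (k + 1) (Finset.mem_Icc.2 ⟨by omega, by omega⟩)).trans ?_
    have ha := alpha_pos hLpsi k
    have h2 : max 1 (P.sigmaPsiSq * alpha P.Lpsi (k + 1) * L / ε) ≤
        1 + P.sigmaPsiSq * alpha P.Lpsi (k + 1) * L / ε :=
      max_le (le_add_of_nonneg_right (by positivity)) (le_add_of_nonneg_left zero_le_one)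
    refine (mul_le_mul_of_nonneg_left h2 hκ.le).trans (le_of_eq ?_)
    ring
  rw [Finset.sum_add_distrib, ← Finset.mul_sum, ← bigA_eq_sum, Finset.sum_const,
    Finset.card_range, nsmul_eq_mul] at h1
  have h3 := mul_le_mul_of_nonneg_left (bigA_le_sq_div hLpsi N)
    (show 0 ≤ κ * (P.sigmaPsiSq * L / ε) by positivity)
  have h4 : κ * (P.sigmaPsiSq * L / ε) * ((N : ℝ) ^ 2 / (2 * P.Lpsi)) =
      κ * (m * P.mu * N ^ 2 * L / (2 * ε)) := by
    rw [Lpsi, sigmaPsiSq]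
    field_simp
  rw [h4] at h3
  linarith

theorem nodeComplexity_le (hn : 0 < n) (hlam : 0 < P.lamMax) (hlam' : 0 < P.lamMinPos)
    (hμ : 0 < P.mu) {κ ε δ : ℝ} (hκ : 0 < κ) (hε : 0 < ε) (hδ : 0 < δ) (hδ' : δ < 1 / 4)
    {N : ℕ} {r : ℕ → ℕ} (hN : 1 ≤ N)
    (hS : 1 ≤ Real.sqrt (P.MF ^ 2 / (P.mu * ε) * P.chi))
    (hNS : N ≤ κ * Real.sqrt (P.MF ^ 2 / (P.mu * ε) * P.chi))
    (hr : ∀ k ∈ Finset.Icc 1 N,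
      r k ≤ κ * max 1 (P.sigmaPsiSq * alpha P.Lpsi k * Real.log (N / δ) / ε))
    (ξ : ℕ → ℕ → Fin m → Fin n) (i : Fin m) :
    (P.nodeComplexity r ξ N i : ℝ) ≤
      (κ * (22 + 7 * κ) + 7 / 2 * κ ^ 3 * (1 + |Real.log κ|)) * (n * max
        (m * P.MF ^ 2 / ε ^ 2 * P.chi *
          Real.log (1 / δ * Real.sqrt (P.MF ^ 2 / (P.mu * ε) * P.chi)))
        (Real.sqrt (P.MF ^ 2 / (P.mu * ε) * P.chi))) := by
  have hchi : 0 < P.chi := div_pos hlam hlam'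
  have hSsq : Real.sqrt (P.MF ^ 2 / (P.mu * ε) * P.chi) ^ 2 = P.MF ^ 2 / (P.mu * ε) * P.chi :=
    Real.sq_sqrt (by positivity)
  set S := Real.sqrt (P.MF ^ 2 / (P.mu * ε) * P.chi) with hSdef
  set T := (m : ℝ) * P.MF ^ 2 / ε ^ 2 * P.chi with hT
  have hT0 : 0 ≤ T := by positivity
  have hN1 : (1 : ℝ) ≤ N := by exact_mod_cast hN
  have hn1 : (1 : ℝ) ≤ n := by exact_mod_cast hn
  have hL := one_le_log_div hN1 hδ hδ'
  have hlogS := one_le_log_div hS hδ hδ'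
  -- Replacing `N` by `κS` costs an additive `ln κ`, absorbed since `ln(S/δ) ≥ 1`.
  have hlogN : Real.log (N / δ) ≤ (1 + |Real.log κ|) * Real.log (S / δ) := by
    have h1 : Real.log (N / δ) ≤ Real.log (κ * (S / δ)) := by
      refine Real.log_le_log (by positivity) ?_
      rw [← mul_div_assoc]
      exact div_le_div_of_nonneg_right hNS hδ.le
    rw [Real.log_mul hκ.ne' (by positivity)] at h1
    have h2 := le_abs_self (Real.log κ)
    nlinarith [mul_le_mul_of_nonneg_left hlogS (abs_nonneg (Real.log κ))]
  have hsum := sum_batch_le hlam hμ hκ hε (by linarith) hr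
  have hdiv : 1 / δ * S = S / δ := by ring
  rw [hdiv]
  set M := max (T * Real.log (S / δ)) S with hM
  have hM1 : T * Real.log (S / δ) ≤ M := le_max_left _ _
  have hM2 : S ≤ M := le_max_right _ _
  have hsq : m * P.mu * (N : ℝ) ^ 2 * Real.log (N / δ) / (2 * ε) ≤
      κ ^ 2 / 2 * (1 + |Real.log κ|) * M := by
    have h1 : (N : ℝ) ^ 2 ≤ κ ^ 2 * S ^ 2 := by
      rw [← mul_pow]
      exact pow_le_pow_left₀ (by positivity) hNS 2
    calc m * P.mu * (N : ℝ) ^ 2 * Real.log (N / δ) / (2 * ε)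
        ≤ m * P.mu * (κ ^ 2 * S ^ 2) * ((1 + |Real.log κ|) * Real.log (S / δ)) / (2 * ε) := by
          gcongr
      _ = κ ^ 2 / 2 * (1 + |Real.log κ|) * (T * Real.log (S / δ)) := by
          rw [hSsq, hT]
          field_simp
      _ ≤ _ := mul_le_mul_of_nonneg_left hM1 (by positivity)
  have hNM : (N : ℝ) ≤ κ * M := hNS.trans (mul_le_mul_of_nonneg_left hM2 hκ.le)
  have hfirst : (N : ℝ) * (8 + 13 * n) + n ≤ n * (22 * N) := by nlinarith
  rw [nodeComplexity_eq]
  push_cast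
  calc (N : ℝ) * (8 + 13 * n) + 7 * n * ∑ k ∈ Finset.range N, (r (k + 1) : ℝ) + n
      ≤ n * (22 * N) + 7 * n * (κ * N + κ * (κ ^ 2 / 2 * (1 + |Real.log κ|) * M)) := by
        have h2 := hsum.trans (add_le_add_right (mul_le_mul_of_nonneg_left hsq hκ.le) _)
        have h3 := mul_le_mul_of_nonneg_left h2 (show (0 : ℝ) ≤ 7 * n by positivity)
        linarith
    _ = n * ((22 + 7 * κ) * N + 7 / 2 * κ ^ 3 * (1 + |Real.log κ|) * M) := by ring
    _ ≤ n * ((22 + 7 * κ) * (κ * M) + 7 / 2 * κ ^ 3 * (1 + |Real.log κ|) * M) := by gcongr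
    _ = _ := by ring

/-! ## The parameters of the theorem -/

/-- The `8` in `N ≥ 8S` gives `A_N ≥ N²/(8L_ψ) ≥ 8S²/L_ψ = 8 M_F²/(ε λ⁺_min)`, so the squared dual
radius is at most `A_N ε / 8`. -/
lemma regime_of_le {m n : ℕ} {P : BaryProblem m n} (hm : 2 ≤ m) (hG : P.G.Connected)
    (hμ : 0 < P.mu) (hq : ∀ i, P.q i ∈ stdSimplex ℝ (Fin n)) (hn : 0 < n) {ε δ : ℝ} (hε : 0 < ε)
    (hδ : 0 < δ) (hδ' : δ < 1 / 4) {N : ℕ} {r : ℕ → ℕ} (hN : 1 ≤ N)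
    (hNS : 8 * Real.sqrt (P.MF ^ 2 / (P.mu * ε) * P.chi) ≤ N)
    (hr : ∀ k ∈ Finset.Icc 1 N,
      3600 * max 1 (P.sigmaPsiSq * alpha P.Lpsi k * Real.log (N / δ) / ε) ≤ r k) :
    Regime P r N ε (Real.log (N / δ)) := by
  have hlam' := P.lamMinPos_pos hm hG ⟨0, hn⟩
  have hle := P.lamMinPos_le_lamMax hm hG ⟨0, hn⟩
  have hlam := hlam'.trans_le hle
  have hchi : 0 < P.chi := div_pos hlam hlam'
  refine ⟨hμ, by omega, hn, hlam', hle, hq, hε, one_le_log_div (by exact_mod_cast hN) hδ hδ', hN,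
    ?_, fun k hk => ?_, fun k hk => ?_⟩
  · have h1 := pow_le_pow_left₀ (by positivity) hNS 2
    rw [mul_pow, Real.sq_sqrt (by positivity)] at h1
    have h2 := sq_div_le_bigA (Lpsi_pos hμ hlam) N
    have h3 : P.MF ^ 2 / P.lamMinPos = 8 ^ 2 * (P.MF ^ 2 / (P.mu * ε) * P.chi) /
        (8 * P.Lpsi) * ε / 8 := by
      rw [Lpsi, chi]
      field_simp
    rw [h3]
    have h4 := (div_le_div_of_nonneg_right h1
      (mul_pos (by norm_num : (0 : ℝ) < 8) (Lpsi_pos hμ hlam)).le).trans h2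
    have h5 := mul_le_mul_of_nonneg_right h4 hε.le
    linarith
  · have h := hr (k + 1) (Finset.mem_Icc.2 ⟨by omega, by omega⟩)
    have h1 := le_max_left 1 (P.sigmaPsiSq * alpha P.Lpsi (k + 1) * Real.log (N / δ) / ε)
    have h2 : (0 : ℝ) < r (k + 1) := by linarith
    exact_mod_cast h2
  · have h := hr (k + 1) (Finset.mem_Icc.2 ⟨by omega, by omega⟩)
    have h1 := le_max_right 1 (P.sigmaPsiSq * alpha P.Lpsi (k + 1) * Real.log (N / δ) / ε)
    rw [div_le_iff₀ hε, sigmaPsiSq] at h1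
    have h2 := mul_le_mul_of_nonneg_right h hε.le
    rw [sigmaPsiSq] at h2
    linarith

end BaryProblem

end WBary

/-! ### Assembly of the theorem -/

theorem mainTheorem4 :
    ∃ cN > (0 : ℝ), ∃ cr > (0 : ℝ), ∀ κ > (0 : ℝ), ∃ cT > (0 : ℝ),
      ∀ (m n : ℕ) (P : WBary.BaryProblem m n),
        2 ≤ m → P.G.Connected → 0 < P.mu → (∀ i, P.q i ∈ stdSimplex ℝ (Fin n)) →
      ∀ ε δ : ℝ, 0 < ε → 0 < δ → δ < 1 / 4 →
      ∀ (N : ℕ) (r : ℕ → ℕ), 1 ≤ N →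
        cN * Real.sqrt (P.MF ^ 2 / (P.mu * ε) * P.chi) ≤ N →
        (∀ k ∈ Finset.Icc 1 N,
          cr * max 1 (P.sigmaPsiSq * WBary.alpha P.Lpsi k * Real.log (N / δ) / ε) ≤ r k) →
      -- accuracy
      (∃ ystar, P.IsDualSolution ystar ∧ ‖ystar‖ ≤ P.MF / Real.sqrt P.lamMinPos) ∧
      (∃ pstar, P.IsBarycenter pstar ∧
        ∀ Ry : ℝ, (∃ ystar, P.IsDualSolution ystar ∧ ‖ystar‖ ≤ Ry) →
          Ry ≤ P.MF / Real.sqrt P.lamMinPos →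
        ∀ (Ω : Type*) [MeasurableSpace Ω] (Pr : Measure Ω) [IsProbabilityMeasure Pr]
          (ξ : ℕ → ℕ → Ω → Fin m → Fin n), WBary.IsSampling P.q Pr ξ →
          1 - 4 * δ ≤ Pr.real {ω |
            ∑ i, WBary.regW P.mu P.C (P.q i)
                (WBary.block (P.output r (fun k s => ξ k s ω) N) i)
              - ∑ i, WBary.regW P.mu P.C (P.q i) pstar ≤ ε ∧
            (0 < Ry → ‖P.sqrtW (P.output r (fun k s => ξ k s ω) N)‖ ≤ ε / Ry)}) ∧
      -- complexity
      (1 ≤ Real.sqrt (P.MF ^ 2 / (P.mu * ε) * P.chi) →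
        N ≤ κ * Real.sqrt (P.MF ^ 2 / (P.mu * ε) * P.chi) →
        (∀ k ∈ Finset.Icc 1 N,
          r k ≤ κ * max 1 (P.sigmaPsiSq * WBary.alpha P.Lpsi k * Real.log (N / δ) / ε)) →
        ∀ (ξ : ℕ → ℕ → Fin m → Fin n) (i : Fin m),
          (P.nodeComplexity r ξ N i : ℝ) ≤ cT * (n * max
            (m * P.MF ^ 2 / ε ^ 2 * P.chi *
              Real.log (1 / δ * Real.sqrt (P.MF ^ 2 / (P.mu * ε) * P.chi)))
            (Real.sqrt (P.MF ^ 2 / (P.mu * ε) * P.chi)))) := by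
  refine ⟨8, by norm_num, 3600, by norm_num, fun κ hκ =>
    ⟨κ * (22 + 7 * κ) + 7 / 2 * κ ^ 3 * (1 + |Real.log κ|), by positivity, ?_⟩⟩
  intro m n P hm hG hμ hq ε δ hε hδ hδ' N r hN hNS hr
  have hn : 0 < n := by
    rcases Nat.eq_zero_or_pos n with rfl | hn
    · simpa using (hq ⟨0, by omega⟩).2
    · exact hn
  have H := WBary.BaryProblem.regime_of_le hm hG hμ hq hn hε hδ hδ' hN hNS hr
  obtain ⟨hdual, pstar, hp, hval⟩ :=
    WBary.BaryProblem.exists_dual_solution_and_barycenter hm hG hμ hq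
  refine ⟨hdual, ⟨pstar, hp, ?_⟩, fun hS hNκ hrκ ξ i =>
    WBary.BaryProblem.nodeComplexity_le hn H.lamMax_pos H.lamMinPos_pos hμ hκ hε hδ hδ' hN hS hNκ
      hrκ ξ i⟩
  rintro R ⟨y, hy, hyR⟩ hR Ω _ Pr _ ξ hs
  obtain ⟨z, hz, hzn⟩ := hdual
  have hN1 : (1 : ℝ) ≤ N := by exact_mod_cast hN
  have hprob := H.measure_accuracy hs hz hzn hR hy hyR
  rw [Real.exp_neg, Real.exp_log (by positivity), inv_div] at hprob
  -- With `L = ln(N/δ)` each bad event has probability at most `δ/N`, and `2N + 2 ≤ 4N` because `N ≥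
  -- 1`.
  have hδN : (2 * (N : ℝ) + 2) * (δ / N) ≤ 4 * δ := by
    rw [mul_div_assoc', div_le_iff₀ (by positivity)]
    nlinarith
  refine (sub_le_sub_left hδN 1).trans (hprob.trans (measureReal_mono ?_))
  rintro w ⟨h1, h2⟩
  refine ⟨?_, fun hR0 => ?_⟩
  · have h3 := hval y hy
    rw [WBary.BaryProblem.objective] at h3
    linarith
  · rw [le_div_iff₀ hR0, mul_comm]
    exact h2
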